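/- **Theorem 1.1.** Let $d\ge 0$ be an integer and let $1\le p_0,p_1,p_2,q_1,q_2,q_3\le\infty$ satisfy $$\tfrac1{p_0}\le \tfrac1{p_1}+\tfrac1{p_2}\qquad\text{and}\qquad 1+\tfrac1{q_3}\le \tfrac1{q_1}+\tfrac1{q_2}.$$ For $f\in\mathcal S'(\mathbb R^d)$ let $Vf(t,\nu)=\int f(y)\,e^{-2\pi i y\cdot\nu}e^{-\|y-t\|^2}\,dy$ (in the sense of distributions), let $\|f\|_{M^{p,q}}=\big\|\,\nu\mapsto\|Vf(\cdot,\nu)\|_{L^p(\mathbb R^d)}\big\|_{L^q(\mathbb R^d)}$, and let $M^{p,q}$ be the space of all $f\in\mathcal S'(\mathbb R^d)$ with $\|f\|_{M^{p,q}}<\infty$. Fix a nonzero Schwartz function $\varphi\in\mathcal S(\mathbb R^d)$. For $\sigma\in\mathcal S'(\mathbb R^{3d})$ let $$\mathcal V_\varphi\sigma(x,t_1,t_2,\xi_1,\xi_2,\nu)=\iiint\sigma(\tilde x,\tilde\xi_1,\tilde\xi_2)\,\varphi(x-\tilde x)\,\varphi(\xi_1-\tilde\xi_1)\,\varphi(\xi_2-\tilde\xi_2)\,e^{-2\pi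 i(\tilde x\cdot\nu-t_1\cdot\tilde\xi_1-t_2\cdot\tilde\xi_2)}\,d\tilde x\,d\tilde\xi_1\,d\tilde\xi_2$$ (in the sense of distributions) and $$\|\sigma\|_{\mathcal M^{(\infty,1,1);(\infty,\infty,1)}}=\int\sup_{\xi_1,\xi_2}\iint\sup_x|\mathcal V_\varphi\sigma(x,t_1,t_2,\xi_1,\xi_2,\nu)|\,dt_1\,dt_2\,d\nu .$$ Then there is a constant $C>0$, depending only on $d$, the $p_i$, the $q_i$ and the window $\varphi$, such that for every $\sigma\in\mathcal S'(\mathbb R^{3d})$ with $\|\sigma\|_{\mathcal M^{(\infty,1,1);(\infty,\infty,1)}}<\infty$ the bilinear pseudodifferential operator $$T_\sigma(f_1,f_2)(x)=\iint e^{2\pi i x\cdot(\xi_1+\xi_2)}\sigma(x,\xi_1,\xi_2)\,\widehat{f_1}(\xi_1)\,\widehat{f_2}(\xi_2)\,d\xi_2\,d\xi_1,$$ initially defined for $f_1,f_2\in\mathcal S(\mathbb R^d)$ as a tempered distribution, that is, $\langle T_\sigma(f_1,f_2),g\rangle=\langle\sigma,\ e^{2\pi i x\cdot(\xi_1+\xi_2)}\widehat{f_1}(\xi_1)\widehat{f_2}(\xi_2)g(x)\rangle$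 for $g\in\mathcal S(\mathbb R^d)$ (bilinear pairings, $\widehat f(\xi)=\int f(x)e^{-2\pi i x\cdot\xi}dx$), extends to a bilinear operator $M^{p_1,q_1}\times M^{p_2,q_2}\to M^{p_0,q_3}$ satisfying $$\|T_\sigma(f_1,f_2)\|_{M^{p_0,q_3}}\le C\,\|\sigma\|_{\mathcal M^{(\infty,1,1);(\infty,\infty,1)}}\,\|f_1\|_{M^{p_1,q_1}}\,\|f_2\|_{M^{p_2,q_2}}$$ for all $f_1\in M^{p_1,q_1}$ and $f_2\in M^{p_2,q_2}$. -/

import Mathlib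

open MeasureTheory Filter Topology
open scoped SchwartzMap FourierTransform ENNReal NNReal ContDiff

noncomputable section

/-- `ℝᵈ` with its Euclidean structure and Lebesgue measure. -/
abbrev Rd (d : ℕ) : Type := EuclideanSpace ℝ (Fin d)

section Schwartz

variable {E F : Type*} [NormedAddCommGroup E] [NormedSpace ℝ E]
  [NormedAddCommGroup F] [NormedSpace ℝ F]

theorem norm_iteratedFDeriv_comp_le_of_norm_le_one {G : Type*} [NormedAddCommGroup G]
    [NormedSpace ℝ G] (L : E →L[ℝ] F) (hL : ‖L‖ ≤ 1) (f : F → G) (hf : ContDiff ℝ ∞ f) (n : ℕ)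
    (x : E) : ‖iteratedFDeriv ℝ n (fun z => f (L z)) x‖ ≤ ‖iteratedFDeriv ℝ n f (L x)‖ := by
  have h := L.iteratedFDeriv_comp_right hf x (i := n) (mod_cast le_top)
  change iteratedFDeriv ℝ n (fun z => f (L z)) x = _ at h
  rw [h]
  refine (ContinuousMultilinearMap.norm_compContinuousLinearMap_le _ _).trans ?_
  simp only [Finset.prod_const, Finset.card_univ, Fintype.card_fin]
  exact mul_le_of_le_one_right (norm_nonneg _) (pow_le_one₀ (norm_nonneg _) hL)

/-- The tensor product `(f ⊗ g)(x, y) = f x * g y` of Schwartz functions, as a continuous linear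
map in `f`. -/
def tensorLeft (g : 𝓢(F, ℂ)) : 𝓢(E, ℂ) →L[ℂ] 𝓢(E × F, ℂ) :=
  SchwartzMap.mkCLM (σ := RingHom.id ℂ) (fun f z => f z.1 * g z.2)
    (fun f f' z => by simp [add_mul])
    (fun a f z => by simp [mul_assoc])
    (fun f => ((f.smooth ⊤).comp contDiff_fst).mul ((g.smooth ⊤).comp contDiff_snd))
    (by
      rintro ⟨k, n⟩
      refine ⟨Finset.Iic (k, n), ∑ i ∈ Finset.range (n + 1), (n.choose i : ℝ) *
          (SchwartzMap.seminorm ℂ 0 (n - i) g + SchwartzMap.seminorm ℂ k (n - i) g),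
        Finset.sum_nonneg fun i _ => by positivity, fun f z => ?_⟩
      have hmul := norm_iteratedFDeriv_mul_le (𝕜 := ℝ) (N := ∞)
        (f := fun z : E × F => f z.1) (g := fun z : E × F => g z.2)
        ((f.smooth ⊤).comp contDiff_fst) ((g.smooth ⊤).comp contDiff_snd) z (n := n)
        (mod_cast le_top)
      refine (mul_le_mul_of_nonneg_left hmul (by positivity)).trans ?_
      rw [Finset.mul_sum, Finset.sum_mul]
      refine Finset.sum_le_sum fun i hi => ?_
      have hi' : i ≤ n := Nat.lt_succ_iff.mp (Finset.mem_range.mp hi)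
      have h1 := norm_iteratedFDeriv_comp_le_of_norm_le_one (ContinuousLinearMap.fst ℝ E F)
        (ContinuousLinearMap.norm_fst_le ℝ E F) f (f.smooth ⊤) i z
      have h2 := norm_iteratedFDeriv_comp_le_of_norm_le_one (ContinuousLinearMap.snd ℝ E F)
        (ContinuousLinearMap.norm_snd_le ℝ E F) g (g.smooth ⊤) (n - i) z
      simp only [ContinuousLinearMap.coe_fst', ContinuousLinearMap.coe_snd'] at h1 h2
      have hz : ‖z‖ ^ k ≤ ‖z.1‖ ^ k + ‖z.2‖ ^ k := by
        rw [Prod.norm_def]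
        rcases max_cases ‖z.1‖ ‖z.2‖ with h | h <;> rw [h.1]
        · exact le_add_of_nonneg_right (by positivity)
        · exact le_add_of_nonneg_left (by positivity)
      set S := ((Finset.Iic (k, n)).sup (schwartzSeminormFamily ℂ E ℂ)) f with hS
      have hSk : ∀ k' ≤ k, SchwartzMap.seminorm ℂ k' i f ≤ S := fun k' hk' =>
        Seminorm.le_def.mp (Finset.le_sup (f := schwartzSeminormFamily ℂ E ℂ)
          (b := (k', i)) (Finset.mem_Iic.mpr (Prod.mk_le_mk.mpr ⟨hk', hi'⟩))) f
      have hS0 : 0 ≤ S := apply_nonneg _ _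
      have a1 := (SchwartzMap.le_seminorm ℂ k i f z.1).trans (hSk k le_rfl)
      have a0 := (SchwartzMap.norm_iteratedFDeriv_le_seminorm ℂ f i z.1).trans (hSk 0 (Nat.zero_le _))
      have b1 := SchwartzMap.le_seminorm ℂ k (n - i) g z.2
      have b0 := SchwartzMap.norm_iteratedFDeriv_le_seminorm ℂ g (n - i) z.2
      set A := ‖iteratedFDeriv ℝ i f z.1‖
      set B := ‖iteratedFDeriv ℝ (n - i) g z.2‖
      set P := SchwartzMap.seminorm ℂ 0 (n - i) g
      set Q := SchwartzMap.seminorm ℂ k (n - i) g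
      have hA : 0 ≤ A := norm_nonneg _
      have hB : 0 ≤ B := norm_nonneg _
      calc ‖z‖ ^ k * ((n.choose i : ℝ) * ‖iteratedFDeriv ℝ i (fun z : E × F => f z.1) z‖ *
            ‖iteratedFDeriv ℝ (n - i) (fun z : E × F => g z.2) z‖)
          ≤ (‖z.1‖ ^ k + ‖z.2‖ ^ k) * ((n.choose i : ℝ) * A * B) := by gcongr
        _ = (n.choose i : ℝ) * ((‖z.1‖ ^ k * A) * B + A * (‖z.2‖ ^ k * B)) := by ring
        _ ≤ (n.choose i : ℝ) * (S * P + S * Q) := by gcongr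
        _ = (n.choose i : ℝ) * (P + Q) * S := by ring)

@[simp]
theorem tensorLeft_apply (g : 𝓢(F, ℂ)) (f : 𝓢(E, ℂ)) (z : E × F) :
    tensorLeft g f z = f z.1 * g z.2 := rfl

/-- The Schwartz function `y ↦ φ (x - y)`. -/
def reflTranslate (x : E) (φ : 𝓢(E, ℂ)) : 𝓢(E, ℂ) :=
  SchwartzMap.compSubConstCLM ℂ x
    (SchwartzMap.compCLMOfContinuousLinearEquiv ℂ (ContinuousLinearEquiv.neg ℝ) φ)

@[simp]
theorem reflTranslate_apply (x : E) (φ : 𝓢(E, ℂ)) (y : E) :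
    reflTranslate x φ y = φ (x - y) := by
  simp [reflTranslate]

/-- The character `e(s) = e^{2πis}` of `ℝ`. -/
def expTwoPiI (s : ℝ) : ℂ := Complex.exp (2 * Real.pi * Complex.I * s)

theorem norm_expTwoPiI (s : ℝ) : ‖expTwoPiI s‖ = 1 := by
  have : (2 * Real.pi * Complex.I * s : ℂ) = ((2 * Real.pi * s : ℝ) : ℂ) * Complex.I := by
    push_cast; ring
  rw [expTwoPiI, this, Complex.norm_exp_ofReal_mul_I]

theorem hasTemperateGrowth_expTwoPiI : expTwoPiI.HasTemperateGrowth := by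
  have hd : ∀ n : ℕ, iteratedDeriv n expTwoPiI =
      fun s => (2 * Real.pi * Complex.I) ^ n * expTwoPiI s := by
    intro n
    induction n with
    | zero => simp
    | succ n ih =>
      rw [iteratedDeriv_succ, ih]
      funext s
      have h : HasDerivAt expTwoPiI (expTwoPiI s * (2 * Real.pi * Complex.I)) s := by
        have h0 : HasDerivAt (fun s : ℝ => (2 * Real.pi * Complex.I * s : ℂ))
            (2 * Real.pi * Complex.I) s := by
          simpa using (Complex.ofRealCLM.hasDerivAt (x := s)).const_mul (2 * Real.pi * Complex.I)
        exact h0.cexp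
      rw [(h.const_mul _).deriv]
      ring
  refine ⟨?_, fun n => ⟨0, (2 * Real.pi) ^ n, fun s => ?_⟩⟩
  · unfold expTwoPiI
    exact (contDiff_const.mul Complex.ofRealCLM.contDiff).cexp
  · rw [norm_iteratedFDeriv_eq_norm_iteratedDeriv, hd]
    simp [norm_expTwoPiI, abs_of_pos Real.pi_pos]

end Schwartz

section Gaussian

variable {E : Type*} [NormedAddCommGroup E] [InnerProductSpace ℝ E]

/-- The Gaussian `x ↦ e^{-‖x‖²}` as a Schwartz function. -/
def gaussianWindow (E : Type*) [NormedAddCommGroup E] [InnerProductSpace ℝ E] : 𝓢(E, ℂ) where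
  toFun x := (Real.exp (-‖x‖ ^ 2) : ℂ)
  smooth' := by
    exact Complex.ofRealCLM.contDiff.comp (Real.contDiff_exp.comp (contDiff_norm_sq ℝ).neg)
  decay' := by
    intro k n
    have hd : ∀ i : ℕ, iteratedDeriv i (fun u : ℝ => (Real.exp u : ℂ)) =
        fun u : ℝ => (Real.exp u : ℂ) := by
      intro i
      induction i with
      | zero => simp
      | succ i ih =>
        rw [iteratedDeriv_succ, ih]
        funext u
        exact (Real.hasDerivAt_exp u).ofReal_comp.deriv
    have hg : ContDiff ℝ ∞ (fun u : ℝ => (Real.exp u : ℂ)) :=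
      Complex.ofRealCLM.contDiff.comp Real.contDiff_exp
    have ht : (fun x : E => -‖x‖ ^ 2).HasTemperateGrowth :=
      (Function.hasTemperateGrowth_norm_sq E).neg
    obtain ⟨m, C, hC, hb⟩ := ht.norm_iteratedFDeriv_le_uniform n
    refine ⟨n.factorial * (max C 1) ^ n * ((k + m * n).factorial * Real.exp 2), fun x => ?_⟩
    have hD1 : 1 ≤ max C 1 * (1 + ‖x‖) ^ m :=
      one_le_mul_of_one_le_of_one_le (le_max_right _ _) (one_le_pow₀ (by simp))
    have h := norm_iteratedFDeriv_comp_le (n := n) (C := Real.exp (-‖x‖ ^ 2))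
      (D := max C 1 * (1 + ‖x‖) ^ m) hg ht.1 (mod_cast le_top) x
      (fun i _ => by
        rw [norm_iteratedFDeriv_eq_norm_iteratedDeriv, hd, Complex.norm_real,
          Real.norm_of_nonneg (Real.exp_pos _).le])
      (fun i hi hin => by
        refine ((hb i hin x).trans ?_).trans (le_self_pow₀ hD1 (by omega))
        gcongr
        exact le_max_left _ _)
    have hexp : (1 + ‖x‖) ^ (k + m * n) * Real.exp (-‖x‖ ^ 2) ≤
        (k + m * n).factorial * Real.exp 2 := by
      have h1 := Real.pow_div_factorial_le_exp (1 + ‖x‖) (by positivity) (k + m * n)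
      rw [div_le_iff₀ (by positivity)] at h1
      calc (1 + ‖x‖) ^ (k + m * n) * Real.exp (-‖x‖ ^ 2)
          ≤ (Real.exp (1 + ‖x‖) * (k + m * n).factorial) * Real.exp (-‖x‖ ^ 2) := by gcongr
        _ = (k + m * n).factorial * Real.exp (1 + ‖x‖ + -‖x‖ ^ 2) := by
            rw [Real.exp_add (1 + ‖x‖)]; ring
        _ ≤ _ := by
            gcongr
            nlinarith [sq_nonneg (‖x‖ - 1 / 2)]
    change ‖x‖ ^ k * ‖iteratedFDeriv ℝ n ((fun u : ℝ => (Real.exp u : ℂ)) ∘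
      (fun x : E => -‖x‖ ^ 2)) x‖ ≤ _
    calc _ ≤ (1 + ‖x‖) ^ k * (n.factorial * Real.exp (-‖x‖ ^ 2) *
            (max C 1 * (1 + ‖x‖) ^ m) ^ n) := by
            gcongr
            linarith
      _ = n.factorial * (max C 1) ^ n * ((1 + ‖x‖) ^ (k + m * n) * Real.exp (-‖x‖ ^ 2)) := by
            rw [mul_pow, ← pow_mul, pow_add]; ring
      _ ≤ _ := by gcongr

@[simp]
theorem gaussianWindow_apply (x : E) : gaussianWindow E x = (Real.exp (-‖x‖ ^ 2) : ℂ) := rfl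

theorem hasTemperateGrowth_inner_clm {D : Type*} [NormedAddCommGroup D] [NormedSpace ℝ D]
    (A B : D →L[ℝ] E) : (fun z : D => inner ℝ (A z) (B z)).HasTemperateGrowth :=
  (innerSL ℝ).bilinear_hasTemperateGrowth A.hasTemperateGrowth B.hasTemperateGrowth

theorem hasTemperateGrowth_phase {D : Type*} [NormedAddCommGroup D] [NormedSpace ℝ D]
    (L : D →L[ℝ] ℝ) : (fun z : D => expTwoPiI (L z)).HasTemperateGrowth :=
  hasTemperateGrowth_expTwoPiI.comp L.hasTemperateGrowth

end Gaussian

/-! ### Modulation spaces -/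

section Modulation

variable {d : ℕ}

/-- The test function `y ↦ e^{-2πi y·ν} φ(y - t)`. -/
def timeFreqShift (φ : 𝓢(Rd d, ℂ)) (t ν : Rd d) : 𝓢(Rd d, ℂ) :=
  SchwartzMap.smulLeftCLM ℂ (fun y : Rd d => expTwoPiI (-inner ℝ y ν))
    (SchwartzMap.compSubConstCLM ℂ t φ)

theorem timeFreqShift_apply (φ : 𝓢(Rd d, ℂ)) (t ν y : Rd d) :
    timeFreqShift φ t ν y = expTwoPiI (-inner ℝ y ν) * φ (y - t) := by
  have h : (fun y : Rd d => expTwoPiI (-inner ℝ y ν)).HasTemperateGrowth :=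
    hasTemperateGrowth_expTwoPiI.comp (by fun_prop)
  simp [timeFreqShift, SchwartzMap.smulLeftCLM_apply_apply h]

/-- The short-time Fourier transform with Gaussian window,
`V f (t, ν) = ∫ f(y) e^{-2πi y·ν} e^{-‖y - t‖²} dy`, of a tempered distribution `f`. -/
def stft (f : 𝓢'(Rd d, ℂ)) (t ν : Rd d) : ℂ :=
  f (timeFreqShift (gaussianWindow (Rd d)) t ν)

/-- The restriction `y ↦ H (y, s)` of a Schwartz function on a product to a slice. -/
def sliceCLM {E P : Type*} [NormedAddCommGroup E] [NormedSpace ℝ E] [NormedAddCommGroup P]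
    [NormedSpace ℝ P] (s : P) : 𝓢(E × P, ℂ) →L[ℂ] 𝓢(E, ℂ) :=
  SchwartzMap.compCLM ℂ (g := fun y : E => (y, s))
    (by
      have h := (ContinuousLinearMap.inl ℝ E P).hasTemperateGrowth.add
        (Function.HasTemperateGrowth.const ((0, s) : E × P))
      convert h using 1
      funext y
      simp)
    ⟨1, 1, fun y => by
      have : ‖y‖ ≤ ‖(y, s)‖ := by simp [Prod.norm_def]
      simp only [pow_one, one_mul]
      linarith⟩

theorem sliceCLM_apply {E P : Type*} [NormedAddCommGroup E] [NormedSpace ℝ E]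
    [NormedAddCommGroup P] [NormedSpace ℝ P] (s : P) (H : 𝓢(E × P, ℂ)) (y : E) :
    sliceCLM s H y = H (y, s) := rfl

theorem continuous_sliceCLM {E P : Type*} [NormedAddCommGroup E] [NormedSpace ℝ E]
    [NormedAddCommGroup P] [NormedSpace ℝ P] (H : 𝓢(E × P, ℂ)) :
    Continuous (fun s : P => sliceCLM s H) := by
  rw [continuous_iff_continuousAt]
  intro s₀
  rw [ContinuousAt, (schwartz_withSeminorms ℂ E ℂ).tendsto_nhds]
  rintro ⟨k, n⟩ ε hε
  set M := SchwartzMap.seminorm ℂ k (n + 1) H with hM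
  have hM0 : 0 ≤ M := apply_nonneg _ _
  have key : ∀ s : P, SchwartzMap.seminorm ℂ k n (sliceCLM s H - sliceCLM s₀ H) ≤
      M * ‖s - s₀‖ := by
    intro s
    refine SchwartzMap.seminorm_le_bound ℂ k n _ (by positivity) fun y => ?_
    have hs : ∀ a : E × P, ContDiff ℝ ∞ (fun z : E × P => H (z + a)) := fun a =>
      (H.smooth ⊤).comp (contDiff_id.add contDiff_const)
    have h1 := norm_iteratedFDeriv_comp_le_of_norm_le_one (ContinuousLinearMap.inl ℝ E P)
      (ContinuousLinearMap.norm_inl_le_one ℝ E P)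
      ((fun z : E × P => H (z + (0, s))) - (fun z : E × P => H (z + (0, s₀))))
      ((hs _).sub (hs _)) n y
    rw [iteratedFDeriv_sub_apply ((hs _).of_le (mod_cast le_top)).contDiffAt
      ((hs _).of_le (mod_cast le_top)).contDiffAt, iteratedFDeriv_comp_add_right,
      iteratedFDeriv_comp_add_right] at h1
    have h2 : (fun y : E => ((fun z : E × P => H (z + (0, s))) -
        (fun z : E × P => H (z + (0, s₀)))) (ContinuousLinearMap.inl ℝ E P y)) =
        (sliceCLM s H - sliceCLM s₀ H : 𝓢(E, ℂ)) := by
      funext y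
      simp [sliceCLM_apply]
    rw [h2] at h1
    simp only [ContinuousLinearMap.inl_apply, Prod.mk_add_mk, add_zero, zero_add] at h1
    have hdiff : Differentiable ℝ (iteratedFDeriv ℝ n H) :=
      (H.smooth ⊤).differentiable_iteratedFDeriv (mod_cast WithTop.coe_lt_top _)
    have hconv : Convex ℝ {z : E × P | z.1 = y} :=
      (convex_singleton y).is_linear_preimage (ContinuousLinearMap.fst ℝ E P).isBoundedLinearMap.toIsLinearMap
    have h3 := hconv.norm_image_sub_le_of_norm_fderiv_le (𝕜 := ℝ)
      (f := fun z => ‖y‖ ^ k • iteratedFDeriv ℝ n H z) (C := M) (x := (y, s₀)) (y := (y, s))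
      (fun z _ => (hdiff z).fun_const_smul _)
      (fun z hz => by
        have hz' : z.1 = y := hz
        rw [fderiv_fun_const_smul (hdiff z), norm_smul, norm_fderiv_iteratedFDeriv, norm_pow,
          norm_norm]
        refine le_trans ?_ (SchwartzMap.le_seminorm ℂ k (n + 1) H z)
        gcongr
        rw [← hz']
        exact norm_fst_le z) rfl rfl
    rw [← smul_sub, norm_smul, norm_pow, norm_norm] at h3
    refine (mul_le_mul_of_nonneg_left h1 (by positivity)).trans (h3.trans_eq ?_)
    simp [Prod.norm_def]
  have hlim : Tendsto (fun s : P => M * ‖s - s₀‖) (𝓝 s₀) (𝓝 0) := by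
    have : Continuous (fun s : P => M * ‖s - s₀‖) := by fun_prop
    simpa using this.tendsto s₀
  filter_upwards [hlim.eventually_lt_const hε] with s hs
  exact (key s).trans_lt hs

theorem continuous_stft (f : 𝓢'(Rd d, ℂ)) :
    Continuous (fun z : Rd d × Rd d => stft f z.1 z.2) := by
  set γ := gaussianWindow (Rd d) with hγ
  have hshear : (fun z : Rd d × Rd d × Rd d => (z.1 - z.2.1, z.2)).HasTemperateGrowth :=
    ((ContinuousLinearMap.fst ℝ (Rd d) (Rd d × Rd d) -
      (ContinuousLinearMap.fst ℝ (Rd d) (Rd d)).comp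
        (ContinuousLinearMap.snd ℝ (Rd d) (Rd d × Rd d))).prod
      (ContinuousLinearMap.snd ℝ (Rd d) (Rd d × Rd d))).hasTemperateGrowth
  have hup : ∃ (k : ℕ) (C : ℝ), ∀ z : Rd d × Rd d × Rd d,
      ‖z‖ ≤ C * (1 + ‖(z.1 - z.2.1, z.2)‖) ^ k := by
    refine ⟨1, 2, fun z => ?_⟩
    have h1 : ‖z.1 - z.2.1‖ ≤ ‖(z.1 - z.2.1, z.2)‖ := norm_fst_le (z.1 - z.2.1, z.2)
    have h2 : ‖z.2‖ ≤ ‖(z.1 - z.2.1, z.2)‖ := norm_snd_le (z.1 - z.2.1, z.2)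
    have h3 : ‖z.2.1‖ ≤ ‖z.2‖ := norm_fst_le z.2
    have h4 : ‖z.1‖ ≤ ‖z.1 - z.2.1‖ + ‖z.2.1‖ := by
      simpa using norm_add_le (z.1 - z.2.1) z.2.1
    have h5 : ‖z‖ = max ‖z.1‖ ‖z.2‖ := rfl
    rw [h5, pow_one]
    exact max_le (by linarith) (by linarith [norm_nonneg (z.1 - z.2.1)])
  have hphase : (fun z : Rd d × Rd d × Rd d =>
      expTwoPiI (-inner ℝ z.1 z.2.2)).HasTemperateGrowth :=
    hasTemperateGrowth_expTwoPiI.comp (hasTemperateGrowth_inner_clm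
      (ContinuousLinearMap.fst ℝ (Rd d) (Rd d × Rd d))
      ((ContinuousLinearMap.snd ℝ (Rd d) (Rd d)).comp
        (ContinuousLinearMap.snd ℝ (Rd d) (Rd d × Rd d)))).neg
  set H : 𝓢(Rd d × Rd d × Rd d, ℂ) :=
    SchwartzMap.smulLeftCLM ℂ (fun z : Rd d × Rd d × Rd d => expTwoPiI (-inner ℝ z.1 z.2.2))
      (SchwartzMap.compCLM ℂ hshear hup (tensorLeft (tensorLeft γ γ) γ)) with hH
  have hslice : ∀ z : Rd d × Rd d, sliceCLM z H = (γ z.1 * γ z.2) • timeFreqShift γ z.1 z.2 := by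
    rintro ⟨t, ν⟩
    ext y
    simp only [sliceCLM_apply, hH, SchwartzMap.smulLeftCLM_apply_apply hphase,
      SchwartzMap.compCLM_apply, Function.comp, tensorLeft_apply, smul_apply,
      timeFreqShift_apply, smul_eq_mul]
    ring
  have hγ0 : ∀ x, γ x ≠ 0 := fun x => by
    rw [hγ, gaussianWindow_apply]
    exact_mod_cast (Real.exp_pos _).ne'
  have hst : (fun z : Rd d × Rd d => stft f z.1 z.2) =
      fun z => (γ z.1 * γ z.2)⁻¹ * f (sliceCLM z H) := by
    funext z
    rw [hslice, map_smul, smul_eq_mul, ← mul_assoc,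
      inv_mul_cancel₀ (mul_ne_zero (hγ0 _) (hγ0 _)), one_mul, stft]
  rw [hst]
  refine Continuous.mul (Continuous.inv₀ ?_ fun z => mul_ne_zero (hγ0 _) (hγ0 _)) ?_
  · exact (γ.continuous.comp continuous_fst).mul (γ.continuous.comp continuous_snd)
  · exact (ContinuousLinearMap.continuous f).comp (continuous_sliceCLM H)

theorem measurable_eLpNorm_of_continuous {X Y : Type*} [TopologicalSpace X] [SequentialSpace X]
    [MeasurableSpace X] [BorelSpace X] [TopologicalSpace Y] [MeasurableSpace Y]
    [OpensMeasurableSpace Y] [SecondCountableTopology Y]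
    (μ : Measure Y) (F : Y → X → ℂ) (hF : Continuous (fun z : Y × X => F z.1 z.2)) (p : ℝ≥0∞) :
    Measurable (fun x : X => eLpNorm (fun y : Y => F y x) p μ) := by
  refine LowerSemicontinuous.measurable (lowerSemicontinuous_iff_isClosed_preimage.mpr fun c => ?_)
  refine IsSeqClosed.isClosed fun u x hu hx => ?_
  have hm : ∀ n : ℕ, AEStronglyMeasurable (fun y : Y => F y (u n)) μ := fun n =>
    (hF.comp (Continuous.prodMk_left (u n))).aestronglyMeasurable
  have hl : ∀ᵐ y ∂μ, Tendsto (fun n => F y (u n)) atTop (𝓝 (F y x)) :=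
    Eventually.of_forall fun y => (hF.tendsto (y, x)).comp (tendsto_const_nhds.prodMk_nhds hx)
  exact Lp.eLpNorm_le_of_ae_tendsto (Eventually.of_forall hu) hm hl

theorem measurable_eLpNorm_stft (f : 𝓢'(Rd d, ℂ)) (p : ℝ≥0∞) :
    Measurable (fun ν : Rd d => eLpNorm (fun t : Rd d => stft f t ν) p volume) :=
  measurable_eLpNorm_of_continuous volume (stft f) (continuous_stft f) p

/-- The norm `‖f‖_{M^{p,q}} = ‖ ν ↦ ‖V f (·, ν)‖_{L^p} ‖_{L^q}`, possibly infinite. -/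
def modulationNorm (p q : ℝ≥0∞) (f : 𝓢'(Rd d, ℂ)) : ℝ≥0∞ :=
  eLpNorm (fun ν : Rd d => eLpNorm (fun t : Rd d => stft f t ν) p volume) q volume

/-- The modulation space `M^{p,q}(ℝᵈ)`: all tempered distributions with finite norm. -/
def modulationSpace (d : ℕ) (p q : ℝ≥0∞) : Submodule ℂ 𝓢'(Rd d, ℂ) where
  carrier := {f | modulationNorm p q f < ⊤}
  zero_mem' := by
    have h : ∀ t ν : Rd d, stft (0 : 𝓢'(Rd d, ℂ)) t ν = 0 := fun _ _ => rfl
    simp [modulationNorm, h]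
  add_mem' := by
    intro f g hf hg
    have hcont : ∀ (h : 𝓢'(Rd d, ℂ)) (ν : Rd d),
        AEStronglyMeasurable (fun t : Rd d => stft h t ν) volume := fun h ν =>
      ((continuous_stft h).comp (Continuous.prodMk_left ν)).aestronglyMeasurable
    have hin : ∀ ν : Rd d, eLpNorm (fun t : Rd d => stft (f + g) t ν) p volume ≤
        (ENNReal.LpAddConst p).toNNReal * (eLpNorm (fun t : Rd d => stft f t ν) p volume +
          eLpNorm (fun t : Rd d => stft g t ν) p volume) := fun ν => by
      rw [ENNReal.coe_toNNReal (ENNReal.LpAddConst_lt_top p).ne]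
      exact eLpNorm_add_le' (hcont f ν) (hcont g ν) p
    have h1 := eLpNorm_le_nnreal_smul_eLpNorm_of_ae_le_mul' (μ := volume)
      (f := fun ν : Rd d => eLpNorm (fun t : Rd d => stft (f + g) t ν) p volume)
      (g := fun ν : Rd d => eLpNorm (fun t : Rd d => stft f t ν) p volume +
        eLpNorm (fun t : Rd d => stft g t ν) p volume)
      (c := (ENNReal.LpAddConst p).toNNReal) (Eventually.of_forall hin) q
    refine h1.trans_lt (ENNReal.mul_lt_top ENNReal.coe_lt_top ?_)
    exact (eLpNorm_add_le' (measurable_eLpNorm_stft f p).aestronglyMeasurable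
      (measurable_eLpNorm_stft g p).aestronglyMeasurable q).trans_lt
      (ENNReal.mul_lt_top (ENNReal.LpAddConst_lt_top q) (ENNReal.add_lt_top.mpr ⟨hf, hg⟩))
  smul_mem' := by
    intro c f hf
    have hin : ∀ ν : Rd d, eLpNorm (fun t : Rd d => stft (c • f) t ν) p volume ≤
        ‖c‖₊ * eLpNorm (fun t : Rd d => stft f t ν) p volume := fun ν =>
      eLpNorm_const_smul_le (c := c) (f := fun t : Rd d => stft f t ν)
    have h1 := eLpNorm_le_nnreal_smul_eLpNorm_of_ae_le_mul' (μ := volume)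
      (f := fun ν : Rd d => eLpNorm (fun t : Rd d => stft (c • f) t ν) p volume)
      (g := fun ν : Rd d => eLpNorm (fun t : Rd d => stft f t ν) p volume)
      (c := ‖c‖₊) (Eventually.of_forall hin) q
    exact h1.trans_lt (ENNReal.mul_lt_top ENNReal.coe_lt_top hf)

theorem mem_modulationSpace {p q : ℝ≥0∞} {f : 𝓢'(Rd d, ℂ)} :
    f ∈ modulationSpace d p q ↔ modulationNorm p q f < ⊤ := Iff.rfl

end Modulation

/-! ### Bilinear pseudodifferential operators and the symbol class -/

section Symbol

variable {d : ℕ}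

/-- The test function
`(x̃, ξ̃₁, ξ̃₂) ↦ e^{-2πi(x̃·ν - t₁·ξ̃₁ - t₂·ξ̃₂)} φ(x - x̃) φ(ξ₁ - ξ̃₁) φ(ξ₂ - ξ̃₂)`. -/
def symbolTestFunction (φ : 𝓢(Rd d, ℂ)) (x t₁ t₂ ξ₁ ξ₂ ν : Rd d) :
    𝓢(Rd d × Rd d × Rd d, ℂ) :=
  SchwartzMap.smulLeftCLM ℂ
    (fun z : Rd d × Rd d × Rd d =>
      expTwoPiI (-(inner ℝ ν z.1 - inner ℝ t₁ z.2.1 - inner ℝ t₂ z.2.2)))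
    (tensorLeft (tensorLeft (reflTranslate ξ₂ φ) (reflTranslate ξ₁ φ)) (reflTranslate x φ))

theorem symbolTestFunction_apply (φ : 𝓢(Rd d, ℂ)) (x t₁ t₂ ξ₁ ξ₂ ν : Rd d)
    (z : Rd d × Rd d × Rd d) :
    symbolTestFunction φ x t₁ t₂ ξ₁ ξ₂ ν z =
      expTwoPiI (-(inner ℝ ν z.1 - inner ℝ t₁ z.2.1 - inner ℝ t₂ z.2.2)) *
        (φ (x - z.1) * (φ (ξ₁ - z.2.1) * φ (ξ₂ - z.2.2))) := by
  have h : (fun z : Rd d × Rd d × Rd d =>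
      expTwoPiI (-(inner ℝ ν z.1 - inner ℝ t₁ z.2.1 - inner ℝ t₂ z.2.2))).HasTemperateGrowth :=
    hasTemperateGrowth_phase (-((innerSL ℝ ν).comp (ContinuousLinearMap.fst ℝ (Rd d) (Rd d × Rd d)) -
      (innerSL ℝ t₁).comp ((ContinuousLinearMap.fst ℝ (Rd d) (Rd d)).comp
        (ContinuousLinearMap.snd ℝ (Rd d) (Rd d × Rd d))) -
      (innerSL ℝ t₂).comp ((ContinuousLinearMap.snd ℝ (Rd d) (Rd d)).comp
        (ContinuousLinearMap.snd ℝ (Rd d) (Rd d × Rd d)))))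
  rw [symbolTestFunction, SchwartzMap.smulLeftCLM_apply_apply h]
  simp

/-- The symbol short-time Fourier transform `𝒱_φ σ (x, t₁, t₂, ξ₁, ξ₂, ν)` of a tempered
distribution `σ` on `ℝ³ᵈ`. -/
def symbolSTFT (φ : 𝓢(Rd d, ℂ)) (σ : 𝓢'(Rd d × Rd d × Rd d, ℂ)) (x t₁ t₂ ξ₁ ξ₂ ν : Rd d) : ℂ :=
  σ (symbolTestFunction φ x t₁ t₂ ξ₁ ξ₂ ν)

/-- The symbol norm `∫ sup_{ξ₁,ξ₂} ∬ sup_x |𝒱_φ σ (x,t₁,t₂,ξ₁,ξ₂,ν)| dt₁ dt₂ dν`,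
possibly infinite. -/
def symbolNorm (φ : 𝓢(Rd d, ℂ)) (σ : 𝓢'(Rd d × Rd d × Rd d, ℂ)) : ℝ≥0∞ :=
  ∫⁻ ν : Rd d, ⨆ (ξ₁ : Rd d) (ξ₂ : Rd d), ∫⁻ t₂ : Rd d, ∫⁻ t₁ : Rd d,
    ⨆ x : Rd d, ‖symbolSTFT φ σ x t₁ t₂ ξ₁ ξ₂ ν‖ₑ

/-- For Schwartz `f₁, f₂`, the continuous linear map sending `g` to the Schwartz function
`(x, ξ₁, ξ₂) ↦ e^{2πi x·(ξ₁+ξ₂)} g(x) f̂₁(ξ₁) f̂₂(ξ₂)`. -/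
def rihaczekCLM (f₁ f₂ : 𝓢(Rd d, ℂ)) : 𝓢(Rd d, ℂ) →L[ℂ] 𝓢(Rd d × Rd d × Rd d, ℂ) :=
  (SchwartzMap.smulLeftCLM ℂ
    (fun z : Rd d × Rd d × Rd d => expTwoPiI (inner ℝ z.1 (z.2.1 + z.2.2)))).comp
    (tensorLeft (tensorLeft (𝓕 f₂) (𝓕 f₁)))

theorem rihaczekCLM_apply (f₁ f₂ g : 𝓢(Rd d, ℂ)) (z : Rd d × Rd d × Rd d) :
    rihaczekCLM f₁ f₂ g z = expTwoPiI (inner ℝ z.1 (z.2.1 + z.2.2)) *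
      (g z.1 * (𝓕 f₁ z.2.1 * 𝓕 f₂ z.2.2)) := by
  have h : (fun z : Rd d × Rd d × Rd d =>
      expTwoPiI (inner ℝ z.1 (z.2.1 + z.2.2))).HasTemperateGrowth :=
    hasTemperateGrowth_expTwoPiI.comp (hasTemperateGrowth_inner_clm
      (ContinuousLinearMap.fst ℝ (Rd d) (Rd d × Rd d))
      ((ContinuousLinearMap.fst ℝ (Rd d) (Rd d) + ContinuousLinearMap.snd ℝ (Rd d) (Rd d)).comp
        (ContinuousLinearMap.snd ℝ (Rd d) (Rd d × Rd d))))
  simp [rihaczekCLM, SchwartzMap.smulLeftCLM_apply_apply h]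

/-- The bilinear pseudodifferential operator with symbol `σ ∈ 𝓢'(ℝ³ᵈ)` on Schwartz functions:
`T_σ(f₁, f₂)(x) = ∬ e^{2πi x·(ξ₁+ξ₂)} σ(x,ξ₁,ξ₂) f̂₁(ξ₁) f̂₂(ξ₂) dξ₂ dξ₁`
read as a tempered distribution in `x`. -/
def bilinearPsiDO (σ : 𝓢'(Rd d × Rd d × Rd d, ℂ)) (f₁ f₂ : 𝓢(Rd d, ℂ)) : 𝓢'(Rd d, ℂ) :=
  PointwiseConvergenceCLM.precomp ℂ (rihaczekCLM f₁ f₂) σ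

theorem bilinearPsiDO_apply (σ : 𝓢'(Rd d × Rd d × Rd d, ℂ)) (f₁ f₂ g : 𝓢(Rd d, ℂ)) :
    bilinearPsiDO σ f₁ f₂ g = σ (rihaczekCLM f₁ f₂ g) := rfl

end Symbol

end

noncomputable section

/-! ### Minkowski, Fatou, Hölder and Young inequalities for nonnegative functions. -/

section Inequalities

/-! Paired with a Schwartz function g, the operator gives σ applied to the Rihaczek function R =
e^{2πi x·(ξ₁+ξ₂)} g(x) f̂₁(ξ₁) f̂₂(ξ₂). The key is a reproducing formula: c·R is an integral over
phase space of exactly those test functions that define 𝒱_φσ. The density `rihaczekKernel` is a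
unimodular factor times V g(x, ν₀-ν-ξ₁-ξ₂) · V f₁(x-t₁+τ, ξ₁) · V f₂(x-t₂+τ, ξ₂). Fourier inversion
in ν, t₁, t₂ proves it (`integral_rihaczekKernel_mul_symbolAtom_snd`), and translation invariance in
(x, ξ₁, ξ₂) leaves the scalar c. As φ is an arbitrary nonzero window, the shifts τ and ν₀ are there
to force c ≠ 0 (`exists_integral_inversionDensity_ne_zero`). Moving σ under the integral
(`SchwartzMap.clm_apply_eq_integral`) expresses c⟨T_σ(f₁,f₂), g⟩ as an absolutely convergent
integral of the density against 𝒱_φσ.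

For g a time-frequency shift of the Gaussian by (s, μ), the factor V g concentrates at x = s,
ν+ξ₁+ξ₂-ν₀ = μ, so the transform of T_σ(f₁,f₂) at (s, μ) is dominated by `symbolMajorant`. Its mixed
norm is estimated in the order dictated by the symbol norm (`exists_eLpNorm_symbolPhase_le`). For
fixed μ, the supremum over x comes out, Young and Hölder in x with 1/r₁+1/r₂ = 1/p₀ handle the
L^{p₀} norm, and Minkowski allows integration in t₁, t₂. What is left in μ is a convolution of the
symbol profile in L¹, the two profiles of f₁, f₂ and a decaying kernel, to which Young applies. The
hypotheses on the exponents are only inequalities; the slack in the q's is absorbed by the kernel,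
which lies in every L^s. The slack in the p's is absorbed by using the window γ∗γ for f₁ and f₂: its
transform is a convolution of γ with the original one, which raises p_i to any r_i ≥ p_i.

No density argument is used (Schwartz functions need not be dense when an exponent is infinite). The
extension is defined by the same integral for all f₁, f₂; finiteness of the majorant at a single (s,
μ) already gives absolute convergence for every g. -/

theorem eLpNorm_lintegral_le_of_le {X Y : Type*} [MeasurableSpace X] [MeasurableSpace Y]
    {μ : Measure X} {ν : Measure Y} [SFinite μ] [SFinite ν] {F : X → Y → ℝ≥0∞}
    (hF : Measurable (Function.uncurry F)) {N : Y → ℝ≥0∞} (hN : Measurable N) {p : ℝ≥0∞}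
    (hp : 1 ≤ p) (hFN : ∀ y, eLpNorm (fun x => F x y) p μ ≤ N y) :
    eLpNorm (fun x => ∫⁻ y, F x y ∂ν) p μ ≤ ∫⁻ y, N y ∂ν := by
  rcases eq_or_ne (∫⁻ y, N y ∂ν) ⊤ with htop | htop
  · rw [htop]; exact le_top
  have hswap : Measurable (Function.uncurry fun y x => F x y) := hF.comp measurable_swap
  have hFx : ∀ y, Measurable fun x => F x y := fun y => hF.comp measurable_prodMk_right
  have hFy : ∀ x, Measurable fun y => F x y := fun x => hF.comp measurable_prodMk_left
  rcases eq_or_ne p ⊤ with rfl | hpt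
  · rw [eLpNorm_exponent_top]
    refine essSup_le_of_ae_le _ ?_
    have h1 : ∀ᵐ y ∂ν, ∀ᵐ x ∂μ, F x y ≤ N y := Eventually.of_forall fun y => by
      have h := hFN y
      rw [eLpNorm_exponent_top] at h
      filter_upwards [ae_le_eLpNormEssSup (f := fun x => F x y) (μ := μ)] with x hx
      exact (hx.trans h)
    have hm : MeasurableSet {z : Y × X | F z.2 z.1 ≤ N z.1} :=
      measurableSet_le hswap (hN.comp measurable_fst)
    rw [Measure.ae_ae_comm hm] at h1
    filter_upwards [h1] with x hx
    exact lintegral_mono_ae hx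
  have hp0 : p ≠ 0 := (zero_lt_one.trans_le hp).ne'
  set r := p.toReal with hr
  have hr1 : 1 ≤ r := by
    rw [hr, ← ENNReal.toReal_one]
    exact (ENNReal.toReal_le_toReal ENNReal.one_ne_top hpt).mpr hp
  have hr0 : 0 < r := zero_lt_one.trans_le hr1
  have hFN' : ∀ y, ∫⁻ x, F x y ^ r ∂μ ≤ N y ^ r := fun y => by
    have h := hFN y
    rw [eLpNorm_eq_lintegral_rpow_enorm_toReal hp0 hpt] at h
    simp only [enorm_eq_self, ← hr] at h
    rw [one_div] at h
    exact (ENNReal.rpow_inv_le_iff hr0).mp h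
  -- Where N vanishes the power `N y ^ (1 - r)` used below may be infinite, so F = 0 there has to be
  -- known beforehand.
  have hzero : ∀ᵐ x ∂μ, ∀ᵐ y ∂ν, N y = 0 → F x y = 0 := by
    have h1 : ∀ᵐ y ∂ν, ∀ᵐ x ∂μ, N y = 0 → F x y = 0 := Eventually.of_forall fun y => by
      by_cases hy : N y = 0
      · have h := hFN' y
        rw [hy, ENNReal.zero_rpow_of_pos hr0, nonpos_iff_eq_zero,
          lintegral_eq_zero_iff ((hFx y).pow_const r)] at h
        filter_upwards [h] with x hx _
        simpa [ENNReal.rpow_eq_zero_iff, hr0, hr0.not_gt] using hx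
      · exact Eventually.of_forall fun x h => absurd h hy
    rwa [Measure.ae_ae_comm] at h1
    have : MeasurableSet {z : Y × X | N z.1 = 0 ∧ F z.2 z.1 ≠ 0} :=
      ((hN.comp measurable_fst) (measurableSet_singleton 0)).inter
        (hswap (measurableSet_singleton 0).compl)
    convert this.compl using 1
    ext z
    simp
  have hfin : ∀ᵐ y ∂ν, N y ≠ ⊤ := by
    filter_upwards [ae_lt_top hN htop] with y hy using hy.ne
  -- Minkowski from Hölder: F = N^{1-1/r} · G^{1/r}, so (∫F)^r ≤ (∫N)^{r-1} ∫G. Integrating G in x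
  -- first gives at most N^r · N^{1-r} = N.
  set G : X → Y → ℝ≥0∞ := fun x y => F x y ^ r * N y ^ (1 - r) with hG
  have hGm : Measurable (Function.uncurry G) :=
    (hF.pow_const r).mul ((hN.comp measurable_snd).pow_const _)
  have hsum : (1 - r⁻¹) + r⁻¹ = 1 := by ring
  have hpt' : ∀ᵐ x ∂μ, (∫⁻ y, F x y ∂ν) ^ r ≤
      (∫⁻ y, N y ∂ν) ^ (r - 1) * ∫⁻ y, G x y ∂ν := by
    filter_upwards [hzero] with x hx
    have h1 : ∫⁻ y, F x y ∂ν ≤ ∫⁻ y, N y ^ (1 - r⁻¹) * G x y ^ r⁻¹ ∂ν := by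
      refine lintegral_mono_ae ?_
      filter_upwards [hx, hfin] with y hy hyt
      by_cases h0 : N y = 0
      · rw [hy h0]; exact zero_le
      · rw [hG]
        simp only
        rw [ENNReal.mul_rpow_of_nonneg _ _ (by positivity), ← ENNReal.rpow_mul,
          mul_inv_cancel₀ hr0.ne', ENNReal.rpow_one, ← ENNReal.rpow_mul, mul_left_comm,
          ← ENNReal.rpow_add _ _ h0 hyt]
        have : 1 - r⁻¹ + (1 - r) * r⁻¹ = 0 := by field_simp; ring
        rw [this, ENNReal.rpow_zero, mul_one]
    have h2 := ENNReal.lintegral_mul_norm_pow_le (μ := ν) hN.aemeasurable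
      (hGm.comp (measurable_prodMk_left (x := x))).aemeasurable
      (sub_nonneg.mpr (inv_le_one_of_one_le₀ hr1)) (inv_nonneg.mpr hr0.le) hsum
    have h3 := ENNReal.rpow_le_rpow (h1.trans h2) hr0.le
    rw [ENNReal.mul_rpow_of_nonneg _ _ hr0.le, ← ENNReal.rpow_mul, ← ENNReal.rpow_mul,
      inv_mul_cancel₀ hr0.ne', ENNReal.rpow_one] at h3
    have : (1 - r⁻¹) * r = r - 1 := by field_simp
    rwa [this] at h3
  have hmain : ∫⁻ x, (∫⁻ y, F x y ∂ν) ^ r ∂μ ≤ (∫⁻ y, N y ∂ν) ^ r := by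
    calc ∫⁻ x, (∫⁻ y, F x y ∂ν) ^ r ∂μ
        ≤ ∫⁻ x, (∫⁻ y, N y ∂ν) ^ (r - 1) * ∫⁻ y, G x y ∂ν ∂μ := lintegral_mono_ae hpt'
      _ = (∫⁻ y, N y ∂ν) ^ (r - 1) * ∫⁻ y, ∫⁻ x, G x y ∂μ ∂ν := by
          rw [lintegral_const_mul _ (f := fun x => ∫⁻ y, G x y ∂ν) hGm.lintegral_prod_right',
            lintegral_lintegral_swap hGm.aemeasurable]
      _ ≤ (∫⁻ y, N y ∂ν) ^ (r - 1) * ∫⁻ y, N y ∂ν := by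
          gcongr with y
          simp only [hG]
          rw [lintegral_mul_const _ ((hFx y).pow_const r)]
          refine (mul_le_mul_left (hFN' y) _).trans ?_
          rcases eq_or_ne (N y) 0 with h0 | h0
          · rw [h0, ENNReal.zero_rpow_of_pos hr0, zero_mul]
          rcases eq_or_ne (N y) ⊤ with ht | ht
          · rw [ht]; exact le_top
          · rw [← ENNReal.rpow_add _ _ h0 ht]
            simp
      _ = (∫⁻ y, N y ∂ν) ^ r := by
          conv_lhs => rw [← ENNReal.rpow_one (∫⁻ y, N y ∂ν), ← ENNReal.rpow_mul]
          rw [← ENNReal.rpow_add_of_nonneg _ _ (by linarith) (by norm_num)]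
          simp
  rw [eLpNorm_eq_lintegral_rpow_enorm_toReal hp0 hpt]
  simp only [enorm_eq_self, ← hr]
  rw [one_div, ENNReal.rpow_inv_le_iff hr0]
  exact hmain

/-- Fatou's lemma along sequences. It serves to make the symbol profile measurable: a supremum over
uncountably many ξ₁, ξ₂ preserves lower semicontinuity but not measurability. -/
theorem lowerSemicontinuous_lintegral {X Y : Type*} [TopologicalSpace X] [SequentialSpace X]
    [TopologicalSpace Y] [MeasurableSpace Y] [OpensMeasurableSpace Y] {μ : Measure Y}
    {F : X × Y → ℝ≥0∞} (hF : LowerSemicontinuous F) :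
    LowerSemicontinuous fun x => ∫⁻ y, F (x, y) ∂μ := by
  refine lowerSemicontinuous_iff_isClosed_preimage.mpr fun c => ?_
  refine IsSeqClosed.isClosed fun u x hu hx => ?_
  have hm : ∀ n : ℕ, Measurable fun y => F (u n, y) := fun n =>
    LowerSemicontinuous.measurable (hF.comp (Continuous.prodMk_right (u n)))
  have hle : ∀ y, F (x, y) ≤ liminf (fun n => F (u n, y)) atTop := fun y =>
    (hF.le_liminf (x, y)).trans
      ((hx.prodMk_nhds tendsto_const_nhds).liminf_le_liminf_comp)
  calc ∫⁻ y, F (x, y) ∂μ ≤ ∫⁻ y, liminf (fun n => F (u n, y)) atTop ∂μ := lintegral_mono hle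
    _ ≤ liminf (fun n => ∫⁻ y, F (u n, y) ∂μ) atTop := lintegral_liminf_le hm
    _ ≤ c := (liminf_le_liminf (Eventually.of_forall hu)).trans_eq (by simp)

/-- **Hölder's inequality** for nonnegative functions. -/
theorem eLpNorm_mul_le_of_holderTriple {X : Type*} [MeasurableSpace X] {μ : Measure X}
    {f g : X → ℝ≥0∞} (hf : Measurable f) (hg : Measurable g) {p q r : ℝ≥0∞} (hr : 1 ≤ r)
    (h : p⁻¹ + q⁻¹ = r⁻¹) :
    eLpNorm (fun x => f x * g x) r μ ≤ eLpNorm f p μ * eLpNorm g q μ := by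
  -- The endpoint case. A zero norm of v is treated apart because the right side would read ∞ · 0 =
  -- 0 for unbounded u.
  have htop : ∀ {u v : X → ℝ≥0∞}, ∀ s : ℝ≥0∞, 1 ≤ s → Measurable v →
      eLpNorm (fun x => u x * v x) s μ ≤ eLpNorm u ⊤ μ * eLpNorm v s μ := by
    intro u v s hs hv
    have hae : ∀ᵐ x ∂μ, u x ≤ eLpNorm u ⊤ μ := by
      rw [eLpNorm_exponent_top]
      exact ae_le_eLpNormEssSup (f := u) (μ := μ)
    rcases eq_or_ne (eLpNorm v s μ) 0 with h0 | h0
    · have hv0 := (eLpNorm_eq_zero_iff hv.aestronglyMeasurable (zero_lt_one.trans_le hs).ne').mp h0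
      rw [h0, mul_zero, nonpos_iff_eq_zero, eLpNorm_congr_ae (g := 0), eLpNorm_zero]
      filter_upwards [hv0] with x hx
      simp [hx]
    rcases eq_or_ne (eLpNorm u ⊤ μ) ⊤ with ht | ht
    · rw [ht, ENNReal.top_mul h0]; exact le_top
    lift eLpNorm u ⊤ μ to ℝ≥0 using ht with c
    refine eLpNorm_le_nnreal_smul_eLpNorm_of_ae_le_mul' (c := c) ?_ s
    filter_upwards [hae] with x hx
    simp only [enorm_eq_self]
    gcongr
  rcases eq_or_ne p ⊤ with rfl | hp
  · obtain rfl : q = r := by simpa using h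
    exact htop q hr hg
  rcases eq_or_ne q ⊤ with rfl | hq
  · obtain rfl : p = r := by simpa using h
    simpa only [mul_comm] using htop (u := g) (v := f) p hr hf
  have hr0 : r ≠ 0 := (zero_lt_one.trans_le hr).ne'
  have hrt : r ≠ ⊤ := by
    rintro rfl
    simp [hp, hq] at h
  have hp0 : p ≠ 0 := by
    rintro rfl
    simp [eq_comm, hr0] at h
  have hq0 : q ≠ 0 := by
    rintro rfl
    simp [eq_comm, hr0] at h
  have hpr : 0 < p.toReal := ENNReal.toReal_pos hp0 hp
  have hqr : 0 < q.toReal := ENNReal.toReal_pos hq0 hq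
  have hrr : 0 < r.toReal := ENNReal.toReal_pos hr0 hrt
  have h' : p.toReal⁻¹ + q.toReal⁻¹ = r.toReal⁻¹ := by
    rw [← ENNReal.toReal_inv, ← ENNReal.toReal_inv, ← ENNReal.toReal_inv, ← h,
      ENNReal.toReal_add (by simpa using hp0) (by simpa using hq0)]
  have hlt : r.toReal < p.toReal := by
    rw [← inv_lt_inv₀ hpr hrr, ← h']
    exact lt_add_of_pos_right _ (by positivity)
  have := ENNReal.lintegral_Lp_mul_le_Lq_mul_Lr hrr hlt
    (by simpa only [one_div] using h'.symm) μ hf.aemeasurable hg.aemeasurable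
  rw [eLpNorm_eq_lintegral_rpow_enorm_toReal hr0 hrt, eLpNorm_eq_lintegral_rpow_enorm_toReal hp0 hp,
    eLpNorm_eq_lintegral_rpow_enorm_toReal hq0 hq]
  simpa only [enorm_eq_self, Pi.mul_apply] using this

variable {G : Type*} [AddCommGroup G] [MeasurableSpace G] [MeasurableAdd₂ G] [MeasurableNeg G]
  {μ : Measure G} [SFinite μ] [μ.IsAddLeftInvariant] [μ.IsNegInvariant]

/-- **Young's convolution inequality** for nonnegative functions. -/
theorem eLpNorm_lintegral_sub_mul_le {f g : G → ℝ≥0∞} (hf : Measurable f) (hg : Measurable g)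
    {p q r : ℝ≥0∞} (hp : 1 ≤ p) (hq : 1 ≤ q) (hr : 1 ≤ r) (h : 1 + r⁻¹ = p⁻¹ + q⁻¹) :
    eLpNorm (fun x => ∫⁻ y, f (x - y) * g y ∂μ) r μ ≤ eLpNorm f p μ * eLpNorm g q μ := by
  have hp' : p⁻¹ ≤ 1 := ENNReal.inv_le_one.mpr hp
  have hq' : q⁻¹ ≤ 1 := ENNReal.inv_le_one.mpr hq
  have hmx : ∀ x : G, Measurable fun y => f (x - y) := fun x =>
    hf.comp (measurable_id.const_sub x)
  rcases eq_or_ne r ⊤ with rfl | hrt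
  · rw [eLpNorm_exponent_top]
    refine essSup_le_of_ae_le _ (Eventually.of_forall fun x => ?_)
    have htr : eLpNorm (fun y => f (x - y)) p μ = eLpNorm f p μ :=
      eLpNorm_comp_measurePreserving (f := fun y => x - y) hf.aestronglyMeasurable
        ⟨measurable_id.const_sub x, Measure.map_sub_left_eq_self μ x⟩
    have hH := eLpNorm_mul_le_of_holderTriple (μ := μ) (hmx x) hg (r := 1) le_rfl
      (by simpa using h.symm)
    rw [htr, eLpNorm_one_eq_lintegral_enorm] at hH
    simpa only [enorm_eq_self] using hH
  have hr0 : r ≠ 0 := (zero_lt_one.trans_le hr).ne'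
  have hri : r⁻¹ ≠ 0 := ENNReal.inv_ne_zero.mpr hrt
  have hp0 : p ≠ 0 := (zero_lt_one.trans_le hp).ne'
  have hq0 : q ≠ 0 := (zero_lt_one.trans_le hq).ne'
  have hpt : p ≠ ⊤ := by
    rintro rfl
    rw [ENNReal.inv_top, zero_add] at h
    exact hri (le_zero_iff.mp (ENNReal.le_of_add_le_add_left ENNReal.one_ne_top
      ((h.le.trans hq').trans_eq (add_zero 1).symm)))
  have hqt : q ≠ ⊤ := by
    rintro rfl
    rw [ENNReal.inv_top, add_zero] at h
    exact hri (le_zero_iff.mp (ENNReal.le_of_add_le_add_left ENNReal.one_ne_top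
      ((h.le.trans hp').trans_eq (add_zero 1).symm)))
  have hrr : 0 < r.toReal := ENNReal.toReal_pos hr0 hrt
  have hpr : 0 < p.toReal := ENNReal.toReal_pos hp0 hpt
  have hqr : 0 < q.toReal := ENNReal.toReal_pos hq0 hqt
  have h' : 1 + r.toReal⁻¹ = p.toReal⁻¹ + q.toReal⁻¹ := by
    have := congrArg ENNReal.toReal h
    rwa [ENNReal.toReal_add (by simp) (by simpa using hr0),
      ENNReal.toReal_add (by simpa using hp0) (by simpa using hq0), ENNReal.toReal_one,
      ENNReal.toReal_inv, ENNReal.toReal_inv, ENNReal.toReal_inv] at this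
  have hp1 : 1 ≤ p.toReal := by
    rw [← ENNReal.toReal_one]; exact ENNReal.toReal_mono hpt hp
  have hq1 : 1 ≤ q.toReal := by
    rw [← ENNReal.toReal_one]; exact ENNReal.toReal_mono hqt hq
  rw [eLpNorm_eq_lintegral_rpow_enorm_toReal hr0 hrt, eLpNorm_eq_lintegral_rpow_enorm_toReal hp0 hpt,
    eLpNorm_eq_lintegral_rpow_enorm_toReal hq0 hqt]
  simp only [enorm_eq_self, one_div]
  set a := p.toReal
  set b := q.toReal
  set c := r.toReal
  have ha1 : a⁻¹ ≤ 1 := inv_le_one_of_one_le₀ hp1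
  have hb1 : b⁻¹ ≤ 1 := inv_le_one_of_one_le₀ hq1
  have hfg : Measurable (Function.uncurry fun x y => f (x - y) ^ a * g y ^ b) :=
    ((hf.comp measurable_sub).pow_const a).mul ((hg.comp measurable_snd).pow_const b)
  set I := ∫⁻ y, f y ^ a ∂μ
  set J := ∫⁻ y, g y ^ b ∂μ
  have hpt : ∀ x, (∫⁻ y, f (x - y) * g y ∂μ) ^ c ≤
      (∫⁻ y, f (x - y) ^ a * g y ^ b ∂μ) * (I ^ (a⁻¹ * c - 1) * J ^ (b⁻¹ * c - 1)) := by
    intro x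
    have hI : ∫⁻ y, f (x - y) ^ a ∂μ = I := lintegral_sub_left_eq_self (fun y => f y ^ a) x
    -- Three-factor Hölder with weights 1/c, 1/a - 1/c, 1/b - 1/c; they sum to 1 by the Young
    -- relation `h'`.
    have hH := ENNReal.lintegral_prod_norm_pow_le (μ := μ) (Finset.univ : Finset (Fin 3))
      (f := ![fun y => f (x - y) ^ a * g y ^ b, fun y => f (x - y) ^ a, fun y => g y ^ b])
      (by
        intro i _
        fin_cases i
        · exact (hfg.comp measurable_prodMk_left).aemeasurable
        · exact ((hmx x).pow_const a).aemeasurable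
        · exact (hg.pow_const b).aemeasurable)
      (p := ![c⁻¹, a⁻¹ - c⁻¹, b⁻¹ - c⁻¹])
      (by simp [Fin.sum_univ_three]; linarith)
      (by
        intro i _
        fin_cases i
        · simp [hrr.le]
        · simp; linarith
        · simp; linarith)
    simp only [Fin.prod_univ_three, Matrix.cons_val_zero, Matrix.cons_val_one, Matrix.cons_val] at hH
    have hint : ∀ y, (f (x - y) ^ a * g y ^ b) ^ c⁻¹ * (f (x - y) ^ a) ^ (a⁻¹ - c⁻¹) *
        (g y ^ b) ^ (b⁻¹ - c⁻¹) = f (x - y) * g y := by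
      intro y
      rw [ENNReal.mul_rpow_of_nonneg _ _ (by positivity)]
      have e : ∀ (u : ℝ≥0∞) (s : ℝ), 0 < s → s⁻¹ - c⁻¹ ≥ 0 →
          (u ^ s) ^ c⁻¹ * (u ^ s) ^ (s⁻¹ - c⁻¹) = u := by
        intro u s hs hsc
        rw [← ENNReal.rpow_add_of_nonneg _ _ (by positivity) hsc, add_sub_cancel,
          ENNReal.rpow_rpow_inv hs.ne']
      calc _ = ((f (x - y) ^ a) ^ c⁻¹ * (f (x - y) ^ a) ^ (a⁻¹ - c⁻¹)) *
            ((g y ^ b) ^ c⁻¹ * (g y ^ b) ^ (b⁻¹ - c⁻¹)) := by ring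
        _ = _ := by rw [e _ a hpr (by linarith), e _ b hqr (by linarith)]
    simp only [hint, hI] at hH
    have h3 := ENNReal.rpow_le_rpow hH hrr.le
    rw [ENNReal.mul_rpow_of_nonneg _ _ hrr.le, ENNReal.mul_rpow_of_nonneg _ _ hrr.le,
      ENNReal.rpow_inv_rpow hrr.ne', ← ENNReal.rpow_mul, ← ENNReal.rpow_mul, sub_mul, sub_mul,
      inv_mul_cancel₀ hrr.ne', mul_assoc] at h3
    exact h3
  have hca : 0 ≤ a⁻¹ * c - 1 := by
    have : 0 ≤ (a⁻¹ - c⁻¹) * c := mul_nonneg (by linarith) hrr.le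
    rwa [sub_mul, inv_mul_cancel₀ hrr.ne'] at this
  have hcb : 0 ≤ b⁻¹ * c - 1 := by
    have : 0 ≤ (b⁻¹ - c⁻¹) * c := mul_nonneg (by linarith) hrr.le
    rwa [sub_mul, inv_mul_cancel₀ hrr.ne'] at this
  have hdouble : ∫⁻ x, ∫⁻ y, f (x - y) ^ a * g y ^ b ∂μ ∂μ = I * J := by
    rw [lintegral_lintegral_swap hfg.aemeasurable]
    have : ∀ y, ∫⁻ x, f (x - y) ^ a * g y ^ b ∂μ = I * g y ^ b := fun y => by
      rw [lintegral_mul_const _ (f := fun x => f (x - y) ^ a)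
          ((hf.comp (measurable_id.sub_const y)).pow_const a),
        lintegral_sub_right_eq_self (fun x => f x ^ a) y]
    simp_rw [this]
    rw [lintegral_const_mul _ (hg.pow_const b)]
  rw [ENNReal.rpow_inv_le_iff hrr, ENNReal.mul_rpow_of_nonneg _ _ hrr.le, ← ENNReal.rpow_mul,
    ← ENNReal.rpow_mul]
  calc ∫⁻ x, (∫⁻ y, f (x - y) * g y ∂μ) ^ c ∂μ
      ≤ ∫⁻ x, (∫⁻ y, f (x - y) ^ a * g y ^ b ∂μ) * (I ^ (a⁻¹ * c - 1) * J ^ (b⁻¹ * c - 1)) ∂μ :=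
        lintegral_mono hpt
    _ = (I * J) * (I ^ (a⁻¹ * c - 1) * J ^ (b⁻¹ * c - 1)) := by
        rw [lintegral_mul_const _ (f := fun x => ∫⁻ y, f (x - y) ^ a * g y ^ b ∂μ)
          hfg.lintegral_prod_right', hdouble]
    _ = I ^ (1 + (a⁻¹ * c - 1)) * J ^ (1 + (b⁻¹ * c - 1)) := by
        rw [ENNReal.rpow_add_of_nonneg _ _ zero_le_one hca,
          ENNReal.rpow_add_of_nonneg _ _ zero_le_one hcb, ENNReal.rpow_one, ENNReal.rpow_one]
        ring
    _ = _ := by rw [add_sub_cancel, add_sub_cancel]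

/-- Convolution with a kernel in all `L^s`, `s ≥ 1`, maps `L^p` to `L^r` for `p ≤ r`. -/
theorem exists_eLpNorm_lintegral_sub_mul_le {k : G → ℝ≥0∞} (hk : Measurable k)
    (hks : ∀ s, 1 ≤ s → eLpNorm k s μ < ⊤) {p r : ℝ≥0∞} (hp : 1 ≤ p) (hpr : r⁻¹ ≤ p⁻¹) :
    ∃ C : ℝ≥0, ∀ g : G → ℝ≥0∞, Measurable g →
      eLpNorm (fun x => ∫⁻ y, k (x - y) * g y ∂μ) r μ ≤ C * eLpNorm g p μ := by
  have hp' : p⁻¹ ≤ 1 := ENNReal.inv_le_one.mpr hp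
  have hr : 1 ≤ r := ENNReal.inv_le_one.mp (hpr.trans hp')
  have h1 : p⁻¹ - r⁻¹ ≤ 1 := tsub_le_self.trans hp'
  -- The kernel exponent solving the Young relation 1 + 1/r = 1/s + 1/p.
  have hs : 1 ≤ (1 - (p⁻¹ - r⁻¹))⁻¹ := ENNReal.one_le_inv.mpr tsub_le_self
  refine ⟨(eLpNorm k (1 - (p⁻¹ - r⁻¹))⁻¹ μ).toNNReal, fun g hg => ?_⟩
  rw [ENNReal.coe_toNNReal (hks _ hs).ne]
  refine eLpNorm_lintegral_sub_mul_le hk hg hs hp hr ?_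
  rw [inv_inv]
  have hrt : r⁻¹ ≠ ⊤ := ne_top_of_le_ne_top ENNReal.one_ne_top (hpr.trans hp')
  have hpt : p⁻¹ - r⁻¹ ≠ ⊤ := ne_top_of_le_ne_top ENNReal.one_ne_top h1
  calc 1 + r⁻¹ = (1 - (p⁻¹ - r⁻¹)) + (p⁻¹ - r⁻¹) + r⁻¹ := by rw [tsub_add_cancel_of_le h1]
    _ = (1 - (p⁻¹ - r⁻¹)) + p⁻¹ := by rw [add_assoc, tsub_add_cancel_of_le hpr]

end Inequalities

/-! ### The mixed-norm estimate on phase space. -/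

section Kernel

set_option synthInstance.maxSize 5000

/-- The slack in the exponents is spent in the innermost convolution: k ∗ b₂ lies in L^s with 1/s =
1 + 1/q₃ - 1/q₁ ≤ 1/q₂. Young with exact exponents then puts (k ∗ b₂) ∗ b₁ in L^{q₃}, and
convolution with S in L¹ stays there. -/
theorem exists_eLpNorm_triple_convolution_le {G : Type*} [AddCommGroup G] [MeasurableSpace G]
    [MeasurableAdd₂ G] [MeasurableNeg G] {μ : Measure G} [SFinite μ] [μ.IsAddLeftInvariant]
    [μ.IsNegInvariant] {k : G → ℝ≥0∞} (hk : Measurable k)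
    (hks : ∀ s, 1 ≤ s → eLpNorm k s μ < ⊤) {q₁ q₂ q₃ : ℝ≥0∞} (hq₁ : 1 ≤ q₁) (hq₂ : 1 ≤ q₂)
    (hq₃ : 1 ≤ q₃) (hq : 1 + q₃⁻¹ ≤ q₁⁻¹ + q₂⁻¹) :
    ∃ C : ℝ≥0, ∀ S b₁ b₂ : G → ℝ≥0∞, Measurable S → Measurable b₁ → Measurable b₂ →
      eLpNorm (fun m => ∫⁻ ν, (∫⁻ ξ₁, (∫⁻ ξ₂, k (m - ν - ξ₁ - ξ₂) * b₂ ξ₂ ∂μ) * b₁ ξ₁ ∂μ) * S ν ∂μ)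
        q₃ μ ≤ C * (∫⁻ ν, S ν ∂μ) * eLpNorm b₁ q₁ μ * eLpNorm b₂ q₂ μ := by
  have h1 : q₁⁻¹ ≤ 1 := ENNReal.inv_le_one.mpr hq₁
  have h2 : q₂⁻¹ ≤ 1 := ENNReal.inv_le_one.mpr hq₂
  have h1' : q₁⁻¹ ≤ 1 + q₃⁻¹ := h1.trans le_self_add
  set s := (1 + q₃⁻¹ - q₁⁻¹)⁻¹ with hs
  have hs2 : s⁻¹ ≤ q₂⁻¹ := by
    rw [hs, inv_inv]
    exact tsub_le_iff_left.mpr hq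
  have hs1 : 1 ≤ s := ENNReal.inv_le_one.mp (hs2.trans h2)
  obtain ⟨C, hC⟩ := exists_eLpNorm_lintegral_sub_mul_le (μ := μ) hk hks hq₂ hs2
  refine ⟨C, fun S b₁ b₂ hS hb₁ hb₂ => ?_⟩
  have hm1 : Measurable fun x => ∫⁻ y, k (x - y) * b₂ y ∂μ :=
    Measurable.lintegral_prod_right' (f := fun z : G × G => k (z.1 - z.2) * b₂ z.2)
      ((hk.comp measurable_sub).mul (hb₂.comp measurable_snd))
  have hm2 : Measurable fun x => ∫⁻ y, (∫⁻ y', k (x - y - y') * b₂ y' ∂μ) * b₁ y ∂μ :=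
    Measurable.lintegral_prod_right'
      (f := fun z : G × G => (∫⁻ y', k (z.1 - z.2 - y') * b₂ y' ∂μ) * b₁ z.2)
      ((hm1.comp measurable_sub).mul (hb₁.comp measurable_snd))
  have e1 := hC b₂ hb₂
  have e2 := eLpNorm_lintegral_sub_mul_le (μ := μ) hm1 hb₁ hs1 hq₁ hq₃ (by
    rw [hs, inv_inv, tsub_add_cancel_of_le h1'])
  have e3 := eLpNorm_lintegral_sub_mul_le (μ := μ) hm2 hS hq₃ le_rfl hq₃
    (by rw [inv_one, add_comm])
  rw [eLpNorm_one_eq_lintegral_enorm] at e3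
  simp only [enorm_eq_self] at e3
  calc _ ≤ _ := e3
    _ ≤ (C * eLpNorm b₂ q₂ μ) * eLpNorm b₁ q₁ μ * ∫⁻ ν, S ν ∂μ := by
        gcongr
        refine e2.trans ?_
        gcongr
    _ = _ := by ring

variable {d : ℕ}

/-- The phase space `((x, ξ₁, ξ₂), (ν, t₂, t₁))` of symbols. -/
abbrev SymbolPhase (d : ℕ) : Type := (Rd d × Rd d × Rd d) × (Rd d × Rd d × Rd d)

/-- Tonelli with x innermost, since the majorant of the symbol transform does not depend on x. -/
theorem lintegral_symbolPhase {F : SymbolPhase d → ℝ≥0∞} (hF : Measurable F) :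
    ∫⁻ z, F z = ∫⁻ y : Rd d × Rd d × Rd d × Rd d × Rd d, ∫⁻ x : Rd d,
      F ((x, y.2.1, y.2.2.1), (y.1, y.2.2.2)) := by
  have hp : ∀ {α β : Type} [MeasureSpace α] [MeasureSpace β] [SFinite (volume : Measure α)]
      [SFinite (volume : Measure β)] (f : α × β → ℝ≥0∞), Measurable f →
      ∫⁻ z, f z = ∫⁻ a, ∫⁻ b, f (a, b) := fun f hf => lintegral_prod f hf.aemeasurable
  have hs : ∀ {α β : Type} [MeasureSpace α] [MeasureSpace β] [SFinite (volume : Measure α)]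
      [SFinite (volume : Measure β)] (f : α × β → ℝ≥0∞), Measurable f →
      ∫⁻ z, f z = ∫⁻ b, ∫⁻ a, f (a, b) := fun f hf => lintegral_prod_symm f hf.aemeasurable
  have h1 : ∀ y : Rd d × Rd d × Rd d, ∫⁻ w : Rd d × Rd d × Rd d, F (w, y) =
      ∫⁻ ξ : Rd d × Rd d, ∫⁻ x : Rd d, F ((x, ξ), y) := fun y => hs _ (by fun_prop)
  rw [hs _ hF]
  simp_rw [h1]
  rw [hp _ (by fun_prop), hp _ (by fun_prop)]
  refine lintegral_congr fun ν => ?_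
  rw [lintegral_lintegral_swap (by fun_prop), hp _ (by fun_prop), hp _ (by fun_prop)]
  refine lintegral_congr fun ξ₁ => ?_
  rw [hp _ (by fun_prop)]

/-- The analytic core. Θ stands for the symbol transform, M for its supremum in x, S for the profile
in ν, and U₁, U₂ for the transforms of f₁, f₂. For fixed μ the norm in s is bounded by a triple
convolution evaluated at μ + ν₀; the norm in μ is then taken of that convolution. -/
theorem exists_eLpNorm_symbolPhase_le {k : Rd d → ℝ≥0∞} (hk : Measurable k)
    (hks : ∀ s, 1 ≤ s → eLpNorm k s volume < ⊤) {p₀ r₁ r₂ q₁ q₂ q₃ : ℝ≥0∞} (hp₀ : 1 ≤ p₀)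
    (hr : r₁⁻¹ + r₂⁻¹ = p₀⁻¹) (hq₁ : 1 ≤ q₁) (hq₂ : 1 ≤ q₂) (hq₃ : 1 ≤ q₃)
    (hq : 1 + q₃⁻¹ ≤ q₁⁻¹ + q₂⁻¹) :
    ∃ C : ℝ≥0, ∀ (Θ : SymbolPhase d → ℝ≥0∞) (M : Rd d × Rd d × Rd d × Rd d × Rd d → ℝ≥0∞)
      (S b₁ b₂ : Rd d → ℝ≥0∞) (U₁ U₂ : Rd d × Rd d → ℝ≥0∞) (τ ν₀ : Rd d),
      Measurable Θ → Measurable M → Measurable S → Measurable b₁ → Measurable b₂ →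
      Measurable U₁ → Measurable U₂ →
      (∀ z, Θ z ≤ M (z.2.1, z.1.2.1, z.1.2.2, z.2.2)) →
      (∀ ν ξ₁ ξ₂, ∫⁻ t₂ : Rd d, ∫⁻ t₁ : Rd d, M (ν, ξ₁, ξ₂, t₂, t₁) ≤ S ν) →
      (∀ ξ, eLpNorm (fun u => U₁ (u, ξ)) r₁ volume ≤ b₁ ξ) →
      (∀ ξ, eLpNorm (fun u => U₂ (u, ξ)) r₂ volume ≤ b₂ ξ) →
      eLpNorm (fun μ : Rd d => eLpNorm (fun s : Rd d => ∫⁻ z : SymbolPhase d,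
        Θ z * (k (s - z.1.1) * k (μ - (z.2.1 + z.1.2.1 + z.1.2.2 - ν₀))) *
          (U₁ (z.1.1 - z.2.2.2 + τ, z.1.2.1) * U₂ (z.1.1 - z.2.2.1 + τ, z.1.2.2))) p₀ volume)
        q₃ volume ≤
        C * (∫⁻ ν, S ν) * eLpNorm b₁ q₁ volume * eLpNorm b₂ q₂ volume := by
  obtain ⟨C, hC⟩ := exists_eLpNorm_triple_convolution_le (μ := (volume : Measure (Rd d))) hk hks
    hq₁ hq₂ hq₃ hq
  obtain ⟨C', hC'⟩ := exists_eLpNorm_lintegral_sub_mul_le (μ := (volume : Measure (Rd d))) hk hks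
    hp₀ le_rfl
  refine ⟨C' * C, fun Θ M S b₁ b₂ U₁ U₂ τ ν₀ hΘ hM hS hb₁ hb₂ hU₁ hU₂ hΘM hMS hUb₁ hUb₂ => ?_⟩
  have hfix : ∀ μ : Rd d, eLpNorm (fun s : Rd d => ∫⁻ z : SymbolPhase d,
        Θ z * (k (s - z.1.1) * k (μ - (z.2.1 + z.1.2.1 + z.1.2.2 - ν₀))) *
          (U₁ (z.1.1 - z.2.2.2 + τ, z.1.2.1) * U₂ (z.1.1 - z.2.2.1 + τ, z.1.2.2))) p₀ volume ≤
      C' * ∫⁻ ν, (∫⁻ ξ₁, (∫⁻ ξ₂, k (μ + ν₀ - ν - ξ₁ - ξ₂) * b₂ ξ₂) * b₁ ξ₁) * S ν := by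
    intro μ
    -- Everything that still depends on x once Θ is replaced by M. Its L^{p₀} norm in s is at most a
    -- constant times b₁ b₂, uniformly in t₁, t₂, because τ and the t's merely translate U₁ and U₂.
    set Q : Rd d → Rd d × Rd d × Rd d × Rd d × Rd d → ℝ≥0∞ := fun s y =>
      ∫⁻ x, k (s - x) * (U₁ (x - y.2.2.2.2 + τ, y.2.1) * U₂ (x - y.2.2.2.1 + τ, y.2.2.1)) with hQ
    have hQm : Measurable (Function.uncurry Q) := by
      refine Measurable.lintegral_prod_right'
        (f := fun w : (Rd d × Rd d × Rd d × Rd d × Rd d × Rd d) × Rd d => k (w.1.1 - w.2) *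
          (U₁ (w.2 - w.1.2.2.2.2.2 + τ, w.1.2.2.1) * U₂ (w.2 - w.1.2.2.2.2.1 + τ, w.1.2.2.2.1))) ?_
      fun_prop
    set N : Rd d × Rd d × Rd d × Rd d × Rd d → ℝ≥0∞ := fun y =>
      M y * k (μ - (y.1 + y.2.1 + y.2.2.1 - ν₀)) * (C' * (b₁ y.2.1 * b₂ y.2.2.1)) with hN
    have hNm : Measurable N := by fun_prop
    have hstep : ∀ s, (∫⁻ z : SymbolPhase d,
        Θ z * (k (s - z.1.1) * k (μ - (z.2.1 + z.1.2.1 + z.1.2.2 - ν₀))) *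
          (U₁ (z.1.1 - z.2.2.2 + τ, z.1.2.1) * U₂ (z.1.1 - z.2.2.1 + τ, z.1.2.2))) ≤
        ∫⁻ y, M y * k (μ - (y.1 + y.2.1 + y.2.2.1 - ν₀)) * Q s y := by
      intro s
      rw [lintegral_symbolPhase (by fun_prop)]
      refine lintegral_mono fun y => ?_
      rw [hQ, ← lintegral_const_mul _ (by fun_prop)]
      refine lintegral_mono fun x => ?_
      simp only
      calc _ ≤ M y * (k (s - x) * k (μ - (y.1 + y.2.1 + y.2.2.1 - ν₀))) *
            (U₁ (x - y.2.2.2.2 + τ, y.2.1) * U₂ (x - y.2.2.2.1 + τ, y.2.2.1)) := by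
            gcongr
            exact hΘM _
        _ = _ := by ring
    have hQN : ∀ y, eLpNorm (fun s => M y * k (μ - (y.1 + y.2.1 + y.2.2.1 - ν₀)) * Q s y) p₀
        volume ≤ N y := by
      intro y
      have hconst : ∀ (c : ℝ≥0∞) (g : Rd d → ℝ≥0∞) (D : ℝ≥0∞), Measurable g →
          eLpNorm g p₀ volume ≤ D → eLpNorm (fun s => c * g s) p₀ volume ≤ c * D := by
        intro c g D hg hD
        refine (eLpNorm_mul_le_of_holderTriple (p := ⊤) (q := p₀) measurable_const hg hp₀
          (by simp)).trans ?_
        gcongr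
        rw [eLpNorm_exponent_top]
        exact eLpNormEssSup_le_of_ae_enorm_bound (Eventually.of_forall fun x => le_rfl)
      refine hconst _ _ _ (hQm.comp measurable_prodMk_right) ?_
      refine (hC' _ (by fun_prop)).trans ?_
      gcongr
      refine (eLpNorm_mul_le_of_holderTriple (p := r₁) (q := r₂) (by fun_prop) (by fun_prop) hp₀
        hr).trans ?_
      have htr : ∀ (U : Rd d × Rd d → ℝ≥0∞) (hU : Measurable U) (r : ℝ≥0∞) (a ξ : Rd d),
          eLpNorm (fun x => U (x - a + τ, ξ)) r volume = eLpNorm (fun x => U (x, ξ)) r volume := by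
        intro U hU r a ξ
        have hmp : MeasurePreserving (fun x : Rd d => x - a + τ) volume volume := by
          have := measurePreserving_add_right (volume : Measure (Rd d)) (-a + τ)
          convert this using 2
          abel
        exact eLpNorm_comp_measurePreserving (g := fun x => U (x, ξ))
          (hU.comp measurable_prodMk_right).aestronglyMeasurable hmp
      rw [htr U₁ hU₁, htr U₂ hU₂]
      gcongr
      · exact hUb₁ _
      · exact hUb₂ _
    calc _ ≤ eLpNorm (fun s => ∫⁻ y, M y * k (μ - (y.1 + y.2.1 + y.2.2.1 - ν₀)) * Q s y) p₀
          volume := eLpNorm_mono_enorm fun s => by simpa only [enorm_eq_self] using hstep s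
      _ ≤ ∫⁻ y, N y := eLpNorm_lintegral_le_of_le (by
          simp only [Function.uncurry_def]
          have : Measurable fun a : Rd d × Rd d × Rd d × Rd d × Rd d × Rd d => Q a.1 a.2 := hQm
          fun_prop) hNm hp₀ hQN
      _ ≤ _ := by
          -- The t-variables now occur only in M, so integrating them for fixed ν, ξ₁, ξ₂ leaves S;
          -- the remaining integrals are the nested convolutions.
          rw [Measure.volume_eq_prod, lintegral_prod _ hNm.aemeasurable,
            ← lintegral_const_mul' _ _ ENNReal.coe_ne_top]
          refine lintegral_mono fun ν => ?_
          rw [Measure.volume_eq_prod, lintegral_prod _ (by fun_prop), mul_comm _ (S ν),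
            ← mul_assoc, ← lintegral_const_mul _ (by fun_prop)]
          refine lintegral_mono fun ξ₁ => ?_
          rw [Measure.volume_eq_prod, lintegral_prod _ (by fun_prop), mul_comm _ (b₁ ξ₁),
            ← mul_assoc, ← lintegral_const_mul _ (by fun_prop)]
          refine lintegral_mono fun ξ₂ => ?_
          simp only [hN]
          rw [Measure.volume_eq_prod, lintegral_prod _ (by fun_prop)]
          have harg : μ - (ν + ξ₁ + ξ₂ - ν₀) = μ + ν₀ - ν - ξ₁ - ξ₂ := by abel
          rw [harg]
          calc _ = ∫⁻ t₂ : Rd d, (∫⁻ t₁ : Rd d, M (ν, ξ₁, ξ₂, t₂, t₁)) *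
                (k (μ + ν₀ - ν - ξ₁ - ξ₂) * (C' * (b₁ ξ₁ * b₂ ξ₂))) :=
                lintegral_congr fun t₂ => by
                  rw [← lintegral_mul_const _ (by fun_prop)]
                  exact lintegral_congr fun t₁ => by ring
            _ = (∫⁻ t₂ : Rd d, ∫⁻ t₁ : Rd d, M (ν, ξ₁, ξ₂, t₂, t₁)) *
                (k (μ + ν₀ - ν - ξ₁ - ξ₂) * (C' * (b₁ ξ₁ * b₂ ξ₂))) := by
                rw [lintegral_mul_const _ (by fun_prop)]
            _ ≤ S ν * (k (μ + ν₀ - ν - ξ₁ - ξ₂) * (C' * (b₁ ξ₁ * b₂ ξ₂))) := by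
                gcongr
                exact hMS ν ξ₁ ξ₂
            _ = _ := by ring
  set B : Rd d → ℝ≥0∞ := fun m =>
    ∫⁻ ν, (∫⁻ ξ₁, (∫⁻ ξ₂, k (m - ν - ξ₁ - ξ₂) * b₂ ξ₂) * b₁ ξ₁) * S ν with hB
  have hBm : Measurable B := by
    refine Measurable.lintegral_prod_right' (f := fun w : Rd d × Rd d =>
      (∫⁻ ξ₁, (∫⁻ ξ₂, k (w.1 - w.2 - ξ₁ - ξ₂) * b₂ ξ₂) * b₁ ξ₁) * S w.2) ?_
    refine Measurable.mul (Measurable.lintegral_prod_right' (f := fun w : (Rd d × Rd d) × Rd d =>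
      (∫⁻ ξ₂, k (w.1.1 - w.1.2 - w.2 - ξ₂) * b₂ ξ₂) * b₁ w.2) ?_) (by fun_prop)
    refine Measurable.mul (Measurable.lintegral_prod_right'
      (f := fun w : ((Rd d × Rd d) × Rd d) × Rd d =>
        k (w.1.1.1 - w.1.1.2 - w.1.2 - w.2) * b₂ w.2) ?_) (by fun_prop)
    fun_prop
  have hBt : eLpNorm (fun μ => B (μ + ν₀)) q₃ volume = eLpNorm B q₃ volume :=
    eLpNorm_comp_measurePreserving hBm.aestronglyMeasurable (measurePreserving_add_right volume ν₀)
  calc _ ≤ C' * eLpNorm (fun μ => B (μ + ν₀)) q₃ volume :=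
        eLpNorm_le_nnreal_smul_eLpNorm_of_ae_le_mul' (c := C')
          (Eventually.of_forall fun μ => by simpa only [enorm_eq_self] using hfix μ) q₃
    _ ≤ C' * (C * (∫⁻ ν, S ν) * eLpNorm b₁ q₁ volume * eLpNorm b₂ q₂ volume) := by
        rw [hBt]
        gcongr
        exact hC S b₁ b₂ hS hb₁ hb₂
    _ = _ := by push_cast; ring

end Kernel

/-! ### Integrals of Schwartz-valued families and continuous functionals. -/

section SchwartzIntegral

set_option synthInstance.maxSize 5000

variable {E : Type*} [NormedAddCommGroup E] [NormedSpace ℝ E]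

/-- Bounded continuous functions with values in the `n`-linear forms. -/
def BoundedJet (E : Type*) [NormedAddCommGroup E] [NormedSpace ℝ E] (n : ℕ) : Type _ :=
  BoundedContinuousFunction E (E [×n]→L[ℝ] ℂ)

instance BoundedJet.instNormedAddCommGroup (n : ℕ) : NormedAddCommGroup (BoundedJet E n) :=
  inferInstanceAs (NormedAddCommGroup (BoundedContinuousFunction E (E [×n]→L[ℝ] ℂ)))

instance BoundedJet.instNormedSpace (n : ℕ) : NormedSpace ℂ (BoundedJet E n) :=
  inferInstanceAs (NormedSpace ℂ (BoundedContinuousFunction E (E [×n]→L[ℝ] ℂ)))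

instance BoundedJet.instCompleteSpace (n : ℕ) : CompleteSpace (BoundedJet E n) :=
  inferInstanceAs (CompleteSpace (BoundedContinuousFunction E (E [×n]→L[ℝ] ℂ)))

/-- Evaluation of a bounded jet at a point and a tuple of vectors. -/
def BoundedJet.evalCLM {n : ℕ} (y : E) (v : Fin n → E) : BoundedJet E n →L[ℂ] ℂ :=
  LinearMap.mkContinuous
    { toFun := fun b => (show BoundedContinuousFunction E (E [×n]→L[ℝ] ℂ) from b) y v
      map_add' := fun _ _ => rfl
      map_smul' := fun _ _ => rfl } (∏ i, ‖v i‖) fun b => by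
    rw [mul_comm]
    exact (ContinuousMultilinearMap.le_opNorm _ v).trans (mul_le_mul_of_nonneg_right
      (BoundedContinuousFunction.norm_coe_le_norm
        (show BoundedContinuousFunction E (E [×n]→L[ℝ] ℂ) from b) y)
      (Finset.prod_nonneg fun _ _ => norm_nonneg _))

theorem BoundedJet.ext {n : ℕ} {b b' : BoundedJet E n}
    (h : ∀ y v, BoundedJet.evalCLM y v b = BoundedJet.evalCLM y v b') : b = b' :=
  BoundedContinuousFunction.ext fun y => ContinuousMultilinearMap.ext fun v => h y v

/-- The weighted derivative `y ↦ ‖y‖ᵏ Dⁿ f(y)` of a Schwartz function as a bounded continuous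
function. -/
def weightedIteratedFDerivCLM (E : Type*) [NormedAddCommGroup E] [NormedSpace ℝ E] (m : ℕ × ℕ) :
    𝓢(E, ℂ) →L[ℂ] BoundedJet E m.2 :=
  SchwartzMap.mkCLMtoNormedSpace (σ := RingHom.id ℂ) (E := ℂ) (G := BoundedJet E m.2)
    (fun f : 𝓢(E, ℂ) => BoundedContinuousFunction.ofNormedAddCommGroup
      (fun y => (‖y‖ ^ m.1 : ℝ) • iteratedFDeriv ℝ m.2 f y)
      ((continuous_norm.pow _).smul ((f.smooth ⊤).continuous_iteratedFDeriv (mod_cast le_top)))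
      (SchwartzMap.seminorm ℂ m.1 m.2 f) (fun y => by
        rw [norm_smul, norm_pow, norm_norm]
        exact SchwartzMap.le_seminorm ℂ m.1 m.2 f y))
    (fun f g => by
      refine BoundedContinuousFunction.ext fun y => ?_
      have := iteratedFDeriv_add_apply (𝕜 := ℝ) (i := m.2) (x := y) (f := f) (g := g)
        ((f.smooth m.2).contDiffAt) ((g.smooth m.2).contDiffAt)
      change (‖y‖ ^ m.1 : ℝ) • iteratedFDeriv ℝ m.2 (⇑f + ⇑g) y =
        (‖y‖ ^ m.1 : ℝ) • iteratedFDeriv ℝ m.2 f y + (‖y‖ ^ m.1 : ℝ) • iteratedFDeriv ℝ m.2 g y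
      rw [this, smul_add])
    (fun a f => by
      refine BoundedContinuousFunction.ext fun y => ?_
      have := iteratedFDeriv_const_smul_apply (𝕜 := ℝ) (i := m.2) (x := y) (f := f) (a := a)
        ((f.smooth m.2).contDiffAt)
      change (‖y‖ ^ m.1 : ℝ) • iteratedFDeriv ℝ m.2 (a • ⇑f) y =
        a • ((‖y‖ ^ m.1 : ℝ) • iteratedFDeriv ℝ m.2 f y)
      rw [this, smul_comm])
    ⟨{m}, 1, zero_le_one, fun f => by
      rw [one_mul, Finset.sup_singleton]
      exact BoundedContinuousFunction.norm_ofNormedAddCommGroup_le _ (apply_nonneg _ _) _⟩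

theorem norm_weightedIteratedFDerivCLM (m : ℕ × ℕ) (f : 𝓢(E, ℂ)) :
    ‖weightedIteratedFDerivCLM E m f‖ = SchwartzMap.seminorm ℂ m.1 m.2 f := by
  refine le_antisymm
    (BoundedContinuousFunction.norm_ofNormedAddCommGroup_le _ (apply_nonneg _ _) fun y => by
      rw [norm_smul, norm_pow, norm_norm]
      exact SchwartzMap.le_seminorm ℂ m.1 m.2 f y)
    (SchwartzMap.seminorm_le_bound ℂ _ _ f (norm_nonneg (weightedIteratedFDerivCLM E m f))
      fun y => ?_)
  have h : ‖(‖y‖ ^ m.1 : ℝ) • iteratedFDeriv ℝ m.2 f y‖ ≤ ‖weightedIteratedFDerivCLM E m f‖ :=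
    BoundedContinuousFunction.norm_coe_le_norm
      (show BoundedContinuousFunction E (E [×m.2]→L[ℝ] ℂ) from weightedIteratedFDerivCLM E m f) y
  rwa [norm_smul, norm_pow, norm_norm] at h

variable {P : Type*} [TopologicalSpace P] [MeasurableSpace P] [OpensMeasurableSpace P]
  [SecondCountableTopology P] {μ : Measure P}

/-- A continuous linear map into a normed space is controlled by finitely many Schwartz seminorms,
whose sum is an integrable majorant. -/
theorem SchwartzMap.integrable_clm_comp {B : Type*} [NormedAddCommGroup B] [NormedSpace ℂ B]
    {H : P → 𝓢(E, ℂ)} (hH : Continuous H)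
    (hint : ∀ k n, Integrable (fun s => SchwartzMap.seminorm ℂ k n (H s)) μ) 
    (L : 𝓢(E, ℂ) →L[ℂ] B) : Integrable (fun s => L (H s)) μ := by
  obtain ⟨t, C, -, hb⟩ := Seminorm.bound_of_continuous (schwartz_withSeminorms ℂ E ℂ)
    ((normSeminorm ℂ B).comp L.toLinearMap) (by exact continuous_norm.comp L.continuous)
  refine Integrable.mono' (g := fun s => C * ∑ m ∈ t, SchwartzMap.seminorm ℂ m.1 m.2 (H s))
    ((integrable_finsetSum t fun m _ => hint m.1 m.2).const_mul (C : ℝ))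
    (L.continuous.comp hH).aestronglyMeasurable (Eventually.of_forall fun s => ?_)
  refine (Seminorm.le_def.mp hb (H s)).trans ?_
  rw [smul_apply]
  refine mul_le_mul_of_nonneg_left ?_ C.coe_nonneg
  have := Seminorm.le_def.mp (Seminorm.finset_sup_le_sum (schwartzSeminormFamily ℂ E ℂ) t) (H s)
  refine this.trans_eq ?_
  rw [← FunLike.coeAddMonoidHom_apply, map_sum, Finset.sum_apply]
  rfl

/-- Differentiation under the integral along t ↦ y + t v, dominated by the seminorm of index (0, 1).
Only the values of G are assumed to be integrals; the same for its derivatives is what has to be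
derived. -/
theorem SchwartzMap.lineDerivOp_eq_integral {H : P → 𝓢(E, ℂ)} (hH : Continuous H)
    (hint : ∀ k n, Integrable (fun s => SchwartzMap.seminorm ℂ k n (H s)) μ) {G : 𝓢(E, ℂ)}
    (hG : ∀ y, G y = ∫ s, H s y ∂μ) (v y : E) :
    LineDeriv.lineDerivOp v G y = ∫ s, LineDeriv.lineDerivOp v (H s) y ∂μ := by
  have hev : ∀ (L : 𝓢(E, ℂ) →L[ℂ] 𝓢(E, ℂ)) (y : E), Integrable (fun s => L (H s) y) μ := by
    intro L y
    exact SchwartzMap.integrable_clm_comp hH hint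
      ((BoundedContinuousFunction.evalCLM ℂ y).comp
        ((SchwartzMap.toBoundedContinuousFunctionCLM ℂ E ℂ).comp L))
  have hcurve : ∀ (f : 𝓢(E, ℂ)) (t : ℝ), HasDerivAt (fun t : ℝ => f (y + t • v))
      (LineDeriv.lineDerivOp v f (y + t • v)) t := by
    intro f t
    rw [SchwartzMap.lineDerivOp_apply_eq_fderiv]
    have h1 : HasDerivAt (fun t : ℝ => y + t • v) v t := by
      simpa using ((hasDerivAt_id t).smul_const v).const_add y
    exact (f.hasFDerivAt (y + t • v)).comp_hasDerivAt t h1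
  have hd := hasDerivAt_integral_of_dominated_loc_of_deriv_le (𝕜 := ℝ) (μ := μ)
    (F := fun (t : ℝ) s => H s (y + t • v))
    (F' := fun (t : ℝ) s => LineDeriv.lineDerivOp v (H s) (y + t • v)) (x₀ := 0) (s := Set.univ)
    (bound := fun s => SchwartzMap.seminorm ℂ 0 1 (H s) * ‖v‖) univ_mem
    (Eventually.of_forall fun t => (hev (ContinuousLinearMap.id ℂ _) _).aestronglyMeasurable)
    (hev (ContinuousLinearMap.id ℂ _) _)
    (hev (LineDeriv.lineDerivOpCLM ℂ 𝓢(E, ℂ) v) _).aestronglyMeasurable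
    (Eventually.of_forall fun s t _ => by
      rw [SchwartzMap.lineDerivOp_apply_eq_fderiv]
      refine (ContinuousLinearMap.le_opNorm _ _).trans ?_
      gcongr
      rw [← norm_iteratedFDeriv_one]
      exact SchwartzMap.norm_iteratedFDeriv_le_seminorm ℂ (H s) 1 _)
    ((hint 0 1).mul_const _) (Eventually.of_forall fun s t _ => hcurve (H s) t)
  have hfun : (fun t : ℝ => ∫ s, H s (y + t • v) ∂μ) = fun t : ℝ => G (y + t • v) :=
    funext fun t => (hG _).symm
  rw [hfun] at hd
  simpa using (hcurve G 0).unique hd.2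

/-- Induction on the order: the line derivatives of H form again a continuous family with integrable
seminorms. -/
theorem SchwartzMap.iteratedFDeriv_eq_integral {H : P → 𝓢(E, ℂ)} (hH : Continuous H)
    (hint : ∀ k n, Integrable (fun s => SchwartzMap.seminorm ℂ k n (H s)) μ) {G : 𝓢(E, ℂ)}
    (hG : ∀ y, G y = ∫ s, H s y ∂μ) (n : ℕ) (y : E) (v : Fin n → E) :
    iteratedFDeriv ℝ n G y v = ∫ s, iteratedFDeriv ℝ n (H s) y v ∂μ := by
  simp_rw [← SchwartzMap.iteratedLineDerivOp_eq_iteratedFDeriv]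
  have key : ∀ n : ℕ, ∀ v : Fin n → E,
      ∀ y, LineDeriv.iteratedLineDerivOp v G y = ∫ s, LineDeriv.iteratedLineDerivOp v (H s) y ∂μ := by
    intro n
    induction n with
    | zero => intro v y; simpa using hG y
    | succ n ih =>
      intro v y
      simp_rw [LineDeriv.iteratedLineDerivOp_succ_left]
      have hc : Continuous (LineDeriv.iteratedLineDerivOp (E := 𝓢(E, ℂ)) (Fin.tail v)) :=
        (LineDeriv.iteratedLineDerivOpCLM ℂ 𝓢(E, ℂ) (Fin.tail v)).continuous
      refine SchwartzMap.lineDerivOp_eq_integral (hc.comp hH) (fun k m => ?_) (ih (Fin.tail v)) _ _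
      have := (SchwartzMap.integrable_clm_comp hH hint ((weightedIteratedFDerivCLM E (k, m)).comp
        (LineDeriv.iteratedLineDerivOpCLM ℂ 𝓢(E, ℂ) (Fin.tail v)))).norm
      refine this.congr (Eventually.of_forall fun s => ?_)
      exact norm_weightedIteratedFDerivCLM (k, m) _
  exact key n v y

/-- Since J is injective, L becomes a bounded functional on the range of J, and Hahn–Banach extends
it to B. This replaces a functional on a Fréchet space by one on a Banach space, where Bochner
integrals commute with it. -/
theorem exists_clm_comp_eq {S B : Type*} [AddCommGroup S] [Module ℂ S] [NormedAddCommGroup B]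
    [NormedSpace ℂ B] {J : S →ₗ[ℂ] B} (hJ : Function.Injective J) (L : S →ₗ[ℂ] ℂ) (C : ℝ)
    (h : ∀ f, ‖L f‖ ≤ C * ‖J f‖) : ∃ ℓ : B →L[ℂ] ℂ, ∀ f, ℓ (J f) = L f := by
  set e := LinearEquiv.ofInjective J hJ with he
  have hbd : ∀ w : J.range, ‖(L.comp e.symm.toLinearMap) w‖ ≤ C * ‖w‖ := fun w => by
    have h1 := h (e.symm w)
    have h2 : J (e.symm w) = w := congrArg Subtype.val (e.apply_symm_apply w)
    rw [h2] at h1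
    exact h1
  set ℓ₀ : J.range →L[ℂ] ℂ := (L.comp e.symm.toLinearMap).mkContinuous C hbd with hℓ₀
  obtain ⟨ℓ, hℓ, -⟩ := exists_extension_norm_eq _ ℓ₀
  refine ⟨ℓ, fun f => ?_⟩
  have h1 := hℓ (e f)
  have h2 : ((e f : J.range) : B) = J f := rfl
  rw [h2] at h1
  rw [h1, hℓ₀, LinearMap.mkContinuous_apply]
  simp

/-- A continuous functional on the Schwartz space commutes with pointwise integrals of absolutely
integrable families. -/
theorem SchwartzMap.clm_apply_eq_integral {H : P → 𝓢(E, ℂ)} (hH : Continuous H)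
    (hint : ∀ k n, Integrable (fun s => SchwartzMap.seminorm ℂ k n (H s)) μ) {G : 𝓢(E, ℂ)}
    (hG : ∀ y, G y = ∫ s, H s y ∂μ) (L : 𝓢(E, ℂ) →L[ℂ] ℂ) : L G = ∫ s, L (H s) ∂μ := by
  obtain ⟨t, C, -, hb⟩ := Seminorm.bound_of_continuous (schwartz_withSeminorms ℂ E ℂ)
    ((normSeminorm ℂ ℂ).comp L.toLinearMap) (by exact continuous_norm.comp L.continuous)
  -- The index (0, 0) is the sup norm; adding it makes J injective.
  set t' : Finset (ℕ × ℕ) := insert (0, 0) t with ht'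
  set J : 𝓢(E, ℂ) →L[ℂ] ((m : t') → BoundedJet E m.1.2) :=
    ContinuousLinearMap.pi fun m => weightedIteratedFDerivCLM E m.1 with hJ
  have hJle : ∀ f (m : t'), SchwartzMap.seminorm ℂ m.1.1 m.1.2 f ≤ ‖J f‖ := fun f m => by
    rw [← norm_weightedIteratedFDerivCLM]
    exact norm_le_pi_norm (J f) m
  have hLJ : ∀ f, ‖L f‖ ≤ C * ‖J f‖ := fun f => by
    refine (Seminorm.le_def.mp hb f).trans ?_
    rw [smul_apply]
    refine mul_le_mul_of_nonneg_left ?_ C.coe_nonneg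
    refine Seminorm.finset_sup_apply_le (norm_nonneg _) fun m hm => ?_
    exact hJle f ⟨m, Finset.mem_insert_of_mem hm⟩
  have hinj : Function.Injective J := by
    refine (injective_iff_map_eq_zero J).mpr fun f hf => ?_
    ext y
    have h1 := (hJle f ⟨(0, 0), Finset.mem_insert_self _ _⟩).trans_eq (by rw [hf])
    have h2 := (SchwartzMap.norm_le_seminorm ℂ f y).trans h1
    exact norm_le_zero_iff.mp (h2.trans_eq norm_zero)
  obtain ⟨ℓ, hℓJ⟩ := exists_clm_comp_eq (J := J.toLinearMap) hinj L.toLinearMap C hLJ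
  have hJI := SchwartzMap.integrable_clm_comp hH hint J
  -- Evaluations at a point and a tuple of vectors separate jets, which reduces the vector-valued
  -- identity to differentiation under the integral.
  have hJG : J G = ∫ s, J (H s) ∂μ := by
    refine funext fun m => BoundedJet.ext fun y v => ?_
    have h1 := ((BoundedJet.evalCLM y v).comp (ContinuousLinearMap.proj (R := ℂ)
        (φ := fun m : t' => BoundedJet E m.1.2) m)).integral_comp_comm hJI
    refine Eq.trans ?_ h1
    change (‖y‖ ^ m.1.1 : ℝ) • iteratedFDeriv ℝ m.1.2 G y v =
      ∫ s, (‖y‖ ^ m.1.1 : ℝ) • iteratedFDeriv ℝ m.1.2 (H s) y v ∂μ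
    rw [integral_smul, SchwartzMap.iteratedFDeriv_eq_integral hH hint hG]
  have h2 := ℓ.integral_comp_comm hJI
  have h3 := hℓJ G
  change ℓ (J G) = L G at h3
  rw [← h3, hJG, ← h2]
  exact integral_congr_ae (Eventually.of_forall fun s => hℓJ (H s))

end SchwartzIntegral

/-! ### Growth and continuity of phase space shifts. -/

section PhaseSpaceShift

variable {E : Type*} [NormedAddCommGroup E] [NormedSpace ℝ E]

/-- The phase space shift `y ↦ e^{2πi ℓ(y)} Φ(y - z)`. -/
def phaseShift (Φ : 𝓢(E, ℂ)) (ℓ : E →L[ℝ] ℝ) (z : E) : 𝓢(E, ℂ) :=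
  SchwartzMap.smulLeftCLM ℂ (fun y => expTwoPiI (ℓ y)) (SchwartzMap.compSubConstCLM ℂ z Φ)

theorem phaseShift_apply (Φ : 𝓢(E, ℂ)) (ℓ : E →L[ℝ] ℝ) (z y : E) :
    phaseShift Φ ℓ z y = expTwoPiI (ℓ y) * Φ (y - z) := by
  simp [phaseShift, SchwartzMap.smulLeftCLM_apply_apply (hasTemperateGrowth_phase ℓ)]

theorem iteratedDeriv_expTwoPiI (n : ℕ) :
    iteratedDeriv n expTwoPiI = fun s => (2 * Real.pi * Complex.I) ^ n * expTwoPiI s := by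
  induction n with
  | zero => simp
  | succ n ih =>
    rw [iteratedDeriv_succ, ih]
    funext s
    have h : HasDerivAt expTwoPiI (expTwoPiI s * (2 * Real.pi * Complex.I)) s := by
      have h0 : HasDerivAt (fun s : ℝ => (2 * Real.pi * Complex.I * s : ℂ))
          (2 * Real.pi * Complex.I) s := by
        simpa using (Complex.ofRealCLM.hasDerivAt (x := s)).const_mul (2 * Real.pi * Complex.I)
      exact h0.cexp
    rw [(h.const_mul _).deriv]
    ring

theorem norm_iteratedFDeriv_expTwoPiI_comp_le (ℓ : E →L[ℝ] ℝ) (n : ℕ) (y : E) :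
    ‖iteratedFDeriv ℝ n (fun y => expTwoPiI (ℓ y)) y‖ ≤ (2 * Real.pi) ^ n * ‖ℓ‖ ^ n := by
  have h := ℓ.iteratedFDeriv_comp_right hasTemperateGrowth_expTwoPiI.1 y (i := n) (mod_cast le_top)
  change iteratedFDeriv ℝ n (fun y => expTwoPiI (ℓ y)) y = _ at h
  rw [h]
  refine (ContinuousMultilinearMap.norm_compContinuousLinearMap_le _ _).trans_eq ?_
  rw [norm_iteratedFDeriv_eq_norm_iteratedDeriv, iteratedDeriv_expTwoPiI]
  simp [norm_expTwoPiI, abs_of_pos Real.pi_pos]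

/-- By Leibniz each derivative falling on the character costs a factor ‖ℓ‖, and the weight satisfies
‖y‖ ≤ (1 + ‖z‖)(1 + ‖y - z‖). The polynomial growth will be beaten by the rapid decay of the
density. -/
theorem exists_seminorm_phaseShift_le (Φ : 𝓢(E, ℂ)) (k n : ℕ) :
    ∃ C : ℝ, 0 ≤ C ∧ ∀ (ℓ : E →L[ℝ] ℝ) (z : E),
      SchwartzMap.seminorm ℂ k n (phaseShift Φ ℓ z) ≤ C * (1 + ‖ℓ‖) ^ n * (1 + ‖z‖) ^ k := by
  set M := 2 ^ k * ((Finset.Iic (k, n)).sup (schwartzSeminormFamily ℂ E ℂ)) Φ with hM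
  have hM0 : 0 ≤ M := by positivity
  refine ⟨∑ i ∈ Finset.range (n + 1), (n.choose i : ℝ) * (2 * Real.pi) ^ i * M, by positivity,
    fun ℓ z => SchwartzMap.seminorm_le_bound ℂ k n _ (by positivity) fun y => ?_⟩
  have hfun : (phaseShift Φ ℓ z : E → ℂ) = fun y => expTwoPiI (ℓ y) * Φ (y - z) :=
    funext fun y => phaseShift_apply Φ ℓ z y
  have hsub : ContDiff ℝ ∞ (fun y => Φ (y - z)) :=
    (Φ.smooth ⊤).comp (contDiff_id.sub contDiff_const)
  have hmul := norm_iteratedFDeriv_mul_le (𝕜 := ℝ) (N := ∞) (f := fun y => expTwoPiI (ℓ y))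
    (g := fun y => Φ (y - z)) (hasTemperateGrowth_phase ℓ).1 hsub y (n := n) (mod_cast le_top)
  rw [hfun]
  refine (mul_le_mul_of_nonneg_left hmul (by positivity)).trans ?_
  rw [Finset.mul_sum, Finset.sum_mul, Finset.sum_mul]
  refine Finset.sum_le_sum fun i hi => ?_
  have hi' : i ≤ n := Nat.lt_succ_iff.mp (Finset.mem_range.mp hi)
  have h1 := norm_iteratedFDeriv_expTwoPiI_comp_le ℓ i y
  have h2 : (1 + ‖y - z‖) ^ k * ‖iteratedFDeriv ℝ (n - i) (fun y => Φ (y - z)) y‖ ≤ M := by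
    rw [iteratedFDeriv_comp_sub]
    exact SchwartzMap.one_add_le_sup_seminorm_apply (𝕜 := ℂ) (m := (k, n)) le_rfl
      (Nat.sub_le n i) Φ (y - z)
  have h3 : ‖y‖ ≤ (1 + ‖z‖) * (1 + ‖y - z‖) := by
    have : ‖y‖ ≤ ‖y - z‖ + ‖z‖ := by simpa using norm_add_le (y - z) z
    nlinarith [norm_nonneg z, norm_nonneg (y - z), mul_nonneg (norm_nonneg z) (norm_nonneg (y - z))]
  have h4 : ‖ℓ‖ ^ i ≤ (1 + ‖ℓ‖) ^ n :=
    (pow_le_pow_left₀ (norm_nonneg _) (by linarith) i).trans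
      (pow_le_pow_right₀ (by linarith [norm_nonneg ℓ]) hi')
  set A := ‖iteratedFDeriv ℝ i (fun y => expTwoPiI (ℓ y)) y‖
  set B := ‖iteratedFDeriv ℝ (n - i) (fun y => Φ (y - z)) y‖
  calc ‖y‖ ^ k * ((n.choose i : ℝ) * A * B)
      ≤ ((1 + ‖z‖) * (1 + ‖y - z‖)) ^ k * ((n.choose i : ℝ) *
          ((2 * Real.pi) ^ i * (1 + ‖ℓ‖) ^ n) * B) := by
        gcongr
        exact h1.trans (by gcongr)
    _ = (n.choose i : ℝ) * (2 * Real.pi) ^ i * ((1 + ‖y - z‖) ^ k * B) * (1 + ‖ℓ‖) ^ n *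
          (1 + ‖z‖) ^ k := by rw [mul_pow]; ring
    _ ≤ _ := by gcongr

theorem continuous_phaseShift {P : Type*} [NormedAddCommGroup P] [NormedSpace ℝ P]
    [FiniteDimensional ℝ P] (Φ : 𝓢(E, ℂ)) (A : P →L[ℝ] E →L[ℝ] ℝ) (B : P →L[ℝ] E) :
    Continuous fun s => phaseShift Φ (A s) (B s) := by
  rw [continuous_iff_continuousAt]
  intro s₀
  -- A cutoff in the parameter, equal to 1 near s₀, turns the whole family into slices of one
  -- Schwartz function on E × P, and slices depend continuously on the parameter.
  set b : ContDiffBump s₀ := ⟨1, 2, one_pos, one_lt_two⟩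
  have hb1 : HasCompactSupport fun s => (b s : ℂ) :=
    b.hasCompactSupport.comp_left (g := fun x : ℝ => (x : ℂ)) Complex.ofReal_zero
  set ρ : 𝓢(P, ℂ) := hb1.toSchwartzMap (Complex.ofRealCLM.contDiff.comp b.contDiff) with hρ
  have hρa : ∀ s, ρ s = b s := fun s => rfl
  have hshear : (fun z : E × P => (z.1 - B z.2, z.2)).HasTemperateGrowth :=
    ((ContinuousLinearMap.fst ℝ E P - B.comp (ContinuousLinearMap.snd ℝ E P)).prod
      (ContinuousLinearMap.snd ℝ E P)).hasTemperateGrowth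
  have hup : ∃ (k : ℕ) (C : ℝ), ∀ z : E × P, ‖z‖ ≤ C * (1 + ‖(z.1 - B z.2, z.2)‖) ^ k := by
    refine ⟨1, 1 + ‖B‖, fun z => ?_⟩
    have h1 : ‖z.1 - B z.2‖ ≤ ‖(z.1 - B z.2, z.2)‖ := norm_fst_le (z.1 - B z.2, z.2)
    have h2 : ‖z.2‖ ≤ ‖(z.1 - B z.2, z.2)‖ := norm_snd_le (z.1 - B z.2, z.2)
    have h3 : ‖B z.2‖ ≤ ‖B‖ * ‖z.2‖ := B.le_opNorm _
    have h4 : ‖z.1‖ ≤ ‖z.1 - B z.2‖ + ‖B z.2‖ := by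
      simpa using norm_add_le (z.1 - B z.2) (B z.2)
    have h5 := norm_nonneg B
    have h6 := mul_le_mul_of_nonneg_left h2 h5
    have h7 := norm_nonneg (z.1 - B z.2, z.2)
    rw [pow_one, Prod.norm_def z]
    refine max_le ?_ ?_ <;> nlinarith [mul_nonneg h5 h7]
  have hphase : (fun z : E × P => expTwoPiI (A z.2 z.1)).HasTemperateGrowth :=
    hasTemperateGrowth_expTwoPiI.comp (A.bilinear_hasTemperateGrowth
      (ContinuousLinearMap.snd ℝ E P).hasTemperateGrowth
      (ContinuousLinearMap.fst ℝ E P).hasTemperateGrowth)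
  set H : 𝓢(E × P, ℂ) := SchwartzMap.smulLeftCLM ℂ (fun z : E × P => expTwoPiI (A z.2 z.1))
    (SchwartzMap.compCLM ℂ hshear hup (tensorLeft ρ Φ)) with hH
  have hslice : ∀ s, sliceCLM s H = (b s : ℂ) • phaseShift Φ (A s) (B s) := by
    intro s
    ext y
    simp only [sliceCLM_apply, hH, SchwartzMap.smulLeftCLM_apply_apply hphase,
      SchwartzMap.compCLM_apply, Function.comp, tensorLeft_apply, smul_apply,
      phaseShift_apply, smul_eq_mul, hρa]
    ring
  refine (continuous_sliceCLM H).continuousAt.congr ?_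
  filter_upwards [b.eventuallyEq_one] with s hs
  rw [hslice, hs]
  simp

end PhaseSpaceShift

/-! ### Short-time Fourier transforms: decay, covariance and inversion. -/

section Gabor

theorem expTwoPiI_add (s t : ℝ) : expTwoPiI (s + t) = expTwoPiI s * expTwoPiI t := by
  rw [expTwoPiI, expTwoPiI, expTwoPiI, ← Complex.exp_add]
  congr 1
  push_cast
  ring

@[fun_prop]
theorem continuous_expTwoPiI : Continuous expTwoPiI := hasTemperateGrowth_expTwoPiI.1.continuous

variable {d : ℕ}

theorem fourier_eq_integral_expTwoPiI (h : Rd d → ℂ) (w : Rd d) :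
    𝓕 h w = ∫ v, expTwoPiI (-inner ℝ v w) * h v := by
  rw [Real.fourier_eq']
  refine integral_congr_ae (Eventually.of_forall fun v => ?_)
  simp only [expTwoPiI, smul_eq_mul]
  congr 2
  push_cast
  ring

theorem fourierInv_eq_integral_expTwoPiI (h : Rd d → ℂ) (w : Rd d) :
    𝓕⁻ h w = ∫ v, expTwoPiI (inner ℝ v w) * h v := by
  rw [Real.fourierInv_eq']
  refine integral_congr_ae (Eventually.of_forall fun v => ?_)
  simp only [expTwoPiI, smul_eq_mul]
  congr 2
  push_cast
  ring

/-- The short-time Fourier transform with window `χ` of a tempered distribution. -/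
def gaborTransform (χ : 𝓢(Rd d, ℂ)) (f : 𝓢'(Rd d, ℂ)) (t ν : Rd d) : ℂ :=
  f (timeFreqShift χ t ν)

theorem timeFreqShift_eq_phaseShift (χ : 𝓢(Rd d, ℂ)) (t ν : Rd d) :
    timeFreqShift χ t ν = phaseShift χ (-(innerSL ℝ ν)) t := by
  ext y
  rw [timeFreqShift_apply, phaseShift_apply]
  simp [real_inner_comm]

theorem continuous_timeFreqShift (χ : 𝓢(Rd d, ℂ)) :
    Continuous fun z : Rd d × Rd d => timeFreqShift χ z.1 z.2 := by
  simp_rw [timeFreqShift_eq_phaseShift]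
  exact continuous_phaseShift χ (-((innerSL ℝ).comp (ContinuousLinearMap.snd ℝ (Rd d) (Rd d))))
    (ContinuousLinearMap.fst ℝ (Rd d) (Rd d))

theorem continuous_gaborTransform (χ : 𝓢(Rd d, ℂ)) (f : 𝓢'(Rd d, ℂ)) :
    Continuous fun z : Rd d × Rd d => gaborTransform χ f z.1 z.2 :=
  (ContinuousLinearMap.continuous f).comp (continuous_timeFreqShift χ)

theorem gaborTransform_coe (χ g : 𝓢(Rd d, ℂ)) (t ν : Rd d) :
    gaborTransform χ (g : 𝓢'(Rd d, ℂ)) t ν =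
      ∫ y, expTwoPiI (-inner ℝ y ν) * (g y * χ (y - t)) := by
  rw [gaborTransform, SchwartzMap.coe_apply]
  refine integral_congr_ae (Eventually.of_forall fun y => ?_)
  simp only [timeFreqShift_apply, smul_eq_mul]
  ring

/-- The linear map sending `g` to the Schwartz function `(y, t) ↦ g(y) χ(y - t)`. -/
def windowCLM (χ : 𝓢(Rd d, ℂ)) : 𝓢(Rd d, ℂ) →L[ℂ] 𝓢(Rd d × Rd d, ℂ) :=
  (SchwartzMap.compCLM ℂ (g := fun z : Rd d × Rd d => (z.1, z.1 - z.2))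
    ((ContinuousLinearMap.fst ℝ (Rd d) (Rd d)).prod (ContinuousLinearMap.fst ℝ (Rd d) (Rd d) -
      ContinuousLinearMap.snd ℝ (Rd d) (Rd d))).hasTemperateGrowth
    ⟨1, 2, fun z => by
      have h1 : ‖z.1‖ ≤ ‖(z.1, z.1 - z.2)‖ := norm_fst_le (z.1, z.1 - z.2)
      have h2 : ‖z.1 - z.2‖ ≤ ‖(z.1, z.1 - z.2)‖ := norm_snd_le (z.1, z.1 - z.2)
      have h3 : ‖z.2‖ ≤ ‖z.1‖ + ‖z.1 - z.2‖ := by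
        simpa using norm_sub_le z.1 (z.1 - z.2)
      have h4 := norm_nonneg (z.1, z.1 - z.2)
      rw [pow_one, Prod.norm_def z]
      exact max_le (by linarith) (by linarith)⟩).comp (tensorLeft χ)

theorem gaborTransform_coe_eq_fourier (χ g : 𝓢(Rd d, ℂ)) (t ν : Rd d) :
    gaborTransform χ (g : 𝓢'(Rd d, ℂ)) t ν = 𝓕 (sliceCLM t (windowCLM χ g)) ν := by
  rw [gaborTransform_coe, SchwartzMap.fourier_coe, fourier_eq_integral_expTwoPiI]
  rfl

/-- Both ‖y‖ and ‖s‖ are at most ‖(y, s)‖, so a seminorm of H with N more powers of weight pays for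
decay of order N in s. -/
theorem one_add_norm_pow_mul_seminorm_sliceCLM_le {E P : Type*} [NormedAddCommGroup E]
    [NormedSpace ℝ E] [NormedAddCommGroup P] [NormedSpace ℝ P] (H : 𝓢(E × P, ℂ)) (N k n : ℕ)
    (s : P) : (1 + ‖s‖) ^ N * SchwartzMap.seminorm ℂ k n (sliceCLM s H) ≤
      2 ^ (k + N) * ((Finset.Iic (k + N, n)).sup (schwartzSeminormFamily ℂ (E × P) ℂ)) H := by
  have hpos : 0 < (1 + ‖s‖) ^ N := by positivity
  rw [← le_div_iff₀' hpos]
  refine SchwartzMap.seminorm_le_bound ℂ k n _ (by positivity) fun y => ?_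
  rw [le_div_iff₀' hpos]
  have h1 := norm_iteratedFDeriv_comp_le_of_norm_le_one (ContinuousLinearMap.inl ℝ E P)
    (ContinuousLinearMap.norm_inl_le_one ℝ E P) (fun z : E × P => H (z + (0, s)))
    ((H.smooth ⊤).comp (contDiff_id.add contDiff_const)) n y
  rw [iteratedFDeriv_comp_add_right] at h1
  have h2 : (fun y : E => H (ContinuousLinearMap.inl ℝ E P y + (0, s))) =
      (sliceCLM s H : 𝓢(E, ℂ)) := by
    funext y
    simp [sliceCLM_apply]
  rw [h2] at h1
  simp only [ContinuousLinearMap.inl_apply, Prod.mk_add_mk, add_zero, zero_add] at h1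
  have h3 := SchwartzMap.one_add_le_sup_seminorm_apply (𝕜 := ℂ) (m := (k + N, n)) le_rfl le_rfl
    H (y, s)
  refine le_trans ?_ h3
  have hy : ‖y‖ ≤ 1 + ‖(y, s)‖ := by linarith [norm_fst_le (y, s)]
  have hs : 1 + ‖s‖ ≤ 1 + ‖(y, s)‖ := by linarith [norm_snd_le (y, s)]
  calc (1 + ‖s‖) ^ N * (‖y‖ ^ k * ‖iteratedFDeriv ℝ n (sliceCLM s H) y‖)
      ≤ (1 + ‖(y, s)‖) ^ N * ((1 + ‖(y, s)‖) ^ k * ‖iteratedFDeriv ℝ n H (y, s)‖) := by gcongr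
    _ = _ := by rw [pow_add]; ring

/-- The short-time Fourier transform of a Schwartz function decays rapidly, with constants
controlled by a continuous seminorm. -/
theorem exists_seminorm_gaborTransform_le (χ : 𝓢(Rd d, ℂ)) (N : ℕ) :
    ∃ q : Seminorm ℂ 𝓢(Rd d, ℂ), Continuous q ∧ ∀ (g : 𝓢(Rd d, ℂ)) (t ν : Rd d),
      (1 + ‖t‖) ^ N * (1 + ‖ν‖) ^ N * ‖gaborTransform χ (g : 𝓢'(Rd d, ℂ)) t ν‖ ≤ q g := by
  have hcont : ∀ (E : Type) [NormedAddCommGroup E] [NormedSpace ℝ E] (m : ℕ × ℕ),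
      Continuous ((Finset.Iic m).sup (schwartzSeminormFamily ℂ E ℂ) : Seminorm ℂ 𝓢(E, ℂ)) := fun E _ _ m =>
    Seminorm.continuous_finsetSup fun i _ => (schwartz_withSeminorms ℂ E ℂ).continuous_seminorm i
  set F : 𝓢(Rd d, ℂ) →L[ℂ] 𝓢(Rd d, ℂ) := SchwartzMap.fourierTransformCLM ℂ
  obtain ⟨s, C, -, hC⟩ := Seminorm.bound_of_continuous (schwartz_withSeminorms ℂ (Rd d) ℂ)
    (((Finset.Iic (N, 0)).sup (schwartzSeminormFamily ℂ (Rd d) ℂ)).comp F.toLinearMap)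
    ((hcont (Rd d) (N, 0)).comp F.continuous)
  -- Decay in ν costs seminorms of the slice, by continuity of the Fourier transform; decay in t
  -- costs N more powers of weight, recorded in p.
  set p : ℕ × ℕ → Seminorm ℂ 𝓢(Rd d × Rd d, ℂ) := fun m => (2 ^ (m.1 + N) : ℝ≥0) •
    (Finset.Iic (m.1 + N, m.2)).sup (schwartzSeminormFamily ℂ (Rd d × Rd d) ℂ) with hp
  refine ⟨((2 ^ N * C : ℝ≥0) • s.sup p).comp (windowCLM χ).toLinearMap, ?_, fun g t ν => ?_⟩
  · refine Continuous.comp (g := ((2 ^ N * C : ℝ≥0) • s.sup p)) ?_ (windowCLM χ).continuous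
    exact Continuous.const_smul (Seminorm.continuous_finsetSup fun i _ =>
      (hcont (Rd d × Rd d) (i.1 + N, i.2)).const_smul _) _
  rw [gaborTransform_coe_eq_fourier]
  set h := sliceCLM t (windowCLM χ g) with hh
  have h1 : (1 + ‖ν‖) ^ N * ‖𝓕 h ν‖ ≤ 2 ^ N * (C * s.sup (schwartzSeminormFamily ℂ (Rd d) ℂ) h) := by
    have h2 := SchwartzMap.one_add_le_sup_seminorm_apply (𝕜 := ℂ) (m := (N, 0)) le_rfl le_rfl
      (𝓕 h) ν
    rw [norm_iteratedFDeriv_zero] at h2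
    refine h2.trans ?_
    gcongr
    exact Seminorm.le_def.mp hC h
  have h3 : (1 + ‖t‖) ^ N * s.sup (schwartzSeminormFamily ℂ (Rd d) ℂ) h ≤
      s.sup p (windowCLM χ g) := by
    have hpos : 0 < (1 + ‖t‖) ^ N := by positivity
    rw [← le_div_iff₀' hpos]
    refine Seminorm.finset_sup_apply_le (by positivity) fun m hm => ?_
    rw [le_div_iff₀' hpos]
    refine (one_add_norm_pow_mul_seminorm_sliceCLM_le (windowCLM χ g) N m.1 m.2 t).trans ?_
    exact Seminorm.le_def.mp (Finset.le_sup (f := p) hm) (windowCLM χ g)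
  change _ ≤ (2 ^ N * C : ℝ) * s.sup p (windowCLM χ g)
  calc _ = (1 + ‖t‖) ^ N * ((1 + ‖ν‖) ^ N * ‖𝓕 h ν‖) := by ring
    _ ≤ (1 + ‖t‖) ^ N * (2 ^ N * (C * s.sup (schwartzSeminormFamily ℂ (Rd d) ℂ) h)) := by gcongr
    _ = 2 ^ N * C * ((1 + ‖t‖) ^ N * s.sup (schwartzSeminormFamily ℂ (Rd d) ℂ) h) := by ring
    _ ≤ _ := by gcongr

/-- Covariance: up to a phase, shifting the function by (s, μ) recentres its transform at (s, -μ).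
-/
theorem gaborTransform_timeFreqShift (χ g : 𝓢(Rd d, ℂ)) (s μ t ν : Rd d) :
    gaborTransform χ (timeFreqShift g s μ : 𝓢'(Rd d, ℂ)) t ν =
      expTwoPiI (-inner ℝ s (ν + μ)) * gaborTransform χ (g : 𝓢'(Rd d, ℂ)) (t - s) (ν + μ) := by
  rw [gaborTransform_coe, gaborTransform_coe, ← integral_const_mul,
    ← integral_add_right_eq_self _ s]
  refine integral_congr_ae (Eventually.of_forall fun y => ?_)
  simp only [timeFreqShift_apply]
  rw [add_sub_cancel_right, show y + s - t = y - (t - s) by abel, ← mul_assoc, ← mul_assoc,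
    ← mul_assoc, ← mul_assoc, ← expTwoPiI_add, ← expTwoPiI_add]
  congr 3
  simp only [inner_add_left, inner_add_right]
  ring

theorem integral_expTwoPiI_mul_gaborTransform (χ g : 𝓢(Rd d, ℂ)) (t y : Rd d) :
    ∫ ν, expTwoPiI (inner ℝ ν y) * gaborTransform χ (g : 𝓢'(Rd d, ℂ)) t ν = g y * χ (y - t) := by
  simp_rw [gaborTransform_coe_eq_fourier]
  rw [← fourierInv_eq_integral_expTwoPiI, ← SchwartzMap.fourierInv_coe,
    FourierTransform.fourierInv_fourier_eq]
  rfl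

/-- For even χ, the modulated transform e^{2πi u·ξ} V f(u, ξ) is the convolution in u of f with
e^{2πi u·ξ} χ(u), so its Fourier transform is a product. This is the inversion used in t₁ and t₂. -/
theorem integral_expTwoPiI_mul_gaborTransform_left {χ : 𝓢(Rd d, ℂ)} (hχ : ∀ y, χ (-y) = χ y)
    (f : 𝓢(Rd d, ℂ)) (ξ η : Rd d) :
    ∫ u, expTwoPiI (-inner ℝ u η) *
      (expTwoPiI (inner ℝ u ξ) * gaborTransform χ (f : 𝓢'(Rd d, ℂ)) u ξ) =
      𝓕 f η * 𝓕 χ (η - ξ) := by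
  simp_rw [gaborTransform_coe]
  have h1 : ∀ u, expTwoPiI (-inner ℝ u η) * (expTwoPiI (inner ℝ u ξ) *
      ∫ y, expTwoPiI (-inner ℝ y ξ) * (f y * χ (y - u))) =
      ∫ y, expTwoPiI (-inner ℝ y η) * f y *
        (expTwoPiI (-inner ℝ (u - y) (η - ξ)) * χ (u - y)) := by
    intro u
    rw [← mul_assoc, ← integral_const_mul]
    refine integral_congr_ae (Eventually.of_forall fun y => ?_)
    simp only
    rw [← hχ (y - u), neg_sub]
    have : expTwoPiI (-inner ℝ u η) * expTwoPiI (inner ℝ u ξ) * expTwoPiI (-inner ℝ y ξ) =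
        expTwoPiI (-inner ℝ y η) * expTwoPiI (-inner ℝ (u - y) (η - ξ)) := by
      rw [← expTwoPiI_add, ← expTwoPiI_add, ← expTwoPiI_add]
      congr 1
      simp only [inner_sub_left, inner_sub_right]
      ring
    linear_combination f y * χ (u - y) * this
  simp_rw [h1]
  rw [integral_integral_swap]
  · have h2 : ∀ y, ∫ u, expTwoPiI (-inner ℝ y η) * f y *
        (expTwoPiI (-inner ℝ (u - y) (η - ξ)) * χ (u - y)) =
        expTwoPiI (-inner ℝ y η) * f y * 𝓕 χ (η - ξ) := by
      intro y
      rw [integral_const_mul, integral_sub_right_eq_self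
        (fun u => expTwoPiI (-inner ℝ u (η - ξ)) * χ u) y, SchwartzMap.fourier_coe,
        fourier_eq_integral_expTwoPiI]
    simp_rw [h2]
    rw [integral_mul_const, SchwartzMap.fourier_coe f, fourier_eq_integral_expTwoPiI]
  · have hI : Integrable (fun z : Rd d × Rd d => χ (z.1 - z.2) * f z.2)
        ((volume : Measure (Rd d)).prod volume) :=
      f.integrable.convolution_integrand (ContinuousLinearMap.mul ℂ ℂ).flip χ.integrable
    refine hI.mono (Continuous.aestronglyMeasurable (by fun_prop))
      (Eventually.of_forall fun z => le_of_eq ?_)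
    simp only [Function.uncurry_def, norm_mul, norm_expTwoPiI, one_mul]
    ring

end Gabor

/-! ### The window γ∗γ and the gain of integrability. -/

section WideGaussian

variable {d : ℕ}

/-- The Gaussian `y ↦ e^{-‖y‖²/2}` as a Schwartz function. -/
def wideGaussian (d : ℕ) : 𝓢(Rd d, ℂ) :=
  SchwartzMap.compCLMOfContinuousLinearEquiv ℂ
    (ContinuousLinearEquiv.smulLeft (Units.mk0 (√2)⁻¹ (by positivity)) : Rd d ≃L[ℝ] Rd d)
    (gaussianWindow (Rd d))

theorem wideGaussian_apply (y : Rd d) :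
    wideGaussian d y = Complex.exp (-(1 / 2 : ℂ) * (‖y‖ : ℂ) ^ 2) := by
  have h : wideGaussian d y = gaussianWindow (Rd d) ((√2)⁻¹ • y) := rfl
  rw [h, gaussianWindow_apply, norm_smul, mul_pow, Real.norm_of_nonneg (by positivity), inv_pow,
    Real.sq_sqrt zero_le_two, Complex.ofReal_exp]
  push_cast
  congr 1
  ring

theorem wideGaussian_neg (y : Rd d) : wideGaussian d (-y) = wideGaussian d y := by
  rw [wideGaussian_apply, wideGaussian_apply, norm_neg]

/-- Needed later for the inversion constant: multiplying φ by this function cannot make it vanish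
identically. -/
theorem fourier_wideGaussian_ne_zero (w : Rd d) : 𝓕 (wideGaussian d) w ≠ 0 := by
  have h : (wideGaussian d : Rd d → ℂ) = fun v => Complex.exp (-(1 / 2 : ℂ) * (‖v‖ : ℂ) ^ 2) :=
    funext wideGaussian_apply
  rw [SchwartzMap.fourier_coe, h, fourier_gaussian_innerProductSpace (by norm_num)]
  refine mul_ne_zero ?_ (Complex.exp_ne_zero _)
  rw [Complex.cpow_def_of_ne_zero (by simp [Real.pi_ne_zero])]
  exact Complex.exp_ne_zero _

theorem gaussianWindow_neg (y : Rd d) :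
    gaussianWindow (Rd d) (-y) = gaussianWindow (Rd d) y := by
  simp

theorem gaussianWindow_ne_zero (y : Rd d) : gaussianWindow (Rd d) y ≠ 0 := by
  rw [gaussianWindow_apply]
  exact_mod_cast (Real.exp_pos _).ne'

/-- Completing the square: ‖v‖² + ‖y - v‖² = 2‖v - y/2‖² + ‖y‖²/2, so κ = ∫ e^{-2‖v‖²}. -/
theorem exists_integral_gaussianWindow_mul (d : ℕ) : ∃ κ : ℂ, κ ≠ 0 ∧ ∀ y : Rd d,
    κ * wideGaussian d y = ∫ v, gaussianWindow (Rd d) v * gaussianWindow (Rd d) (y - v) := by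
  refine ⟨∫ v : Rd d, Complex.exp (-2 * (‖v‖ : ℂ) ^ 2), ?_, fun y => ?_⟩
  · rw [GaussianFourier.integral_cexp_neg_mul_sq_norm (by norm_num)]
    rw [Complex.cpow_def_of_ne_zero (by simp [Real.pi_ne_zero])]
    exact Complex.exp_ne_zero _
  · rw [← integral_mul_const, ← integral_sub_right_eq_self _ ((1 / 2 : ℝ) • y)]
    refine integral_congr_ae (Eventually.of_forall fun v => ?_)
    simp only [gaussianWindow_apply, wideGaussian_apply]
    rw [Complex.ofReal_exp, Complex.ofReal_exp, ← Complex.exp_add, ← Complex.exp_add]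
    congr 1
    have h : -2 * ‖v - (1 / 2 : ℝ) • y‖ ^ 2 + -(1 / 2) * ‖y‖ ^ 2 = -‖v‖ ^ 2 + -‖y - v‖ ^ 2 := by
      rw [norm_sub_sq_real, norm_sub_sq_real, inner_smul_right, norm_smul, mul_pow,
        Real.norm_of_nonneg (by norm_num), real_inner_comm]
      ring
    have h' := congrArg (fun x : ℝ => (x : ℂ)) h
    push_cast at h' ⊢
    exact h'

theorem integrable_norm_mul_one_add_norm_pow (g : 𝓢(Rd d, ℂ)) (k : ℕ) :
    Integrable fun v => ‖g v‖ * (1 + ‖v‖) ^ k := by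
  obtain ⟨M, hM⟩ : ∃ M, ∀ v, (1 + ‖v‖) ^ (k + (d + 1)) * ‖g v‖ ≤ M :=
    ⟨_, fun v => by
      simpa using SchwartzMap.one_add_le_sup_seminorm_apply (𝕜 := ℂ) (m := (k + (d + 1), 0))
        le_rfl le_rfl g v⟩
  have hI := (integrable_one_add_norm (E := Rd d) (μ := volume) (r := (d + 1 : ℕ))
    (by simp)).const_mul M
  refine hI.mono' (by fun_prop) (Eventually.of_forall fun v => ?_)
  have hpos : (0 : ℝ) < 1 + ‖v‖ := by positivity
  rw [Real.norm_of_nonneg (by positivity), Real.rpow_neg hpos.le, Real.rpow_natCast,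
    ← div_eq_mul_inv, le_div_iff₀ (by positivity)]
  refine le_trans (le_of_eq ?_) (hM v)
  rw [pow_add]
  ring

/-- The shifted wide window is a superposition of shifted windows γ, and a tempered distribution may
be applied under that integral. -/
theorem exists_gaborTransform_wideGaussian_eq (d : ℕ) : ∃ κ : ℂ, κ ≠ 0 ∧
    ∀ (f : 𝓢'(Rd d, ℂ)) (u ξ : Rd d), κ * gaborTransform (wideGaussian d) f u ξ =
      ∫ v, gaussianWindow (Rd d) v * stft f (u + v) ξ := by
  obtain ⟨κ, hκ, hκe⟩ := exists_integral_gaussianWindow_mul d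
  refine ⟨κ, hκ, fun f u ξ => ?_⟩
  set γ := gaussianWindow (Rd d) with hγ
  set L : 𝓢(Rd d, ℂ) →L[ℂ] ℂ := ⟨f.toLinearMap, ContinuousLinearMap.continuous f⟩ with hL
  have hH : Continuous fun v : Rd d => γ v • timeFreqShift γ (u + v) ξ :=
    γ.continuous.smul ((continuous_timeFreqShift γ).comp
      (f := fun v : Rd d => (u + v, ξ)) (by fun_prop))
  have hint : ∀ k n, Integrable
      (fun v => SchwartzMap.seminorm ℂ k n (γ v • timeFreqShift γ (u + v) ξ)) := by
    intro k n
    obtain ⟨C, hC0, hC⟩ := exists_seminorm_phaseShift_le γ k n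
    refine ((integrable_norm_mul_one_add_norm_pow γ k).const_mul
      (C * (1 + ‖-(innerSL ℝ ξ)‖) ^ n * (1 + ‖u‖) ^ k)).mono'
      (((schwartz_withSeminorms ℂ (Rd d) ℂ).continuous_seminorm (k, n)).comp
        hH).aestronglyMeasurable (Eventually.of_forall fun v => ?_)
    rw [Real.norm_of_nonneg (apply_nonneg _ _), map_smul_eq_mul, timeFreqShift_eq_phaseShift]
    have h1 : 1 + ‖u + v‖ ≤ (1 + ‖u‖) * (1 + ‖v‖) := by
      nlinarith [norm_add_le u v, mul_nonneg (norm_nonneg u) (norm_nonneg v)]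
    calc ‖γ v‖ * _ ≤ ‖γ v‖ * (C * (1 + ‖-(innerSL ℝ ξ)‖) ^ n * (1 + ‖u + v‖) ^ k) := by
          gcongr
          exact hC _ _
      _ ≤ ‖γ v‖ * (C * (1 + ‖-(innerSL ℝ ξ)‖) ^ n * ((1 + ‖u‖) * (1 + ‖v‖)) ^ k) := by gcongr
      _ = _ := by rw [mul_pow]; ring
  have h := SchwartzMap.clm_apply_eq_integral (μ := volume) hH hint
    (G := κ • timeFreqShift (wideGaussian d) u ξ) (fun y => by
      simp only [smul_apply, timeFreqShift_apply, smul_eq_mul]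
      rw [mul_left_comm, hκe, ← integral_const_mul]
      refine integral_congr_ae (Eventually.of_forall fun v => ?_)
      simp only
      rw [sub_sub]
      ring) L
  simp only [map_smul, smul_eq_mul] at h
  exact h

theorem exists_enorm_gaborTransform_wideGaussian_le (d : ℕ) : ∃ C : ℝ≥0,
    ∀ (f : 𝓢'(Rd d, ℂ)) (u ξ : Rd d), ‖gaborTransform (wideGaussian d) f u ξ‖ₑ ≤
      C * ∫⁻ v, ‖gaussianWindow (Rd d) (u - v)‖ₑ * ‖stft f v ξ‖ₑ := by
  obtain ⟨κ, hκ, h⟩ := exists_gaborTransform_wideGaussian_eq d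
  refine ⟨‖κ‖₊⁻¹, fun f u ξ => ?_⟩
  have h1 : gaborTransform (wideGaussian d) f u ξ =
      κ⁻¹ * ∫ v, gaussianWindow (Rd d) v * stft f (u + v) ξ := by
    rw [← h, inv_mul_cancel_left₀ hκ]
  rw [h1, enorm_mul]
  have h2 : ‖κ⁻¹‖ₑ = ((‖κ‖₊⁻¹ : ℝ≥0) : ℝ≥0∞) := by rw [← nnnorm_inv]; rfl
  rw [h2]
  gcongr
  refine (enorm_integral_le_lintegral_enorm _).trans_eq ?_
  rw [← lintegral_sub_right_eq_self _ u]
  refine lintegral_congr fun v => ?_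
  rw [enorm_mul, add_sub_cancel, ← neg_sub u v, gaussianWindow_neg]

/-- For each frequency ξ the wide transform is dominated by a convolution with γ, which lies in all
L^s. This is how p₁, p₂ are raised to exponents fit for Hölder. -/
theorem exists_eLpNorm_gaborTransform_wideGaussian_le (d : ℕ) {p r : ℝ≥0∞} (hp : 1 ≤ p)
    (hpr : r⁻¹ ≤ p⁻¹) : ∃ C : ℝ≥0, ∀ (f : 𝓢'(Rd d, ℂ)) (ξ : Rd d),
      eLpNorm (fun u => ‖gaborTransform (wideGaussian d) f u ξ‖ₑ) r volume ≤
        C * eLpNorm (fun v => stft f v ξ) p volume := by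
  obtain ⟨C, hC⟩ := exists_enorm_gaborTransform_wideGaussian_le d
  have hγm : Measurable fun v => ‖gaussianWindow (Rd d) v‖ₑ :=
    (gaussianWindow (Rd d)).continuous.enorm.measurable
  obtain ⟨C', hC'⟩ := exists_eLpNorm_lintegral_sub_mul_le (μ := (volume : Measure (Rd d))) hγm
    (fun s _ => (eLpNorm_enorm (gaussianWindow (Rd d) : Rd d → ℂ)).trans_lt
      (SchwartzMap.eLpNorm_lt_top (gaussianWindow (Rd d)) s volume)) hp hpr
  refine ⟨C * C', fun f ξ => ?_⟩
  have hs : Measurable fun v => ‖stft f v ξ‖ₑ :=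
    ((continuous_stft f).comp (Continuous.prodMk_left ξ)).enorm.measurable
  calc _ ≤ C * eLpNorm (fun u => ∫⁻ v, ‖gaussianWindow (Rd d) (u - v)‖ₑ * ‖stft f v ξ‖ₑ) r volume :=
        eLpNorm_le_nnreal_smul_eLpNorm_of_ae_le_mul' (Eventually.of_forall fun u => by
          simpa only [enorm_eq_self] using hC f u ξ) r
    _ ≤ C * (C' * eLpNorm (fun v => ‖stft f v ξ‖ₑ) p volume) := by
        gcongr
        exact hC' _ hs
    _ = _ := by
        rw [eLpNorm_enorm]
        push_cast
        ring

end WideGaussian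

/-! ### A polynomially decaying kernel controlling short-time Fourier transforms. -/

section DecayKernel

variable {d : ℕ}

/-- The integrable kernel `(1 + ‖x‖)^{-(d+1)}` on `ℝᵈ`. -/
def decayKernel (x : Rd d) : ℝ≥0∞ := ‖((1 + ‖x‖) ^ (d + 1))⁻¹‖ₑ

@[fun_prop]
theorem measurable_decayKernel : Measurable (decayKernel (d := d)) := by
  unfold decayKernel
  fun_prop

theorem decayKernel_le_one (x : Rd d) : decayKernel x ≤ 1 := by
  rw [decayKernel, Real.enorm_of_nonneg (by positivity), ← ENNReal.ofReal_one]
  exact ENNReal.ofReal_le_ofReal (inv_le_one_of_one_le₀ (one_le_pow₀ (by simp)))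

theorem eLpNorm_decayKernel_lt_top (s : ℝ≥0∞) (hs : 1 ≤ s) :
    eLpNorm (decayKernel (d := d)) s volume < ⊤ := by
  rcases eq_or_ne s ⊤ with rfl | hst
  · rw [eLpNorm_exponent_top]
    refine (eLpNormEssSup_le_of_ae_enorm_bound (C := 1)
      (Eventually.of_forall fun x => decayKernel_le_one x)).trans_lt ENNReal.one_lt_top
  have hs1 : 1 ≤ s.toReal := by
    rw [← ENNReal.toReal_one]; exact ENNReal.toReal_mono hst hs
  rw [eLpNorm_lt_top_iff_lintegral_rpow_enorm_lt_top (zero_lt_one.trans_le hs).ne' hst]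
  have hI := (integrable_one_add_norm (E := Rd d) (μ := volume) (r := (d + 1 : ℕ))
    (by simp)).hasFiniteIntegral
  refine lt_of_le_of_lt (lintegral_mono fun x => ?_) hI
  rw [enorm_eq_self]
  calc decayKernel x ^ s.toReal ≤ decayKernel x ^ (1 : ℝ) :=
        ENNReal.rpow_le_rpow_of_exponent_ge (decayKernel_le_one x) hs1
    _ = _ := by
        simp only
        rw [ENNReal.rpow_one, decayKernel, Real.rpow_neg (by positivity), Real.rpow_natCast]

/-- From 1 + ‖y - x‖ ≤ (1 + ‖x‖)(1 + ‖y‖). It recentres the kernel at any point at polynomial cost,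
so a bound at one (s, μ) serves all test functions. -/
theorem decayKernel_le (x y : Rd d) : decayKernel x ≤ ‖(1 + ‖y‖) ^ (d + 1)‖ₑ * decayKernel (y - x) := by
  rw [decayKernel, decayKernel, ← enorm_mul, Real.enorm_of_nonneg (by positivity),
    Real.enorm_of_nonneg (by positivity)]
  refine ENNReal.ofReal_le_ofReal ?_
  rw [← div_eq_mul_inv, inv_eq_one_div, div_le_div_iff₀ (by positivity) (by positivity), one_mul,
    ← mul_pow]
  gcongr
  nlinarith [norm_sub_le y x, mul_nonneg (norm_nonneg x) (norm_nonneg y)]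

theorem decayKernel_neg (x : Rd d) : decayKernel (-x) = decayKernel x := by
  simp [decayKernel]

theorem exists_seminorm_enorm_gaborTransform_le (χ : 𝓢(Rd d, ℂ)) :
    ∃ q : Seminorm ℂ 𝓢(Rd d, ℂ), Continuous q ∧ ∀ (g : 𝓢(Rd d, ℂ)) (t ν : Rd d),
      ‖gaborTransform χ (g : 𝓢'(Rd d, ℂ)) t ν‖ₑ ≤
        ENNReal.ofReal (q g) * (decayKernel t * decayKernel ν) := by
  obtain ⟨q, hq, h⟩ := exists_seminorm_gaborTransform_le χ (d + 1)
  refine ⟨q, hq, fun g t ν => ?_⟩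
  rw [decayKernel, decayKernel, ← enorm_mul, Real.enorm_of_nonneg (by positivity),
    ← ENNReal.ofReal_mul (apply_nonneg _ _), ← ofReal_norm]
  refine ENNReal.ofReal_le_ofReal ?_
  rw [← mul_inv, ← div_eq_mul_inv, le_div_iff₀' (by positivity)]
  exact h g t ν

theorem coe_mem_modulationSpace (f : 𝓢(Rd d, ℂ)) {p q : ℝ≥0∞} (hp : 1 ≤ p) (hq : 1 ≤ q) :
    (f : 𝓢'(Rd d, ℂ)) ∈ modulationSpace d p q := by
  obtain ⟨Q, -, h⟩ := exists_seminorm_enorm_gaborTransform_le (gaussianWindow (Rd d))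
  rw [mem_modulationSpace, modulationNorm]
  set C : ℝ≥0 := (Q f).toNNReal
  set K : ℝ≥0 := (eLpNorm (decayKernel (d := d)) p volume).toNNReal
  have h1 : ∀ ν, eLpNorm (fun t => stft (f : 𝓢'(Rd d, ℂ)) t ν) p volume ≤
      (C * K : ℝ≥0) * decayKernel ν := by
    intro ν
    have h2 : eLpNorm (fun t => stft (f : 𝓢'(Rd d, ℂ)) t ν) p volume ≤
        (C * decayKernel ν).toNNReal * eLpNorm (decayKernel (d := d)) p volume := by
      refine eLpNorm_le_nnreal_smul_eLpNorm_of_ae_le_mul' (Eventually.of_forall fun t => ?_) p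
      rw [ENNReal.coe_toNNReal (ENNReal.mul_ne_top ENNReal.coe_ne_top
        (ne_top_of_le_ne_top ENNReal.one_ne_top (decayKernel_le_one ν))), enorm_eq_self]
      refine (h f t ν).trans_eq ?_
      rw [mul_comm (decayKernel t), ← mul_assoc]
      rfl
    refine h2.trans_eq ?_
    rw [ENNReal.coe_toNNReal (ENNReal.mul_ne_top ENNReal.coe_ne_top
        (ne_top_of_le_ne_top ENNReal.one_ne_top (decayKernel_le_one ν))), ENNReal.coe_mul,
        ENNReal.coe_toNNReal (eLpNorm_decayKernel_lt_top p hp).ne]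
    ring
  refine (eLpNorm_le_nnreal_smul_eLpNorm_of_ae_le_mul' (c := C * K) (g := decayKernel (d := d))
    (Eventually.of_forall fun ν => ?_) q).trans_lt
    (ENNReal.mul_lt_top ENNReal.coe_lt_top (eLpNorm_decayKernel_lt_top q hq))
  simpa only [enorm_eq_self] using h1 ν

end DecayKernel

/-! ### Atoms, measurability and profile of the symbol transform. -/

section SymbolTransform

set_option synthInstance.maxSize 5000

variable {d : ℕ}

/-- The linear phase `y ↦ -(ν·y₀ - t₁·y₁ - t₂·y₂)`, linear in `(ν, t₂, t₁)`. -/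
def symbolPhaseCLM (d : ℕ) :
    (Rd d × Rd d × Rd d) →L[ℝ] (Rd d × Rd d × Rd d) →L[ℝ] ℝ :=
  let ip (P : (Rd d × Rd d × Rd d) →L[ℝ] Rd d) (Q : (Rd d × Rd d × Rd d) →L[ℝ] Rd d) :
      (Rd d × Rd d × Rd d) →L[ℝ] (Rd d × Rd d × Rd d) →L[ℝ] ℝ :=
    ((ContinuousLinearMap.compL ℝ (Rd d × Rd d × Rd d) (Rd d) ℝ).flip Q).comp
      ((innerSL ℝ (E := Rd d)).comp P)
  let p₀ := ContinuousLinearMap.fst ℝ (Rd d) (Rd d × Rd d)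
  let p₁ := (ContinuousLinearMap.fst ℝ (Rd d) (Rd d)).comp
    (ContinuousLinearMap.snd ℝ (Rd d) (Rd d × Rd d))
  let p₂ := (ContinuousLinearMap.snd ℝ (Rd d) (Rd d)).comp
    (ContinuousLinearMap.snd ℝ (Rd d) (Rd d × Rd d))
  Neg.neg (ip p₀ p₀ - ip p₂ p₁ - ip p₁ p₂)

theorem symbolPhaseCLM_apply (s y : Rd d × Rd d × Rd d) : symbolPhaseCLM d s y =
    -(inner ℝ s.1 y.1 - inner ℝ s.2.2 y.2.1 - inner ℝ s.2.1 y.2.2) := rfl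

/-- The reflected tensor power `(y₀, y₁, y₂) ↦ φ(-y₀) φ(-y₁) φ(-y₂)`. -/
def symbolWindow (φ : 𝓢(Rd d, ℂ)) : 𝓢(Rd d × Rd d × Rd d, ℂ) :=
  tensorLeft (tensorLeft (reflTranslate 0 φ) (reflTranslate 0 φ)) (reflTranslate 0 φ)

/-- The test functions of the symbol transform as a function of the phase space point. -/
def symbolAtom (φ : 𝓢(Rd d, ℂ)) (z : SymbolPhase d) : 𝓢(Rd d × Rd d × Rd d, ℂ) :=
  symbolTestFunction φ z.1.1 z.2.2.2 z.2.2.1 z.1.2.1 z.1.2.2 z.2.1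

theorem symbolAtom_eq_phaseShift (φ : 𝓢(Rd d, ℂ)) (z : SymbolPhase d) :
    symbolAtom φ z = phaseShift (symbolWindow φ) (symbolPhaseCLM d z.2) z.1 := by
  ext y
  rw [symbolAtom, symbolTestFunction_apply, phaseShift_apply, symbolPhaseCLM_apply, symbolWindow]
  simp

theorem continuous_symbolAtom (φ : 𝓢(Rd d, ℂ)) : Continuous (symbolAtom φ) := by
  have h := continuous_phaseShift (P := SymbolPhase d) (symbolWindow φ)
    ((symbolPhaseCLM d).comp (ContinuousLinearMap.snd ℝ _ _)) (ContinuousLinearMap.fst ℝ _ _)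
  refine h.congr fun z => (symbolAtom_eq_phaseShift φ z).symm

theorem exists_seminorm_symbolAtom_le (φ : 𝓢(Rd d, ℂ)) (k n : ℕ) : ∃ C : ℝ, 0 ≤ C ∧
    ∀ z : SymbolPhase d, SchwartzMap.seminorm ℂ k n (symbolAtom φ z) ≤ C * (1 + ‖z‖) ^ (n + k) := by
  obtain ⟨C, hC0, hC⟩ := exists_seminorm_phaseShift_le (symbolWindow φ) k n
  refine ⟨C * (1 + ‖symbolPhaseCLM d‖) ^ n, by positivity, fun z => ?_⟩
  rw [symbolAtom_eq_phaseShift]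
  refine (hC _ _).trans ?_
  have h1 : ‖z.1‖ ≤ ‖z‖ := norm_fst_le z
  have h2 : ‖z.2‖ ≤ ‖z‖ := norm_snd_le z
  have h3 : 1 + ‖symbolPhaseCLM d z.2‖ ≤ (1 + ‖symbolPhaseCLM d‖) * (1 + ‖z‖) := by
    have h4 := (symbolPhaseCLM d).le_opNorm z.2
    nlinarith [norm_nonneg (symbolPhaseCLM d), norm_nonneg z,
      mul_le_mul_of_nonneg_left h2 (norm_nonneg (symbolPhaseCLM d))]
  calc _ ≤ C * ((1 + ‖symbolPhaseCLM d‖) * (1 + ‖z‖)) ^ n * (1 + ‖z‖) ^ k := by gcongr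
    _ = _ := by rw [mul_pow, pow_add]; ring

/-- The symbol transform as a function on phase space. -/
def symbolTransform (φ : 𝓢(Rd d, ℂ)) (σ : 𝓢'(Rd d × Rd d × Rd d, ℂ)) (z : SymbolPhase d) : ℂ :=
  symbolSTFT φ σ z.1.1 z.2.2.2 z.2.2.1 z.1.2.1 z.1.2.2 z.2.1

theorem continuous_symbolTransform (φ : 𝓢(Rd d, ℂ)) (σ : 𝓢'(Rd d × Rd d × Rd d, ℂ)) :
    Continuous (symbolTransform φ σ) :=
  (ContinuousLinearMap.continuous σ).comp (continuous_symbolAtom φ)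

/-- The supremum over `x` of the symbol transform, as a function of `(ν, ξ₁, ξ₂, t₂, t₁)`. -/
def symbolSup (φ : 𝓢(Rd d, ℂ)) (σ : 𝓢'(Rd d × Rd d × Rd d, ℂ))
    (y : Rd d × Rd d × Rd d × Rd d × Rd d) : ℝ≥0∞ :=
  ⨆ x : Rd d, ‖symbolTransform φ σ ((x, y.2.1, y.2.2.1), (y.1, y.2.2.2))‖ₑ

theorem lowerSemicontinuous_symbolSup (φ : 𝓢(Rd d, ℂ)) (σ : 𝓢'(Rd d × Rd d × Rd d, ℂ)) :
    LowerSemicontinuous (symbolSup φ σ) :=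
  lowerSemicontinuous_iSup fun x => Continuous.lowerSemicontinuous
    ((continuous_symbolTransform φ σ).comp (f := fun y : Rd d × Rd d × Rd d × Rd d × Rd d =>
      (((x, y.2.1, y.2.2.1), (y.1, y.2.2.2)) : SymbolPhase d)) (by fun_prop)).enorm

/-- The integrand of the symbol norm, as a function of the outer variable `ν`. -/
def symbolProfile (φ : 𝓢(Rd d, ℂ)) (σ : 𝓢'(Rd d × Rd d × Rd d, ℂ)) (ν : Rd d) : ℝ≥0∞ :=
  ⨆ (ξ₁ : Rd d) (ξ₂ : Rd d), ∫⁻ t₂ : Rd d, ∫⁻ t₁ : Rd d, symbolSup φ σ (ν, ξ₁, ξ₂, t₂, t₁)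

theorem symbolNorm_eq_lintegral (φ : 𝓢(Rd d, ℂ)) (σ : 𝓢'(Rd d × Rd d × Rd d, ℂ)) :
    symbolNorm φ σ = ∫⁻ ν, symbolProfile φ σ ν := rfl

/-- Semicontinuity survives the suprema and, by Fatou, the integrals in t₁ and t₂. -/
theorem measurable_symbolProfile (φ : 𝓢(Rd d, ℂ)) (σ : 𝓢'(Rd d × Rd d × Rd d, ℂ)) :
    Measurable (symbolProfile φ σ) := by
  refine LowerSemicontinuous.measurable
    (lowerSemicontinuous_iSup fun ξ₁ => lowerSemicontinuous_iSup fun ξ₂ => ?_)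
  have h1 : LowerSemicontinuous fun z : (Rd d × Rd d) × Rd d =>
      symbolSup φ σ (z.1.1, ξ₁, ξ₂, z.1.2, z.2) :=
    (lowerSemicontinuous_symbolSup φ σ).comp
      (g := fun z : (Rd d × Rd d) × Rd d => (z.1.1, ξ₁, ξ₂, z.1.2, z.2)) (by fun_prop)
  exact lowerSemicontinuous_lintegral (F := fun z : Rd d × Rd d =>
    ∫⁻ t₁ : Rd d, symbolSup φ σ (z.1, ξ₁, ξ₂, z.2, t₁)) (lowerSemicontinuous_lintegral h1)

end SymbolTransform

/-! ### The reproducing formula for the Rihaczek function. -/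

section RihaczekInversion

set_option synthInstance.maxSize 5000

variable {d : ℕ}

/-- The modulated short-time Fourier transform `e^{2πi u·ξ} V f(u, ξ)` with the wide window. -/
def modulatedGabor (f : 𝓢'(Rd d, ℂ)) (z : Rd d × Rd d) : ℂ :=
  expTwoPiI (inner ℝ z.1 z.2) * gaborTransform (wideGaussian d) f z.1 z.2

@[fun_prop]
theorem continuous_modulatedGabor (f : 𝓢'(Rd d, ℂ)) : Continuous (modulatedGabor f) := by
  have h := continuous_gaborTransform (wideGaussian d) f
  unfold modulatedGabor
  fun_prop

theorem norm_modulatedGabor (f : 𝓢'(Rd d, ℂ)) (z : Rd d × Rd d) :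
    ‖modulatedGabor f z‖ = ‖gaborTransform (wideGaussian d) f z.1 z.2‖ := by
  rw [modulatedGabor, norm_mul, norm_expTwoPiI, one_mul]

/-- The density of the superposition of symbol test functions representing the Rihaczek
distribution of `f₁`, `f₂`, `g`; the parameters `τ`, `ν₀` shift the phase space. -/
def rihaczekKernel (τ ν₀ : Rd d) (f₁ f₂ : 𝓢'(Rd d, ℂ)) (g : 𝓢(Rd d, ℂ)) (z : SymbolPhase d) : ℂ :=
  expTwoPiI (inner ℝ z.1.1 ν₀ - inner ℝ (z.1.1 + τ) (z.1.2.1 + z.1.2.2)) *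
    gaborTransform (gaussianWindow (Rd d)) (g : 𝓢'(Rd d, ℂ)) z.1.1
      (-(z.2.1 + z.1.2.1 + z.1.2.2 - ν₀)) *
    (modulatedGabor f₁ (z.1.1 - z.2.2.2 + τ, z.1.2.1) *
      modulatedGabor f₂ (z.1.1 - z.2.2.1 + τ, z.1.2.2))

theorem continuous_rihaczekKernel (τ ν₀ : Rd d) (f₁ f₂ : 𝓢'(Rd d, ℂ)) (g : 𝓢(Rd d, ℂ)) :
    Continuous (rihaczekKernel τ ν₀ f₁ f₂ g) := by
  have h := (continuous_gaborTransform (gaussianWindow (Rd d)) (g : 𝓢'(Rd d, ℂ))).comp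
    (f := fun z : SymbolPhase d => (z.1.1, -(z.2.1 + z.1.2.1 + z.1.2.2 - ν₀))) (by fun_prop)
  have h1 := (continuous_modulatedGabor f₁).comp
    (f := fun z : SymbolPhase d => (z.1.1 - z.2.2.2 + τ, z.1.2.1)) (by fun_prop)
  have h2 := (continuous_modulatedGabor f₂).comp
    (f := fun z : SymbolPhase d => (z.1.1 - z.2.2.1 + τ, z.1.2.2)) (by fun_prop)
  have h0 : Continuous fun z : SymbolPhase d =>
      expTwoPiI (inner ℝ z.1.1 ν₀ - inner ℝ (z.1.1 + τ) (z.1.2.1 + z.1.2.2)) := by fun_prop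
  exact (h0.mul h).mul (h1.mul h2)

/-- The arguments of the three transforms in the density, together with τ and ν₀, determine every
phase space coordinate; hence decay of the factors gives decay of the density in all variables. -/
theorem one_add_norm_symbolPhase_le (τ ν₀ : Rd d) (z : SymbolPhase d) :
    1 + ‖z‖ ≤ (1 + ‖τ‖) * (1 + ‖ν₀‖) * ((1 + ‖z.1.1‖) *
      (1 + ‖-(z.2.1 + z.1.2.1 + z.1.2.2 - ν₀)‖)) * ((1 + ‖z.1.1 - z.2.2.2 + τ‖) * (1 + ‖z.1.2.1‖)) *
      ((1 + ‖z.1.1 - z.2.2.1 + τ‖) * (1 + ‖z.1.2.2‖)) := by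
  obtain ⟨⟨x, ξ₁, ξ₂⟩, ν, t₂, t₁⟩ := z
  simp only
  have hν : ‖ν‖ ≤ ‖-(ν + ξ₁ + ξ₂ - ν₀)‖ + ‖ξ₁‖ + ‖ξ₂‖ + ‖ν₀‖ := by
    rw [norm_neg]
    calc ‖ν‖ = ‖(ν + ξ₁ + ξ₂ - ν₀) - ξ₁ - ξ₂ + ν₀‖ := by congr 1; abel
      _ ≤ _ := by
        refine (norm_add_le _ _).trans (add_le_add_left ((norm_sub_le _ _).trans ?_) _)
        exact add_le_add_left (norm_sub_le _ _) _
  have ht : ∀ t : Rd d, ‖t‖ ≤ ‖x - t + τ‖ + ‖x‖ + ‖τ‖ := fun t => by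
    calc ‖t‖ = ‖x + τ - (x - t + τ)‖ := by congr 1; abel
      _ ≤ (‖x‖ + ‖τ‖) + ‖x - t + τ‖ := (norm_sub_le _ _).trans (by gcongr; exact norm_add_le _ _)
      _ = _ := by ring
  have hmul : ∀ {a b A B : ℝ}, 0 ≤ a → 0 ≤ b → 1 + a ≤ A → 1 + b ≤ B → 1 + (a + b) ≤ A * B := by
    intro a b A B ha hb hA hB
    nlinarith [mul_le_mul hA hB (by linarith) (by linarith), mul_nonneg ha hb]
  set w := ‖-(ν + ξ₁ + ξ₂ - ν₀)‖
  have hw : 0 ≤ w := norm_nonneg _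
  have h := hmul (by positivity) (by positivity) (hmul (by positivity) (by positivity)
    (hmul (by positivity) (by positivity) (hmul (norm_nonneg τ) (norm_nonneg ν₀) le_rfl le_rfl)
      (hmul (norm_nonneg x) hw le_rfl le_rfl))
    (hmul (norm_nonneg (x - t₁ + τ)) (norm_nonneg ξ₁) le_rfl le_rfl))
    (hmul (norm_nonneg (x - t₂ + τ)) (norm_nonneg ξ₂) le_rfl le_rfl)
  refine le_trans ?_ h
  have h1 := ht t₁
  have h2 := ht t₂
  have n1 := norm_nonneg x
  have n2 := norm_nonneg ξ₁
  have n3 := norm_nonneg ξ₂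
  have n4 := norm_nonneg τ
  have n5 := norm_nonneg ν₀
  have n6 := norm_nonneg (x - t₁ + τ)
  have n7 := norm_nonneg (x - t₂ + τ)
  simp only [Prod.norm_def]
  gcongr
  refine max_le (max_le ?_ (max_le ?_ ?_)) (max_le ?_ (max_le ?_ ?_)) <;> linarith

theorem exists_norm_rihaczekKernel_le (τ ν₀ : Rd d) (f₁ f₂ g : 𝓢(Rd d, ℂ)) (N : ℕ) :
    ∃ C : ℝ, ∀ z : SymbolPhase d,
      (1 + ‖z‖) ^ N * ‖rihaczekKernel τ ν₀ (f₁ : 𝓢'(Rd d, ℂ)) (f₂ : 𝓢'(Rd d, ℂ)) g z‖ ≤ C := by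
  obtain ⟨q, -, hq⟩ := exists_seminorm_gaborTransform_le (gaussianWindow (Rd d)) N
  obtain ⟨q', -, hq'⟩ := exists_seminorm_gaborTransform_le (wideGaussian d) N
  refine ⟨((1 + ‖τ‖) * (1 + ‖ν₀‖)) ^ N * (q g * q' f₁ * q' f₂), fun z => ?_⟩
  rw [rihaczekKernel, norm_mul, norm_mul, norm_mul, norm_expTwoPiI, one_mul,
    norm_modulatedGabor, norm_modulatedGabor]
  have h0 := hq g z.1.1 (-(z.2.1 + z.1.2.1 + z.1.2.2 - ν₀))
  have h1 := hq' f₁ (z.1.1 - z.2.2.2 + τ) z.1.2.1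
  have h2 := hq' f₂ (z.1.1 - z.2.2.1 + τ) z.1.2.2
  rw [← mul_pow] at h0 h1 h2
  have hz := pow_le_pow_left₀ (by positivity) (one_add_norm_symbolPhase_le τ ν₀ z) N
  rw [mul_pow, mul_pow, mul_pow] at hz
  refine (mul_le_mul_of_nonneg_right hz (by positivity)).trans ?_
  rw [show ∀ a b c e A B D : ℝ, a * b * c * e * (A * (B * D)) =
    a * (((b * A) * (c * B)) * (e * D)) from fun _ _ _ _ _ _ _ => by ring]
  have := apply_nonneg q g
  have := apply_nonneg q' f₁
  have := apply_nonneg q' f₂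
  gcongr

theorem integrable_one_add_norm_pow_symbolPhase (d : ℕ) : ∃ r : ℕ,
    Integrable fun z : SymbolPhase d => ((1 + ‖z‖) ^ r)⁻¹ := by
  have i1 : (volume : Measure (Rd d × Rd d)).IsAddHaarMeasure := by
    rw [Measure.volume_eq_prod]; infer_instance
  have i2 : (volume : Measure (Rd d × Rd d × Rd d)).IsAddHaarMeasure := by
    rw [Measure.volume_eq_prod]; infer_instance
  have i3 : (volume : Measure (SymbolPhase d)).IsAddHaarMeasure := by
    rw [Measure.volume_eq_prod]; infer_instance
  have h := integrable_one_add_norm (E := SymbolPhase d) (μ := volume)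
    (r := (Module.finrank ℝ (SymbolPhase d) + 1 : ℕ)) (by push_cast; linarith)
  refine ⟨Module.finrank ℝ (SymbolPhase d) + 1, h.congr (Eventually.of_forall fun z => ?_)⟩
  simp only
  rw [Real.rpow_neg (by positivity), Real.rpow_natCast]

theorem integrable_norm_rihaczekKernel_mul (τ ν₀ : Rd d) (f₁ f₂ g : 𝓢(Rd d, ℂ)) (k : ℕ) :
    Integrable fun z : SymbolPhase d =>
      ‖rihaczekKernel τ ν₀ (f₁ : 𝓢'(Rd d, ℂ)) (f₂ : 𝓢'(Rd d, ℂ)) g z‖ * (1 + ‖z‖) ^ k := by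
  obtain ⟨r, hr⟩ := integrable_one_add_norm_pow_symbolPhase d
  obtain ⟨C, hC⟩ := exists_norm_rihaczekKernel_le τ ν₀ f₁ f₂ g (k + r)
  have hc := continuous_rihaczekKernel τ ν₀ (f₁ : 𝓢'(Rd d, ℂ)) (f₂ : 𝓢'(Rd d, ℂ)) g
  refine (hr.const_mul C).mono' (Continuous.aestronglyMeasurable (by fun_prop))
    (Eventually.of_forall fun z => ?_)
  have h := hC z
  rw [pow_add] at h
  rw [Real.norm_of_nonneg (by positivity), ← div_eq_mul_inv, le_div_iff₀ (by positivity)]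
  linarith

theorem continuous_rihaczekKernel_smul_symbolAtom (φ : 𝓢(Rd d, ℂ)) (τ ν₀ : Rd d)
    (f₁ f₂ g : 𝓢(Rd d, ℂ)) : Continuous fun z : SymbolPhase d =>
      rihaczekKernel τ ν₀ (f₁ : 𝓢'(Rd d, ℂ)) (f₂ : 𝓢'(Rd d, ℂ)) g z • symbolAtom φ z :=
  (continuous_rihaczekKernel τ ν₀ _ _ g).smul (continuous_symbolAtom φ)

theorem integrable_seminorm_rihaczekKernel_smul_symbolAtom (φ : 𝓢(Rd d, ℂ)) (τ ν₀ : Rd d)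
    (f₁ f₂ g : 𝓢(Rd d, ℂ)) (k n : ℕ) : Integrable fun z : SymbolPhase d =>
      SchwartzMap.seminorm ℂ k n
        (rihaczekKernel τ ν₀ (f₁ : 𝓢'(Rd d, ℂ)) (f₂ : 𝓢'(Rd d, ℂ)) g z • symbolAtom φ z) := by
  obtain ⟨C, hC0, hC⟩ := exists_seminorm_symbolAtom_le φ k n
  refine ((integrable_norm_rihaczekKernel_mul τ ν₀ f₁ f₂ g (n + k)).const_mul C).mono'
    (Continuous.aestronglyMeasurable (((schwartz_withSeminorms ℂ _ ℂ).continuous_seminorm (k, n)).comp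
      (continuous_rihaczekKernel_smul_symbolAtom φ τ ν₀ f₁ f₂ g)))
    (Eventually.of_forall fun z => ?_)
  rw [Real.norm_of_nonneg (apply_nonneg _ _), map_smul_eq_mul]
  refine (mul_le_mul_of_nonneg_left (hC z) (norm_nonneg _)).trans_eq (by ring)

/-- The integrable function whose total mass is the constant in the inversion formula for the
Rihaczek distribution. -/
def inversionDensity (φ : 𝓢(Rd d, ℂ)) (τ ν₀ : Rd d) (w : Rd d × Rd d × Rd d) : ℂ :=
  expTwoPiI (inner ℝ w.1 ν₀ - inner ℝ (w.1 + τ) (w.2.1 + w.2.2)) *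
    ((φ w.1 * gaussianWindow (Rd d) (-w.1)) *
      ((φ w.2.1 * 𝓕 (wideGaussian d) (-w.2.1)) * (φ w.2.2 * 𝓕 (wideGaussian d) (-w.2.2))))

theorem integral_expTwoPiI_mul_modulatedGabor (f : 𝓢(Rd d, ℂ)) (a ξ η : Rd d) :
    ∫ t, expTwoPiI (inner ℝ t η) * modulatedGabor (f : 𝓢'(Rd d, ℂ)) (a - t, ξ) =
      expTwoPiI (inner ℝ a η) * (𝓕 f η * 𝓕 (wideGaussian d) (η - ξ)) := by
  rw [← integral_expTwoPiI_mul_gaborTransform_left wideGaussian_neg, ← integral_const_mul,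
    ← integral_sub_left_eq_self _ volume a]
  refine integral_congr_ae (Eventually.of_forall fun t => ?_)
  simp only [modulatedGabor, sub_sub_cancel]
  rw [← mul_assoc (expTwoPiI (inner ℝ a η)), ← expTwoPiI_add, inner_sub_left, sub_eq_add_neg]

theorem integral_expTwoPiI_mul_gaborTransform_sub (χ g : 𝓢(Rd d, ℂ)) (x y b : Rd d) :
    ∫ ν, expTwoPiI (-inner ℝ ν y) * gaborTransform χ (g : 𝓢'(Rd d, ℂ)) x (b - ν) =
      expTwoPiI (-inner ℝ b y) * (g y * χ (y - x)) := by
  rw [← integral_expTwoPiI_mul_gaborTransform, ← integral_const_mul,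
    ← integral_sub_left_eq_self _ volume b]
  refine integral_congr_ae (Eventually.of_forall fun t => ?_)
  simp only [sub_sub_cancel]
  rw [← mul_assoc, ← expTwoPiI_add]
  congr 2
  rw [inner_sub_left]
  ring

theorem integral_prod_prod_mul {X Y Z : Type*} [MeasureSpace X] [MeasureSpace Y] [MeasureSpace Z]
    [SigmaFinite (volume : Measure X)] [SigmaFinite (volume : Measure Y)]
    [SigmaFinite (volume : Measure Z)] (f : X → ℂ) (g : Y → ℂ) (h : Z → ℂ) :
    ∫ v : X × Y × Z, f v.1 * (g v.2.1 * h v.2.2) = (∫ x, f x) * ((∫ y, g y) * ∫ z, h z) := by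
  rw [Measure.volume_eq_prod, integral_prod_mul f (fun v : Y × Z => g v.1 * h v.2),
    Measure.volume_eq_prod, integral_prod_mul]

/-- For fixed (x, ξ₁, ξ₂) the integral splits into one in ν, which recovers g(y₀) γ(y₀ - x), and two
in t_j, which give f̂_j(y_j) times the transformed wide window at y_j - ξ_j. The phases recombine so
that, apart from R(y), only w - y remains. -/
theorem integral_rihaczekKernel_mul_symbolAtom_snd (φ : 𝓢(Rd d, ℂ)) (τ ν₀ : Rd d)
    (f₁ f₂ g : 𝓢(Rd d, ℂ)) (y w : Rd d × Rd d × Rd d) :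
    ∫ v : Rd d × Rd d × Rd d, rihaczekKernel τ ν₀ (f₁ : 𝓢'(Rd d, ℂ)) (f₂ : 𝓢'(Rd d, ℂ)) g (w, v) *
      symbolAtom φ (w, v) y = inversionDensity φ τ ν₀ (w - y) * rihaczekCLM f₁ f₂ g y := by
  obtain ⟨x, ξ₁, ξ₂⟩ := w
  obtain ⟨y₀, y₁, y₂⟩ := y
  have h1 : ∀ v : Rd d × Rd d × Rd d,
      rihaczekKernel τ ν₀ (f₁ : 𝓢'(Rd d, ℂ)) (f₂ : 𝓢'(Rd d, ℂ)) g ((x, ξ₁, ξ₂), v) *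
        symbolAtom φ ((x, ξ₁, ξ₂), v) (y₀, y₁, y₂) =
      (expTwoPiI (inner ℝ x ν₀ - inner ℝ (x + τ) (ξ₁ + ξ₂)) *
        (φ (x - y₀) * (φ (ξ₁ - y₁) * φ (ξ₂ - y₂)))) *
      ((expTwoPiI (-inner ℝ v.1 y₀) * gaborTransform (gaussianWindow (Rd d)) (g : 𝓢'(Rd d, ℂ)) x
          ((ν₀ - ξ₁ - ξ₂) - v.1)) *
        ((expTwoPiI (inner ℝ v.2.1 y₂) * modulatedGabor (f₂ : 𝓢'(Rd d, ℂ)) ((x + τ) - v.2.1, ξ₂)) *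
         (expTwoPiI (inner ℝ v.2.2 y₁) *
            modulatedGabor (f₁ : 𝓢'(Rd d, ℂ)) ((x + τ) - v.2.2, ξ₁)))) := by
    rintro ⟨ν, t₂, t₁⟩
    rw [rihaczekKernel, symbolAtom, symbolTestFunction_apply]
    simp only
    rw [show -(inner ℝ ν y₀ - inner ℝ t₁ y₁ - inner ℝ t₂ y₂) =
      -inner ℝ ν y₀ + inner ℝ t₂ y₂ + inner ℝ t₁ y₁ by ring, expTwoPiI_add, expTwoPiI_add,
      show -(ν + ξ₁ + ξ₂ - ν₀) = ν₀ - ξ₁ - ξ₂ - ν by abel,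
      show x - t₁ + τ = x + τ - t₁ by abel, show x - t₂ + τ = x + τ - t₂ by abel]
    ring
  simp_rw [h1]
  rw [integral_const_mul, integral_prod_prod_mul (fun ν => expTwoPiI (-inner ℝ ν y₀) *
      gaborTransform (gaussianWindow (Rd d)) (g : 𝓢'(Rd d, ℂ)) x (ν₀ - ξ₁ - ξ₂ - ν))
    (fun t => expTwoPiI (inner ℝ t y₂) * modulatedGabor (f₂ : 𝓢'(Rd d, ℂ)) (x + τ - t, ξ₂))
    (fun t => expTwoPiI (inner ℝ t y₁) * modulatedGabor (f₁ : 𝓢'(Rd d, ℂ)) (x + τ - t, ξ₁)),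
    integral_expTwoPiI_mul_modulatedGabor,
    integral_expTwoPiI_mul_modulatedGabor, integral_expTwoPiI_mul_gaborTransform_sub,
    rihaczekCLM_apply, inversionDensity]
  simp only [Prod.fst_sub, Prod.snd_sub, neg_sub]
  -- The phase identity that fixes the form of the unimodular factor in `rihaczekKernel`.
  have h2 : expTwoPiI (inner ℝ x ν₀ - inner ℝ (x + τ) (ξ₁ + ξ₂)) *
      (expTwoPiI (-inner ℝ (ν₀ - ξ₁ - ξ₂) y₀) * (expTwoPiI (inner ℝ (x + τ) y₂) *
        expTwoPiI (inner ℝ (x + τ) y₁))) =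
      expTwoPiI (inner ℝ (x - y₀) ν₀ - inner ℝ (x - y₀ + τ) (ξ₁ - y₁ + (ξ₂ - y₂))) *
        expTwoPiI (inner ℝ y₀ (y₁ + y₂)) := by
    simp only [← expTwoPiI_add]
    congr 1
    simp only [inner_add_left, inner_add_right, inner_sub_left, inner_sub_right]
    rw [real_inner_comm y₀ ν₀, real_inner_comm y₀ ξ₁, real_inner_comm y₀ ξ₂]
    ring
  linear_combination (φ (x - y₀) * (φ (ξ₁ - y₁) * φ (ξ₂ - y₂)) * (g y₀ *
    gaussianWindow (Rd d) (y₀ - x)) * (𝓕 f₂ y₂ * 𝓕 (wideGaussian d) (y₂ - ξ₂)) *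
    (𝓕 f₁ y₁ * 𝓕 (wideGaussian d) (y₁ - ξ₁))) * h2

theorem integral_rihaczekKernel_mul_symbolAtom (φ : 𝓢(Rd d, ℂ)) (τ ν₀ : Rd d)
    (f₁ f₂ g : 𝓢(Rd d, ℂ)) (y : Rd d × Rd d × Rd d) :
    ∫ z, rihaczekKernel τ ν₀ (f₁ : 𝓢'(Rd d, ℂ)) (f₂ : 𝓢'(Rd d, ℂ)) g z * symbolAtom φ z y =
      (∫ w, inversionDensity φ τ ν₀ w) * rihaczekCLM f₁ f₂ g y := by
  have hc := continuous_rihaczekKernel τ ν₀ (f₁ : 𝓢'(Rd d, ℂ)) (f₂ : 𝓢'(Rd d, ℂ)) g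
  have hint : Integrable (fun z : SymbolPhase d =>
      rihaczekKernel τ ν₀ (f₁ : 𝓢'(Rd d, ℂ)) (f₂ : 𝓢'(Rd d, ℂ)) g z * symbolAtom φ z y) := by
    refine (integrable_seminorm_rihaczekKernel_smul_symbolAtom φ τ ν₀ f₁ f₂ g 0 0).mono'
      (Continuous.aestronglyMeasurable ?_) (Eventually.of_forall fun z => ?_)
    · simp_rw [symbolAtom, symbolTestFunction_apply]
      fun_prop
    · exact SchwartzMap.norm_le_seminorm ℂ
        (rihaczekKernel τ ν₀ (f₁ : 𝓢'(Rd d, ℂ)) (f₂ : 𝓢'(Rd d, ℂ)) g z • symbolAtom φ z) y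
  rw [Measure.volume_eq_prod] at hint ⊢
  rw [integral_prod _ hint]
  simp_rw [integral_rihaczekKernel_mul_symbolAtom_snd]
  rw [integral_mul_const]
  have i2 : (volume : Measure (Rd d × Rd d)).IsAddHaarMeasure := by
    rw [Measure.volume_eq_prod]; infer_instance
  have i3 : (volume : Measure (Rd d × Rd d × Rd d)).IsAddHaarMeasure := by
    rw [Measure.volume_eq_prod]; infer_instance
  rw [integral_sub_right_eq_self]

theorem apply_rihaczekCLM_eq_integral (φ : 𝓢(Rd d, ℂ)) (τ ν₀ : Rd d)
    (σ : 𝓢'(Rd d × Rd d × Rd d, ℂ)) (f₁ f₂ g : 𝓢(Rd d, ℂ)) :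
    (∫ w, inversionDensity φ τ ν₀ w) * σ (rihaczekCLM f₁ f₂ g) =
      ∫ z, rihaczekKernel τ ν₀ (f₁ : 𝓢'(Rd d, ℂ)) (f₂ : 𝓢'(Rd d, ℂ)) g z *
        symbolTransform φ σ z := by
  set L : 𝓢(Rd d × Rd d × Rd d, ℂ) →L[ℂ] ℂ := ⟨σ.toLinearMap, ContinuousLinearMap.continuous σ⟩
  have h := SchwartzMap.clm_apply_eq_integral
    (continuous_rihaczekKernel_smul_symbolAtom φ τ ν₀ f₁ f₂ g)
    (integrable_seminorm_rihaczekKernel_smul_symbolAtom φ τ ν₀ f₁ f₂ g)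
    (G := (∫ w, inversionDensity φ τ ν₀ w) • rihaczekCLM f₁ f₂ g)
    (fun y => (integral_rihaczekKernel_mul_symbolAtom φ τ ν₀ f₁ f₂ g y).symm) L
  simp only [map_smul, smul_eq_mul] at h
  exact h

theorem exists_schwartz_mul (f g : 𝓢(Rd d, ℂ)) : ∃ h : 𝓢(Rd d, ℂ), ∀ y, h y = f y * g y :=
  ⟨SchwartzMap.smulLeftCLM ℂ f g, fun y => by
    rw [SchwartzMap.smulLeftCLM_apply_apply f.hasTemperateGrowth, smul_eq_mul]⟩

theorem SchwartzMap.exists_fourierInv_ne_zero {h : 𝓢(Rd d, ℂ)} (hh : h ≠ 0) :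
    ∃ w, 𝓕⁻ h w ≠ 0 := by
  by_contra! hc
  refine hh ?_
  have : 𝓕⁻ h = 0 := by ext w; exact hc w
  rw [← FourierTransform.fourier_fourierInv_eq (F := 𝓢(Rd d, ℂ)) h, this]
  exact map_zero (SchwartzMap.fourierTransformCLM ℂ)

/-- Integrating out the last two variables shows that the constant is the inverse Fourier transform
at ν₀ of l(a) = φ(a) γ(-a) ĥ(a + τ)², where h(a) = φ(a) Γ̂(-a) and Γ is the wide Gaussian. Neither
Gaussian factor vanishes, so τ can be chosen to make l nonzero at a point, and then ν₀ exists by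
injectivity of the Fourier transform. -/
theorem exists_integral_inversionDensity_ne_zero {φ : 𝓢(Rd d, ℂ)} (hφ : φ ≠ 0) :
    ∃ τ ν₀ : Rd d, ∫ w, inversionDensity φ τ ν₀ w ≠ 0 := by
  obtain ⟨a₀, ha₀⟩ : ∃ a, φ a ≠ 0 := by
    by_contra! hc
    exact hφ (by ext a; exact hc a)
  obtain ⟨h, hh⟩ := exists_schwartz_mul φ (reflTranslate 0 (𝓕 (wideGaussian d)))
  obtain ⟨m, hm⟩ := exists_schwartz_mul φ (reflTranslate 0 (gaussianWindow (Rd d)))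
  simp only [reflTranslate_apply, zero_sub] at hh hm
  have hh0 : h ≠ 0 := fun h0 => by
    have h1 := hh a₀
    rw [h0] at h1
    exact mul_ne_zero ha₀ (fourier_wideGaussian_ne_zero _) h1.symm
  obtain ⟨w, hw⟩ := SchwartzMap.exists_fourierInv_ne_zero hh0
  -- The shift moves a point where ĥ ≠ 0 onto a₀, where φ ≠ 0.
  obtain ⟨τ, hτ⟩ : ∃ τ : Rd d, 𝓕 h (a₀ + τ) ≠ 0 := by
    refine ⟨-w - a₀, ?_⟩
    rw [add_sub_cancel, SchwartzMap.fourier_coe, ← Real.fourierInv_eq_fourier_neg,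
      ← SchwartzMap.fourierInv_coe]
    exact hw
  obtain ⟨k, hk⟩ := exists_schwartz_mul (SchwartzMap.compSubConstCLM ℂ (-τ) (𝓕 h))
    (SchwartzMap.compSubConstCLM ℂ (-τ) (𝓕 h))
  obtain ⟨l, hl⟩ := exists_schwartz_mul m k
  simp only [SchwartzMap.compSubConstCLM_apply, sub_neg_eq_add] at hk
  have hl0 : l ≠ 0 := fun h0 => by
    have h1 := hl a₀
    rw [h0, hm, hk] at h1
    exact mul_ne_zero (mul_ne_zero ha₀ (gaussianWindow_ne_zero _)) (mul_ne_zero hτ hτ) h1.symm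
  obtain ⟨ν₀, hν₀⟩ := SchwartzMap.exists_fourierInv_ne_zero hl0
  refine ⟨τ, ν₀, ?_⟩
  convert hν₀ using 1
  rw [SchwartzMap.fourierInv_coe, fourierInv_eq_integral_expTwoPiI]
  have hint : Integrable (inversionDensity φ τ ν₀) := by
    have h1 : Integrable fun w : Rd d × Rd d × Rd d => m w.1 * (h w.2.1 * h w.2.2) := by
      rw [Measure.volume_eq_prod]
      refine Integrable.mul_prod (f := m) (g := fun v : Rd d × Rd d => h v.1 * h v.2)
        m.integrable ?_
      rw [Measure.volume_eq_prod]
      exact Integrable.mul_prod h.integrable h.integrable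
    have h2 : inversionDensity φ τ ν₀ = fun w => expTwoPiI (inner ℝ w.1 ν₀ -
        inner ℝ (w.1 + τ) (w.2.1 + w.2.2)) * (m w.1 * (h w.2.1 * h w.2.2)) := by
      funext w
      rw [inversionDensity, hm, hh, hh]
    rw [h2]
    refine h1.mono (Continuous.aestronglyMeasurable (by fun_prop))
      (Eventually.of_forall fun w => ?_)
    rw [norm_mul, norm_expTwoPiI, one_mul]
  rw [Measure.volume_eq_prod] at hint ⊢
  rw [integral_prod _ hint]
  refine integral_congr_ae (Eventually.of_forall fun a => ?_)
  simp only [hl, hk]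
  rw [SchwartzMap.fourier_coe, fourier_eq_integral_expTwoPiI]
  have h3 : ∀ v : Rd d × Rd d, inversionDensity φ τ ν₀ (a, v) =
      (expTwoPiI (inner ℝ a ν₀) * m a) * ((expTwoPiI (-inner ℝ v.1 (a + τ)) * h v.1) *
        (expTwoPiI (-inner ℝ v.2 (a + τ)) * h v.2)) := by
    intro v
    have h4 : expTwoPiI (inner ℝ a ν₀ - inner ℝ (a + τ) (v.1 + v.2)) = expTwoPiI (inner ℝ a ν₀) *
        (expTwoPiI (-inner ℝ v.1 (a + τ)) * expTwoPiI (-inner ℝ v.2 (a + τ))) := by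
      rw [← expTwoPiI_add, ← expTwoPiI_add]
      congr 1
      rw [inner_add_right, real_inner_comm v.1, real_inner_comm v.2]
      ring
    rw [inversionDensity, hm, hh, hh, h4]
    ring
  simp_rw [h3]
  rw [integral_const_mul, Measure.volume_eq_prod, integral_prod_mul
    (fun v => expTwoPiI (-inner ℝ v (a + τ)) * h v) (fun v => expTwoPiI (-inner ℝ v (a + τ)) * h v)]
  ring

end RihaczekInversion

/-! ### The majorant and the integral defining the extension. -/

section Extension

set_option synthInstance.maxSize 5000

variable {d : ℕ}

/-- The majorant of the short-time Fourier transform of the bilinear operator. -/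
def symbolMajorant (φ : 𝓢(Rd d, ℂ)) (τ ν₀ : Rd d) (σ : 𝓢'(Rd d × Rd d × Rd d, ℂ))
    (f₁ f₂ : 𝓢'(Rd d, ℂ)) (s μ : Rd d) : ℝ≥0∞ :=
  ∫⁻ z : SymbolPhase d, ‖symbolTransform φ σ z‖ₑ *
    (decayKernel (s - z.1.1) * decayKernel (μ - (z.2.1 + z.1.2.1 + z.1.2.2 - ν₀))) *
      (‖modulatedGabor f₁ (z.1.1 - z.2.2.2 + τ, z.1.2.1)‖ₑ *
        ‖modulatedGabor f₂ (z.1.1 - z.2.2.1 + τ, z.1.2.2)‖ₑ)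

theorem exists_eLpNorm_symbolMajorant_le {p₀ p₁ p₂ q₁ q₂ q₃ : ℝ≥0∞}
    (hp₀ : 1 ≤ p₀) (hp₁ : 1 ≤ p₁) (hp₂ : 1 ≤ p₂) (hq₁ : 1 ≤ q₁) (hq₂ : 1 ≤ q₂) (hq₃ : 1 ≤ q₃)
    (hp : p₀⁻¹ ≤ p₁⁻¹ + p₂⁻¹) (hq : 1 + q₃⁻¹ ≤ q₁⁻¹ + q₂⁻¹) (φ : 𝓢(Rd d, ℂ)) (τ ν₀ : Rd d) :
    ∃ C : ℝ≥0, ∀ (σ : 𝓢'(Rd d × Rd d × Rd d, ℂ)) (f₁ f₂ : 𝓢'(Rd d, ℂ)),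
      eLpNorm (fun μ => eLpNorm (fun s => symbolMajorant φ τ ν₀ σ f₁ f₂ s μ) p₀ volume) q₃ volume ≤
        C * symbolNorm φ σ * modulationNorm p₁ q₁ f₁ * modulationNorm p₂ q₂ f₂ := by
  -- Hölder exponents with 1/r₁ + 1/r₂ = 1/p₀ exactly and r_i ≥ p_i: as much as possible of 1/p₀ is
  -- taken from 1/p₁, and the hypothesis on the p's covers the rest.
  set r₁ : ℝ≥0∞ := (min p₁⁻¹ p₀⁻¹)⁻¹ with hr₁
  set r₂ : ℝ≥0∞ := (p₀⁻¹ - min p₁⁻¹ p₀⁻¹)⁻¹ with hr₂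
  have hr : r₁⁻¹ + r₂⁻¹ = p₀⁻¹ := by
    rw [hr₁, hr₂, inv_inv, inv_inv, add_tsub_cancel_of_le (min_le_right _ _)]
  have h1 : r₁⁻¹ ≤ p₁⁻¹ := by rw [hr₁, inv_inv]; exact min_le_left _ _
  have h2 : r₂⁻¹ ≤ p₂⁻¹ := by
    rw [hr₂, inv_inv, tsub_le_iff_left]
    rcases min_cases p₁⁻¹ p₀⁻¹ with h | h <;> rw [h.1]
    · exact hp
    · exact le_self_add
  obtain ⟨C, hC⟩ := exists_eLpNorm_symbolPhase_le (measurable_decayKernel (d := d))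
    eLpNorm_decayKernel_lt_top hp₀ hr hq₁ hq₂ hq₃ hq
  obtain ⟨C₁, hC₁⟩ := exists_eLpNorm_gaborTransform_wideGaussian_le d hp₁ h1
  obtain ⟨C₂, hC₂⟩ := exists_eLpNorm_gaborTransform_wideGaussian_le d hp₂ h2
  refine ⟨C * C₁ * C₂, fun σ f₁ f₂ => ?_⟩
  have hnorm : ∀ (f : 𝓢'(Rd d, ℂ)) (z : Rd d × Rd d),
      ‖modulatedGabor f z‖ₑ = ‖gaborTransform (wideGaussian d) f z.1 z.2‖ₑ := fun f z => by
    rw [← ofReal_norm, norm_modulatedGabor, ofReal_norm]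
  have h := hC (fun z => ‖symbolTransform φ σ z‖ₑ) (symbolSup φ σ) (symbolProfile φ σ)
    (fun ξ => C₁ * eLpNorm (fun t => stft f₁ t ξ) p₁ volume)
    (fun ξ => C₂ * eLpNorm (fun t => stft f₂ t ξ) p₂ volume)
    (fun z => ‖modulatedGabor f₁ z‖ₑ) (fun z => ‖modulatedGabor f₂ z‖ₑ) τ ν₀
    (continuous_symbolTransform φ σ).enorm.measurable
    (lowerSemicontinuous_symbolSup φ σ).measurable (measurable_symbolProfile φ σ)
    ((measurable_eLpNorm_stft f₁ p₁).const_mul _) ((measurable_eLpNorm_stft f₂ p₂).const_mul _)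
    (continuous_modulatedGabor f₁).enorm.measurable
    (continuous_modulatedGabor f₂).enorm.measurable
    (fun z => le_iSup (fun x => ‖symbolTransform φ σ ((x, z.1.2.1, z.1.2.2), z.2)‖ₑ) z.1.1)
    (fun ν ξ₁ ξ₂ => le_iSup₂ (f := fun ξ₁ ξ₂ => ∫⁻ t₂ : Rd d, ∫⁻ t₁ : Rd d,
      symbolSup φ σ (ν, ξ₁, ξ₂, t₂, t₁)) ξ₁ ξ₂)
    (fun ξ => by simpa only [hnorm] using hC₁ f₁ ξ) (fun ξ => by simpa only [hnorm] using hC₂ f₂ ξ)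
  refine h.trans ?_
  have hmul : ∀ (c : ℝ≥0) (f : 𝓢'(Rd d, ℂ)) (p q : ℝ≥0∞),
      eLpNorm (fun ξ => c * eLpNorm (fun t => stft f t ξ) p volume) q volume ≤
        c * modulationNorm p q f := fun c f p q =>
    eLpNorm_le_nnreal_smul_eLpNorm_of_ae_le_mul' (Eventually.of_forall fun ξ => by simp) q
  rw [← symbolNorm_eq_lintegral]
  calc _ ≤ C * symbolNorm φ σ * (C₁ * modulationNorm p₁ q₁ f₁) * (C₂ * modulationNorm p₂ q₂ f₂) := by
        gcongr
        · exact hmul C₁ f₁ p₁ q₁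
        · exact hmul C₂ f₂ p₂ q₂
    _ = _ := by push_cast; ring

theorem enorm_rihaczekKernel (τ ν₀ : Rd d) (f₁ f₂ : 𝓢'(Rd d, ℂ)) (g : 𝓢(Rd d, ℂ))
    (z : SymbolPhase d) : ‖rihaczekKernel τ ν₀ f₁ f₂ g z‖ₑ =
      ‖gaborTransform (gaussianWindow (Rd d)) (g : 𝓢'(Rd d, ℂ)) z.1.1
        (-(z.2.1 + z.1.2.1 + z.1.2.2 - ν₀))‖ₑ *
      (‖modulatedGabor f₁ (z.1.1 - z.2.2.2 + τ, z.1.2.1)‖ₑ *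
        ‖modulatedGabor f₂ (z.1.1 - z.2.2.1 + τ, z.1.2.2)‖ₑ) := by
  rw [rihaczekKernel, enorm_mul, enorm_mul, enorm_mul, ← ofReal_norm (expTwoPiI _),
    norm_expTwoPiI, ENNReal.ofReal_one, one_mul]

theorem lintegral_enorm_rihaczekKernel_mul_le (φ : 𝓢(Rd d, ℂ)) (τ ν₀ : Rd d)
    (σ : 𝓢'(Rd d × Rd d × Rd d, ℂ)) (f₁ f₂ : 𝓢'(Rd d, ℂ)) (g : 𝓢(Rd d, ℂ)) (s μ : Rd d)
    {c : ℝ≥0∞} (hc : ∀ x ν, ‖gaborTransform (gaussianWindow (Rd d)) (g : 𝓢'(Rd d, ℂ)) x (-ν)‖ₑ ≤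
      c * (decayKernel (s - x) * decayKernel (μ - ν))) :
    ∫⁻ z, ‖rihaczekKernel τ ν₀ f₁ f₂ g z * symbolTransform φ σ z‖ₑ ≤
      c * symbolMajorant φ τ ν₀ σ f₁ f₂ s μ := by
  have hm1 := (continuous_symbolTransform φ σ).enorm.measurable
  have hm2 := (continuous_modulatedGabor f₁).enorm.measurable
  have hm3 := (continuous_modulatedGabor f₂).enorm.measurable
  rw [symbolMajorant, ← lintegral_const_mul _ (by fun_prop)]
  refine lintegral_mono fun z => ?_
  rw [enorm_mul, enorm_rihaczekKernel]
  calc _ ≤ c * (decayKernel (s - z.1.1) * decayKernel (μ - (z.2.1 + z.1.2.1 + z.1.2.2 - ν₀))) *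
      (‖modulatedGabor f₁ (z.1.1 - z.2.2.2 + τ, z.1.2.1)‖ₑ *
        ‖modulatedGabor f₂ (z.1.1 - z.2.2.1 + τ, z.1.2.2)‖ₑ) * ‖symbolTransform φ σ z‖ₑ := by
        gcongr
        exact hc _ _
    _ = _ := by ring

/-- Two uses of one decay estimate. For general g the kernel is recentred at (s, μ) at polynomial
cost, which gives continuity in g; for the shifted Gaussian covariance centres it there for free,
which gives a bound uniform in (s, μ). -/
theorem exists_lintegral_enorm_rihaczekKernel_mul_le (d : ℕ) :
    ∃ q : Seminorm ℂ 𝓢(Rd d, ℂ), Continuous q ∧ ∀ (φ : 𝓢(Rd d, ℂ)) (τ ν₀ : Rd d)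
      (σ : 𝓢'(Rd d × Rd d × Rd d, ℂ)) (f₁ f₂ : 𝓢'(Rd d, ℂ)) (s μ : Rd d),
      (∀ g, ∫⁻ z, ‖rihaczekKernel τ ν₀ f₁ f₂ g z * symbolTransform φ σ z‖ₑ ≤
        ENNReal.ofReal (q g) * (‖(1 + ‖s‖) ^ (d + 1)‖ₑ * ‖(1 + ‖μ‖) ^ (d + 1)‖ₑ) *
          symbolMajorant φ τ ν₀ σ f₁ f₂ s μ) ∧
      ∫⁻ z, ‖rihaczekKernel τ ν₀ f₁ f₂ (timeFreqShift (gaussianWindow (Rd d)) s μ) z *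
          symbolTransform φ σ z‖ₑ ≤
        ENNReal.ofReal (q (gaussianWindow (Rd d))) * symbolMajorant φ τ ν₀ σ f₁ f₂ s μ := by
  obtain ⟨q, hq, h⟩ := exists_seminorm_enorm_gaborTransform_le (gaussianWindow (Rd d))
  refine ⟨q, hq, fun φ τ ν₀ σ f₁ f₂ s μ => ⟨fun g =>
    lintegral_enorm_rihaczekKernel_mul_le φ τ ν₀ σ f₁ f₂ g s μ fun x ν => ?_,
    lintegral_enorm_rihaczekKernel_mul_le φ τ ν₀ σ f₁ f₂ _ s μ fun x ν => ?_⟩⟩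
  · refine (h g x (-ν)).trans ?_
    rw [decayKernel_neg]
    calc _ ≤ ENNReal.ofReal (q g) * ((‖(1 + ‖s‖) ^ (d + 1)‖ₑ * decayKernel (s - x)) *
          (‖(1 + ‖μ‖) ^ (d + 1)‖ₑ * decayKernel (μ - ν))) := by
          gcongr
          · exact decayKernel_le x s
          · exact decayKernel_le ν μ
      _ = _ := by ring
  · rw [gaborTransform_timeFreqShift, enorm_mul, ← ofReal_norm (expTwoPiI _), norm_expTwoPiI,
      ENNReal.ofReal_one, one_mul, ← decayKernel_neg (s - x), neg_sub, sub_eq_neg_add μ]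
    exact h _ _ _

theorem rihaczekKernel_add_left (τ ν₀ : Rd d) (f₁ f₁' f₂ : 𝓢'(Rd d, ℂ)) (g : 𝓢(Rd d, ℂ))
    (z : SymbolPhase d) : rihaczekKernel τ ν₀ (f₁ + f₁') f₂ g z =
      rihaczekKernel τ ν₀ f₁ f₂ g z + rihaczekKernel τ ν₀ f₁' f₂ g z := by
  have h : ∀ w, modulatedGabor (f₁ + f₁') w = modulatedGabor f₁ w + modulatedGabor f₁' w :=
    fun w => mul_add _ _ _
  rw [rihaczekKernel, h, rihaczekKernel, rihaczekKernel]
  ring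

theorem rihaczekKernel_smul_left (τ ν₀ : Rd d) (a : ℂ) (f₁ f₂ : 𝓢'(Rd d, ℂ)) (g : 𝓢(Rd d, ℂ))
    (z : SymbolPhase d) : rihaczekKernel τ ν₀ (a • f₁) f₂ g z =
      a * rihaczekKernel τ ν₀ f₁ f₂ g z := by
  have h : ∀ w, modulatedGabor (a • f₁) w = a * modulatedGabor f₁ w :=
    fun w => mul_left_comm _ a _
  rw [rihaczekKernel, h, rihaczekKernel]
  ring

theorem rihaczekKernel_add_right (τ ν₀ : Rd d) (f₁ f₂ f₂' : 𝓢'(Rd d, ℂ)) (g : 𝓢(Rd d, ℂ))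
    (z : SymbolPhase d) : rihaczekKernel τ ν₀ f₁ (f₂ + f₂') g z =
      rihaczekKernel τ ν₀ f₁ f₂ g z + rihaczekKernel τ ν₀ f₁ f₂' g z := by
  have h : ∀ w, modulatedGabor (f₂ + f₂') w = modulatedGabor f₂ w + modulatedGabor f₂' w :=
    fun w => mul_add _ _ _
  rw [rihaczekKernel, h, rihaczekKernel, rihaczekKernel]
  ring

theorem rihaczekKernel_smul_right (τ ν₀ : Rd d) (a : ℂ) (f₁ f₂ : 𝓢'(Rd d, ℂ)) (g : 𝓢(Rd d, ℂ))
    (z : SymbolPhase d) : rihaczekKernel τ ν₀ f₁ (a • f₂) g z =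
      a * rihaczekKernel τ ν₀ f₁ f₂ g z := by
  have h : ∀ w, modulatedGabor (a • f₂) w = a * modulatedGabor f₂ w :=
    fun w => mul_left_comm _ a _
  rw [rihaczekKernel, h, rihaczekKernel]
  ring

theorem rihaczekKernel_add (τ ν₀ : Rd d) (f₁ f₂ : 𝓢'(Rd d, ℂ)) (g g' : 𝓢(Rd d, ℂ))
    (z : SymbolPhase d) : rihaczekKernel τ ν₀ f₁ f₂ (g + g') z =
      rihaczekKernel τ ν₀ f₁ f₂ g z + rihaczekKernel τ ν₀ f₁ f₂ g' z := by
  have h : ∀ t ν, gaborTransform (gaussianWindow (Rd d)) ((g + g' : 𝓢(Rd d, ℂ)) : 𝓢'(Rd d, ℂ)) t ν =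
      gaborTransform (gaussianWindow (Rd d)) (g : 𝓢'(Rd d, ℂ)) t ν +
        gaborTransform (gaussianWindow (Rd d)) (g' : 𝓢'(Rd d, ℂ)) t ν := fun t ν => by
    rw [map_add]; rfl
  rw [rihaczekKernel, h, rihaczekKernel, rihaczekKernel]
  ring

theorem rihaczekKernel_smul (τ ν₀ : Rd d) (a : ℂ) (f₁ f₂ : 𝓢'(Rd d, ℂ)) (g : 𝓢(Rd d, ℂ))
    (z : SymbolPhase d) : rihaczekKernel τ ν₀ f₁ f₂ (a • g) z =
      a * rihaczekKernel τ ν₀ f₁ f₂ g z := by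
  have h : ∀ t ν, gaborTransform (gaussianWindow (Rd d)) ((a • g : 𝓢(Rd d, ℂ)) : 𝓢'(Rd d, ℂ)) t ν =
      a * gaborTransform (gaussianWindow (Rd d)) (g : 𝓢'(Rd d, ℂ)) t ν := fun t ν => by
    rw [map_smul]; rfl
  rw [rihaczekKernel, h, rihaczekKernel]
  ring

theorem integrable_rihaczekKernel_mul {φ : 𝓢(Rd d, ℂ)} {τ ν₀ : Rd d}
    {σ : 𝓢'(Rd d × Rd d × Rd d, ℂ)} {f₁ f₂ : 𝓢'(Rd d, ℂ)}
    (h : ∃ s μ, symbolMajorant φ τ ν₀ σ f₁ f₂ s μ < ⊤) (g : 𝓢(Rd d, ℂ)) :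
    Integrable fun z => rihaczekKernel τ ν₀ f₁ f₂ g z * symbolTransform φ σ z := by
  obtain ⟨s, μ, h⟩ := h
  obtain ⟨q, -, hq⟩ := exists_lintegral_enorm_rihaczekKernel_mul_le d
  have hc := (continuous_rihaczekKernel τ ν₀ f₁ f₂ g).mul (continuous_symbolTransform φ σ)
  exact ⟨hc.aestronglyMeasurable, ((hq φ τ ν₀ σ f₁ f₂ s μ).1 g).trans_lt
    (ENNReal.mul_lt_top (ENNReal.mul_lt_top ENNReal.ofReal_lt_top
      (ENNReal.mul_lt_top enorm_lt_top enorm_lt_top)) h)⟩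

/-- The integral is linear in g and bounded by a continuous seminorm times the majorant at the one
point where it is finite. -/
theorem exists_temperedDistribution_eq_integral {φ : 𝓢(Rd d, ℂ)} {τ ν₀ : Rd d}
    {σ : 𝓢'(Rd d × Rd d × Rd d, ℂ)} {f₁ f₂ : 𝓢'(Rd d, ℂ)}
    (h : ∃ s μ, symbolMajorant φ τ ν₀ σ f₁ f₂ s μ < ⊤) : ∃ T : 𝓢'(Rd d, ℂ), ∀ g : 𝓢(Rd d, ℂ),
      T g = ∫ z, rihaczekKernel τ ν₀ f₁ f₂ g z * symbolTransform φ σ z := by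
  have hI := integrable_rihaczekKernel_mul h
  obtain ⟨s, μ, h⟩ := h
  obtain ⟨q, hqc, hq⟩ := exists_lintegral_enorm_rihaczekKernel_mul_le d
  obtain ⟨S, C, -, hC⟩ := Seminorm.bound_of_continuous (schwartz_withSeminorms ℂ (Rd d) ℂ) q hqc
  set K : ℝ≥0∞ := ‖(1 + ‖s‖) ^ (d + 1)‖ₑ * ‖(1 + ‖μ‖) ^ (d + 1)‖ₑ *
    symbolMajorant φ τ ν₀ σ f₁ f₂ s μ with hK
  have hKt : K < ⊤ := ENNReal.mul_lt_top (ENNReal.mul_lt_top enorm_lt_top enorm_lt_top) h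
  refine ⟨ContinuousLinearMap.toPointwiseConvergenceCLM ℂ (RingHom.id ℂ) _ _ (SchwartzMap.mkCLMtoNormedSpace
    (fun g => ∫ z, rihaczekKernel τ ν₀ f₁ f₂ g z * symbolTransform φ σ z)
    (fun g g' => ?_) (fun a g => ?_) ⟨S, K.toReal * C, by positivity, fun g => ?_⟩), fun g => rfl⟩
  · simp_rw [rihaczekKernel_add, add_mul]
    exact integral_add (hI g) (hI g')
  · simp_rw [rihaczekKernel_smul, mul_assoc]
    exact integral_const_mul a _
  · have h1 : ‖∫ z, rihaczekKernel τ ν₀ f₁ f₂ g z * symbolTransform φ σ z‖ₑ ≤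
        ENNReal.ofReal (q g) * K := by
      refine (enorm_integral_le_lintegral_enorm _).trans (((hq φ τ ν₀ σ f₁ f₂ s μ).1 g).trans_eq ?_)
      rw [hK, mul_assoc]
    have h2 := ENNReal.toReal_mono (ENNReal.mul_lt_top ENNReal.ofReal_lt_top hKt).ne h1
    rw [toReal_enorm, ENNReal.toReal_mul, ENNReal.toReal_ofReal (apply_nonneg _ _)] at h2
    calc _ ≤ q g * K.toReal := h2
      _ ≤ (C * S.sup (schwartzSeminormFamily ℂ (Rd d) ℂ) g) * K.toReal := by
          gcongr
          exact Seminorm.le_def.mp hC g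
      _ = _ := by ring

theorem eLpNorm_const_top {X : Type*} [MeasurableSpace X] {μ : Measure X} (hμ : μ ≠ 0)
    {p : ℝ≥0∞} (hp : p ≠ 0) : eLpNorm (fun _ : X => (⊤ : ℝ≥0∞)) p μ = ⊤ := by
  rw [eLpNorm_const _ hp hμ, enorm_eq_self, ENNReal.top_mul]
  rw [Ne, ENNReal.rpow_eq_zero_iff]
  rintro (⟨h0, -⟩ | ⟨-, h0⟩)
  · exact hμ (Measure.measure_univ_eq_zero.mp h0)
  · exact absurd h0 (not_lt.mpr (by positivity))

theorem exists_lt_top_of_eLpNorm_eLpNorm_lt_top {X Y : Type*} [MeasurableSpace X]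
    [MeasurableSpace Y] {μ : Measure X} {ν : Measure Y} (hμ : μ ≠ 0) (hν : ν ≠ 0) {p q : ℝ≥0∞}
    (hp : p ≠ 0) (hq : q ≠ 0) {F : X → Y → ℝ≥0∞}
    (h : eLpNorm (fun y => eLpNorm (fun x => F x y) p μ) q ν < ⊤) : ∃ x y, F x y < ⊤ := by
  by_contra! hF
  have hF' : ∀ x y, F x y = ⊤ := fun x y => top_le_iff.mp (hF x y)
  simp [hF', eLpNorm_const_top hμ hp, eLpNorm_const_top hν hq] at h

end Extension

/-! ### Norm bound and assembly of the bilinear extension. -/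

section Main

set_option synthInstance.maxSize 5000

/-- Testing the integral formula on shifted Gaussians bounds the short-time Fourier transform of T
pointwise by the majorant; K depends only on the Gaussian window. -/
theorem exists_modulationNorm_le_of_forall_eq_integral {d : ℕ} {φ : 𝓢(Rd d, ℂ)} {τ ν₀ : Rd d} :
    ∃ K : ℝ≥0, ∀ (σ : 𝓢'(Rd d × Rd d × Rd d, ℂ)) (f₁ f₂ T : 𝓢'(Rd d, ℂ)) (c : ℂ) (p q : ℝ≥0∞),
      (∀ g, T g = c * ∫ z, rihaczekKernel τ ν₀ f₁ f₂ g z * symbolTransform φ σ z) →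
      modulationNorm p q T ≤ ‖c‖₊ * K *
        eLpNorm (fun μ => eLpNorm (fun s => symbolMajorant φ τ ν₀ σ f₁ f₂ s μ) p volume) q volume := by
  obtain ⟨Q, -, hQ⟩ := exists_lintegral_enorm_rihaczekKernel_mul_le d
  set K : ℝ≥0 := (Q (gaussianWindow (Rd d))).toNNReal with hK
  refine ⟨K, fun σ f₁ f₂ T c p q hT => ?_⟩
  have h1 : ∀ s μ, ‖stft T s μ‖ₑ ≤ (‖c‖₊ * K : ℝ≥0) * symbolMajorant φ τ ν₀ σ f₁ f₂ s μ := by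
    intro s μ
    rw [stft, hT, enorm_mul, ENNReal.coe_mul, mul_assoc]
    gcongr
    · exact le_rfl
    exact (enorm_integral_le_lintegral_enorm _).trans (hQ φ τ ν₀ σ f₁ f₂ s μ).2
  have h2 : ∀ μ, eLpNorm (fun s => stft T s μ) p volume ≤ (‖c‖₊ * K : ℝ≥0) *
      eLpNorm (fun s => symbolMajorant φ τ ν₀ σ f₁ f₂ s μ) p volume := fun μ =>
    eLpNorm_le_nnreal_smul_eLpNorm_of_ae_le_mul' (Eventually.of_forall fun s => h1 s μ) p
  rw [← ENNReal.coe_mul]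
  exact eLpNorm_le_nnreal_smul_eLpNorm_of_ae_le_mul' (Eventually.of_forall h2) q

theorem theorem1p1 (d : ℕ) (p₀ p₁ p₂ q₁ q₂ q₃ : ℝ≥0∞)
    (hp₀ : 1 ≤ p₀) (hp₁ : 1 ≤ p₁) (hp₂ : 1 ≤ p₂)
    (hq₁ : 1 ≤ q₁) (hq₂ : 1 ≤ q₂) (hq₃ : 1 ≤ q₃)
    (hp : p₀⁻¹ ≤ p₁⁻¹ + p₂⁻¹) (hq : 1 + q₃⁻¹ ≤ q₁⁻¹ + q₂⁻¹)
    (φ : 𝓢(Rd d, ℂ)) (hφ : φ ≠ 0) :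
    ∃ C : ℝ≥0, 0 < C ∧ ∀ σ : 𝓢'(Rd d × Rd d × Rd d, ℂ), symbolNorm φ σ < ⊤ →
      ∃ T : modulationSpace d p₁ q₁ →ₗ[ℂ] modulationSpace d p₂ q₂ →ₗ[ℂ] modulationSpace d p₀ q₃,
        (∀ f₁ f₂ : 𝓢(Rd d, ℂ),
          ∃ (h₁ : (f₁ : 𝓢'(Rd d, ℂ)) ∈ modulationSpace d p₁ q₁)
            (h₂ : (f₂ : 𝓢'(Rd d, ℂ)) ∈ modulationSpace d p₂ q₂),
            (T ⟨f₁, h₁⟩ ⟨f₂, h₂⟩ : 𝓢'(Rd d, ℂ)) = bilinearPsiDO σ f₁ f₂) ∧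
        ∀ (f₁ : modulationSpace d p₁ q₁) (f₂ : modulationSpace d p₂ q₂),
          modulationNorm p₀ q₃ (T f₁ f₂ : 𝓢'(Rd d, ℂ)) ≤
            C * symbolNorm φ σ * modulationNorm p₁ q₁ (f₁ : 𝓢'(Rd d, ℂ)) *
              modulationNorm p₂ q₂ (f₂ : 𝓢'(Rd d, ℂ)) := by
  obtain ⟨τ, ν₀, hc⟩ := exists_integral_inversionDensity_ne_zero hφ
  set c : ℂ := ∫ w, inversionDensity φ τ ν₀ w
  obtain ⟨C, hC⟩ := exists_eLpNorm_symbolMajorant_le hp₀ hp₁ hp₂ hq₁ hq₂ hq₃ hp hq φ τ ν₀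
  obtain ⟨K, hK⟩ := exists_modulationNorm_le_of_forall_eq_integral (φ := φ) (τ := τ) (ν₀ := ν₀)
  -- The summand 1 only makes the constant positive.
  refine ⟨‖c⁻¹‖₊ * K * C + 1, by positivity, fun σ hσ => ?_⟩
  have hlt : ∀ (f₁ : modulationSpace d p₁ q₁) (f₂ : modulationSpace d p₂ q₂),
      C * symbolNorm φ σ * modulationNorm p₁ q₁ (f₁ : 𝓢'(Rd d, ℂ)) *
        modulationNorm p₂ q₂ (f₂ : 𝓢'(Rd d, ℂ)) < ⊤ := fun f₁ f₂ =>
    ENNReal.mul_lt_top (ENNReal.mul_lt_top (ENNReal.mul_lt_top ENNReal.coe_lt_top hσ)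
      (mem_modulationSpace.mp f₁.2)) (mem_modulationSpace.mp f₂.2)
  -- A finite mixed norm rules out a majorant that is infinite everywhere.
  have hex : ∀ (f₁ : modulationSpace d p₁ q₁) (f₂ : modulationSpace d p₂ q₂),
      ∃ s μ, symbolMajorant φ τ ν₀ σ f₁ f₂ s μ < ⊤ := fun f₁ f₂ =>
    exists_lt_top_of_eLpNorm_eLpNorm_lt_top (NeZero.ne volume) (NeZero.ne volume)
      (one_pos.trans_le hp₀).ne' (one_pos.trans_le hq₃).ne' ((hC σ f₁ f₂).trans_lt (hlt f₁ f₂))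
  choose A hA using fun f₁ f₂ => exists_temperedDistribution_eq_integral (hex f₁ f₂)
  have hT : ∀ f₁ f₂ g, (c⁻¹ • A f₁ f₂) g = c⁻¹ * ∫ z,
      rihaczekKernel τ ν₀ (f₁ : 𝓢'(Rd d, ℂ)) (f₂ : 𝓢'(Rd d, ℂ)) g z * symbolTransform φ σ z :=
    fun f₁ f₂ g => congrArg (c⁻¹ * ·) (hA f₁ f₂ g)
  have hbound := fun (f₁ : modulationSpace d p₁ q₁) (f₂ : modulationSpace d p₂ q₂) => (hK σ f₁ f₂ (c⁻¹ • A f₁ f₂) c⁻¹ p₀ q₃ (hT f₁ f₂)).trans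
    (mul_le_mul_right (hC σ f₁ f₂) _)
  have hmem : ∀ f₁ f₂, c⁻¹ • A f₁ f₂ ∈ modulationSpace d p₀ q₃ := fun f₁ f₂ =>
    mem_modulationSpace.mpr ((hbound f₁ f₂).trans_lt (ENNReal.mul_lt_top
      (ENNReal.mul_lt_top ENNReal.coe_lt_top ENNReal.coe_lt_top) (hlt f₁ f₂)))
  refine ⟨LinearMap.mk₂ ℂ (fun f₁ f₂ => ⟨c⁻¹ • A f₁ f₂, hmem f₁ f₂⟩) ?_ ?_ ?_ ?_, ?_, ?_⟩
  · intro f₁ f₁' f₂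
    refine Subtype.ext (UniformConvergenceCLM.ext _ _ fun g => ?_)
    change (c⁻¹ • A (f₁ + f₁') f₂) g = (c⁻¹ • A f₁ f₂) g + (c⁻¹ • A f₁' f₂) g
    rw [hT, hT, hT, ← mul_add, ← integral_add (integrable_rihaczekKernel_mul (hex f₁ f₂) g)
      (integrable_rihaczekKernel_mul (hex f₁' f₂) g)]
    simp_rw [Submodule.coe_add, rihaczekKernel_add_left, add_mul]
  · intro a f₁ f₂
    refine Subtype.ext (UniformConvergenceCLM.ext _ _ fun g => ?_)
    change (c⁻¹ • A (a • f₁) f₂) g = a * (c⁻¹ • A f₁ f₂) g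
    rw [hT, hT]
    simp_rw [Submodule.coe_smul, rihaczekKernel_smul_left, mul_assoc]
    rw [integral_const_mul, mul_left_comm]
  · intro f₁ f₂ f₂'
    refine Subtype.ext (UniformConvergenceCLM.ext _ _ fun g => ?_)
    change (c⁻¹ • A f₁ (f₂ + f₂')) g = (c⁻¹ • A f₁ f₂) g + (c⁻¹ • A f₁ f₂') g
    rw [hT, hT, hT, ← mul_add, ← integral_add (integrable_rihaczekKernel_mul (hex f₁ f₂) g)
      (integrable_rihaczekKernel_mul (hex f₁ f₂') g)]
    simp_rw [Submodule.coe_add, rihaczekKernel_add_right, add_mul]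
  · intro a f₁ f₂
    refine Subtype.ext (UniformConvergenceCLM.ext _ _ fun g => ?_)
    change (c⁻¹ • A f₁ (a • f₂)) g = a * (c⁻¹ • A f₁ f₂) g
    rw [hT, hT]
    simp_rw [Submodule.coe_smul, rihaczekKernel_smul_right, mul_assoc]
    rw [integral_const_mul, mul_left_comm]
  · intro f₁ f₂
    refine ⟨coe_mem_modulationSpace f₁ hp₁ hq₁, coe_mem_modulationSpace f₂ hp₂ hq₂,
      UniformConvergenceCLM.ext _ _ fun g => ?_⟩
    -- On Schwartz functions the defining integral is c times σ applied to R, by the reproducing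
    -- formula.
    refine (hT _ _ g).trans ?_
    rw [bilinearPsiDO_apply, ← apply_rihaczekCLM_eq_integral, inv_mul_cancel_left₀ hc]
  · intro f₁ f₂
    refine (hbound f₁ f₂).trans ?_
    push_cast
    rw [← mul_assoc, ← mul_assoc, ← mul_assoc]
    gcongr
    exact le_self_add

end Main

end
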